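/- \textbf{Setting.} Write $\mathcal F_x\phi(\xi)=\int_{\mathbb R}e^{-ix\xi}\phi(x)\,dx$, let $\mathcal F$ be the Fourier transform in $(x,t)$ (dual variables $(\xi,\tau)$) on $\mathcal S'(\mathbb R\times\mathbb R)$, and let $\omega(\xi)=-\xi|\xi|$. Call $\eta:\mathbb R\to[0,1]$ a \emph{cutoff} if it is even, smooth, supported in $[-8/5,8/5]$ and equal to $1$ on $[-5/4,5/4]$. Fix cutoffs $\eta_0$ and $\psi$. Put $\chi_\ell(\xi)=\eta_0(\xi/2^\ell)-\eta_0(\xi/2^{\ell-1})$ for $\ell\in\mathbb Z$ and $\eta_k=\chi_k$ for $k\ge1$. Let $\widetilde I_0=[-2,2]$, $\widetilde I_l=\{\xi:2^{l-1}\le|\xi|\le2^{l+1}\}$ for $l\ge1$, and $D_{k,j}=\{(\xi,\tau):\xi\in\widetilde I_k,\ \tau-\omega(\xi)\in\widetilde I_j\}$ for $k\ge1$, $j\ge 0$. For $f\in L^2(\mathbb R)$ supported in $[-2,2]$ let $$\|f\|_{B_0}=\inf_{f=g+h}\Big(\|\mathcal F_\xi^{-1}g\|_{L^1_x}+\sum_{k'\le1}2^{-k'/2}\|\chi_{k'}h\|_{L^2}\Big),$$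 and for $\sigma\ge0$ let $\widetilde H^\sigma$ be the space of $\phi\in L^2(\mathbb R)$ with $$\|\phi\|_{\widetilde H^\sigma}^2=\|\eta_0\mathcal F_x\phi\|_{B_0}^2+\sum_{k\ge1}2^{2\sigma k}\|\eta_k\mathcal F_x\phi\|_{L^2}^2<\infty .$$ For $f\in L^2(\mathbb R^2)$ supported in $\widetilde I_k\times\mathbb R$ let $$\|f\|_{X_k}=\sum_{j\ge0}2^{j/2}\big(1+2^{(j-2k)/2}\big)\|\eta_j(\tau-\omega(\xi))f\|_{L^2}\quad(k\ge1),\qquad \|f\|_{X_0}=\sum_{j\ge0}\sum_{k'\le1}2^{j-k'/2}\|\eta_j(\tau)\chi_{k'}(\xi)f\|_{L^2}.$$ For $k\ge100$ and $f\in L^2(\mathbb R^2)$ supported in $\bigcup_{j=0}^{k-1}D_{k,j}$ let $\|f\|_{Y_k}=2^{-k/2}\|\mathcal F^{-1}[(\tau-\omega(\xi)+i)f]\|_{L^1_xL^2_t}$, and for $f\in L^2(\mathbb R^2)$ supported in $\widetilde I_0\times\mathbb R$ let $$\|f\|_{Y_0}=\sum_{j\ge1}2^j\|\mathcal F^{-1}[\eta_j(\tau)f]\|_{L^1_xL^2_t}+\sum_{j\le0}\|\mathcal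 F^{-1}[\chi_j(\tau)f]\|_{L^1_xL^2_t}.$$ Let $Z_k=X_k$ for $1\le k\le99$ and $Z_k=X_k+Y_k$ (with the sum-space norm) for $k=0$ and $k\ge100$. For $\sigma\ge0$ and $u\in\mathcal S'(\mathbb R\times\mathbb R)$ let $$\|u\|_{F^\sigma}^2=\sum_{k\ge0}2^{2\sigma k}\|\eta_k(\xi)(I-\partial_\tau^2)\mathcal F u\|_{Z_k}^2 .$$ For $\epsilon\in[0,1]$, $t\in\mathbb R$ and $\phi\in L^2(\mathbb R)$ let $$W_\epsilon(t)\phi=\mathcal F_\xi^{-1}\big[e^{it\omega(\xi)-|t|\epsilon\xi^2}\mathcal F_x\phi\big]$$ be the free Benjamin--Ono--Burgers evolution (for $t\ge0$), extended to $t<0$ as a curve in $C(\mathbb R;L^2)$. \textbf{Lemma.} There is a constant $C$, depending only on the cutoffs $\eta_0,\psi$, such that for all $\sigma\ge0$, all $\epsilon\in[0,1]$ and all $\phi\in\widetilde H^\sigma$, $$\|\psi(t)\,W_\epsilon(t)\phi\|_{F^\sigma}\le C\|\phi\|_{\widetilde H^\sigma}.$$ In particular $C$ does not depend on $\epsilon$.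 -/

import Mathlib

open MeasureTheory Set Filter Topology
open scoped ENNReal NNReal SchwartzMap FourierTransform LineDeriv ContDiff

noncomputable section

namespace BOB

/-- The Euclidean plane, carrying the variables `(x, t)` or `(ξ, τ)`; the first coordinate is
`p.fst`, the second one is `p.snd`. -/
abbrev Plane : Type := WithLp 2 (ℝ × ℝ)

/-- The point of the plane with the given coordinates. -/
abbrev pt (x t : ℝ) : Plane := WithLp.toLp 2 (x, t)

/-- Complex-valued `L²` functions (modulo null sets) for Lebesgue measure. -/
abbrev L2 (E : Type) [MeasureSpace E] : Type := Lp ℂ 2 (volume : Measure E)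

/-! ### The Fourier transform with kernel `exp (-i x·ξ)`

Mathlib's transform `𝓕` has the kernel `exp (-2πi x·ξ)`, so the transform used here is
`ξ ↦ (𝓕 f) (ξ / 2π)`, and its inverse is `x ↦ (2π)^(-d) (𝓕⁻ g) (x / 2π)`. -/

section Fourier

variable (E : Type) [NormedAddCommGroup E] [InnerProductSpace ℝ E] [FiniteDimensional ℝ E]
  [MeasurableSpace E] [BorelSpace E]

lemma two_pi_inv_ne_zero : ((2 * Real.pi)⁻¹ : ℝ) ≠ 0 := by positivity

lemma aux_eLpNorm_dilate {f : E → ℂ} (hf : AEStronglyMeasurable f volume) {c : ℝ} (hc : c ≠ 0) :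
    eLpNorm (fun x => f (c • x)) 2 volume
      = (ENNReal.ofReal (abs (c ^ Module.finrank ℝ E)⁻¹)) ^ (1 / 2 : ℝ) * eLpNorm f 2 volume := by
  have hm : Measure.map (fun x : E => c • x) volume
      = ENNReal.ofReal (abs (c ^ Module.finrank ℝ E)⁻¹) • (volume : Measure E) :=
    Measure.map_addHaar_smul volume hc
  have hf' : AEStronglyMeasurable f (Measure.map (fun x : E => c • x) volume) := by
    rw [hm]; exact hf.smul_measure _
  have h1 : eLpNorm (f ∘ fun x : E => c • x) 2 volume
      = eLpNorm f 2 (Measure.map (fun x : E => c • x) volume) :=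
    (eLpNorm_map_measure hf' (by fun_prop)).symm
  rw [hm, eLpNorm_smul_measure_of_ne_top (by simp)] at h1
  simpa [Function.comp_def] using h1

lemma aux_memLp_dilate {f : E → ℂ} (hf : MemLp f 2 volume) {c : ℝ} (hc : c ≠ 0) :
    MemLp (fun x => f (c • x)) 2 volume := by
  refine ⟨?_, ?_⟩
  · have hm : Measure.map (fun x : E => c • x) volume
        = ENNReal.ofReal (abs (c ^ Module.finrank ℝ E)⁻¹) • (volume : Measure E) :=
      Measure.map_addHaar_smul volume hc
    have hf' : AEStronglyMeasurable f (Measure.map (fun x : E => c • x) volume) := by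
      rw [hm]; exact hf.1.smul_measure _
    exact hf'.comp_aemeasurable (by fun_prop)
  · rw [aux_eLpNorm_dilate E hf.1 hc]
    exact ENNReal.mul_lt_top (ENNReal.rpow_lt_top_of_nonneg (by norm_num) ENNReal.ofReal_ne_top)
      hf.2

lemma aux_ae_dilate {p : E → Prop} (hp : ∀ᵐ x, p x) {c : ℝ} (hc : c ≠ 0) :
    ∀ᵐ x : E, p (c • x) := by
  have hm : Measure.map (fun x : E => c • x) volume
      = ENNReal.ofReal (abs (c ^ Module.finrank ℝ E)⁻¹) • (volume : Measure E) :=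
    Measure.map_addHaar_smul volume hc
  refine ae_of_ae_map (f := fun x : E => c • x) (by fun_prop) ?_
  rw [hm]
  exact Measure.ae_smul_measure hp _

/-- The dilation `f ↦ f (c ·)` on `L²`. -/
def dilate (c : ℝ) (hc : c ≠ 0) : L2 E →L[ℂ] L2 E :=
  LinearMap.mkContinuous
    { toFun := fun f => (aux_memLp_dilate E (Lp.memLp f) hc).toLp (fun x => f (c • x))
      map_add' := by
        intro f g
        apply Lp.ext
        filter_upwards [MemLp.coeFn_toLp (aux_memLp_dilate E (Lp.memLp (f + g)) hc),
          MemLp.coeFn_toLp (aux_memLp_dilate E (Lp.memLp f) hc),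
          MemLp.coeFn_toLp (aux_memLp_dilate E (Lp.memLp g) hc),
          aux_ae_dilate E (Lp.coeFn_add f g) hc,
          Lp.coeFn_add ((aux_memLp_dilate E (Lp.memLp f) hc).toLp (fun x => f (c • x)))
            ((aux_memLp_dilate E (Lp.memLp g) hc).toLp (fun x => g (c • x)))]
          with x h1 h2 h3 h4 h5
        rw [h1, h5, Pi.add_apply, h2, h3, h4, Pi.add_apply]
      map_smul' := by
        intro a f
        apply Lp.ext
        filter_upwards [MemLp.coeFn_toLp (aux_memLp_dilate E (Lp.memLp (a • f)) hc),
          MemLp.coeFn_toLp (aux_memLp_dilate E (Lp.memLp f) hc),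
          aux_ae_dilate E (Lp.coeFn_smul a f) hc,
          Lp.coeFn_smul a ((aux_memLp_dilate E (Lp.memLp f) hc).toLp (fun x => f (c • x)))]
          with x h1 h2 h4 h5
        rw [h1, RingHom.id_apply, h5, Pi.smul_apply, h2, h4, Pi.smul_apply] }
    (((ENNReal.ofReal (abs (c ^ Module.finrank ℝ E)⁻¹)) ^ (1 / 2 : ℝ)).toReal)
    (by
      intro f
      change ‖(aux_memLp_dilate E (Lp.memLp f) hc).toLp (fun x => f (c • x))‖ ≤ _
      rw [Lp.norm_toLp, aux_eLpNorm_dilate E (Lp.memLp f).1 hc, ENNReal.toReal_mul, Lp.norm_def])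

/-- The Fourier transform on `L²`, with kernel `exp (-i x·ξ)`. -/
def fourierL2 : L2 E →L[ℂ] L2 E :=
  dilate E (2 * Real.pi)⁻¹ two_pi_inv_ne_zero ∘L FourierTransform.fourierCLM ℂ (L2 E)

/-- The inverse Fourier transform on `L²`: `(2π)^(-d) ∫ exp (i x·ξ) g(ξ) dξ`. -/
def fourierInvL2 : L2 E →L[ℂ] L2 E :=
  (((2 * Real.pi) ^ Module.finrank ℝ E)⁻¹ : ℂ) •
    (dilate E (2 * Real.pi)⁻¹ two_pi_inv_ne_zero ∘L FourierTransform.fourierInvCLM ℂ (L2 E))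

/-- The Fourier transform `Φ ↦ ∫ exp (-i x·ξ) Φ(ξ) dξ` on Schwartz functions. -/
def fourierSchwartz : 𝓢(E, ℂ) →L[ℂ] 𝓢(E, ℂ) :=
  SchwartzMap.compCLMOfContinuousLinearEquiv ℂ
    (ContinuousLinearEquiv.smulLeft (R₁ := ℝ) (M₁ := E)
      (Units.mk0 ((2 * Real.pi)⁻¹ : ℝ) two_pi_inv_ne_zero)) ∘L FourierTransform.fourierCLM ℂ 𝓢(E, ℂ)

/-- The Fourier transform of a tempered distribution, by duality. -/
def fourierDist : 𝓢'(E, ℂ) →L[ℂ] 𝓢'(E, ℂ) :=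
  PointwiseConvergenceCLM.precomp ℂ (fourierSchwartz E)

end Fourier

/-- The Fourier transform of an integrable function on the line. -/
def fourierL1 (G : ℝ → ℂ) (ξ : ℝ) : ℂ := ∫ x : ℝ, Complex.exp (-(Complex.I * x * ξ)) * G x

/-! ### Dyadic decomposition -/

/-- The even smooth cutoffs `ℝ → [0,1]`, supported in `[-8/5, 8/5]` and equal to `1` on
`[-5/4, 5/4]`. -/
structure IsCutoff (η : ℝ → ℝ) : Prop where
  smooth : ContDiff ℝ ∞ η
  even : ∀ x, η (-x) = η x
  mem_Icc : ∀ x, η x ∈ Icc (0 : ℝ) 1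
  supp : tsupport η ⊆ Icc (-(8 / 5)) (8 / 5)
  eq_one : ∀ x ∈ Icc (-(5 / 4) : ℝ) (5 / 4), η x = 1

lemma IsCutoff.hasCompactSupport {η : ℝ → ℝ} (hη : IsCutoff η) : HasCompactSupport η :=
  isCompact_Icc.of_isClosed_subset (isClosed_tsupport η) hη.supp

/-- `χ_ℓ(ξ) = η₀(ξ/2^ℓ) - η₀(ξ/2^(ℓ-1))`, `ℓ ∈ ℤ`. -/
def chi (η₀ : ℝ → ℝ) (l : ℤ) (ξ : ℝ) : ℝ := η₀ (ξ / 2 ^ l) - η₀ (ξ / 2 ^ (l - 1))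

/-- `η_k`, `k ≥ 0`: the given cutoff for `k = 0`, and `χ_k` for `k ≥ 1`. -/
def eta (η₀ : ℝ → ℝ) (k : ℕ) (ξ : ℝ) : ℝ := if k = 0 then η₀ ξ else chi η₀ k ξ

lemma contDiff_eta {η₀ : ℝ → ℝ} (h : IsCutoff η₀) (k : ℕ) : ContDiff ℝ ∞ (eta η₀ k) := by
  have := h.smooth
  unfold eta chi
  split_ifs <;> fun_prop

/-- Multiplication of tempered distributions on the plane by `η_k(ξ)` is legitimate. -/
lemma hasTemperateGrowth_eta {η₀ : ℝ → ℝ} (h : IsCutoff η₀) (k : ℕ) :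
    (fun p : Plane => (eta η₀ k p.fst : ℂ)).HasTemperateGrowth := by
  have hdil : ∀ c : ℝ, 0 < c → HasCompactSupport fun ξ => η₀ (ξ / c) := by
    intro c hc
    have := h.hasCompactSupport.comp_homeomorph (Homeomorph.mulRight₀ c⁻¹ (by positivity))
    simpa [Function.comp_def, div_eq_mul_inv] using this
  have hs : HasCompactSupport (eta η₀ k) := by
    by_cases hk : k = 0
    · have : eta η₀ k = η₀ := by ext; simp [eta, hk]
      rw [this]; exact h.hasCompactSupport
    · have : eta η₀ k = (fun ξ => η₀ (ξ / 2 ^ (k : ℤ))) - fun ξ => η₀ (ξ / 2 ^ ((k : ℤ) - 1)) := by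
        ext; simp [eta, chi, hk]
      rw [this]
      exact (hdil _ (by positivity)).sub (hdil _ (by positivity))
  have h1 : (eta η₀ k).HasTemperateGrowth :=
    (hs.toSchwartzMap (contDiff_eta h k)).hasTemperateGrowth
  have h2 : (fun p : Plane => p.fst).HasTemperateGrowth :=
    (WithLp.fstL 2 ℝ ℝ ℝ).hasTemperateGrowth
  have h3 : (fun p : Plane => eta η₀ k p.fst).HasTemperateGrowth := h1.comp h2
  exact Complex.ofRealCLM.hasTemperateGrowth.comp h3

/-- The dispersion relation `ω(ξ) = -ξ|ξ|`. -/
def omega (ξ : ℝ) : ℝ := -ξ * |ξ|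

/-- `Ĩ_0 = [-2,2]`, and `Ĩ_l = I_l = {2^(l-1) ≤ |ξ| ≤ 2^(l+1)}` for `l ≥ 1`. -/
def Itilde (l : ℕ) : Set ℝ :=
  if l = 0 then Icc (-2) 2 else {ξ | (2 : ℝ) ^ ((l : ℤ) - 1) ≤ |ξ| ∧ |ξ| ≤ (2 : ℝ) ^ ((l : ℤ) + 1)}

/-- `D_{k,j}` for `k ≥ 1`. -/
def D (k j : ℕ) : Set Plane := {p | p.fst ∈ Itilde k ∧ p.snd - omega p.fst ∈ Itilde j}

/-- `β_{k,j} = 1 + 2^((j-2k)/2)`. -/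
def beta (k j : ℕ) : ℝ≥0∞ := 1 + (2 : ℝ≥0∞) ^ (((j : ℝ) - 2 * k) / 2)

/-! ### The spaces `B₀`, `X_k`, `Y_k`, `Z_k`

All norms take values in `[0, ∞]`; a space consists of the elements of finite norm. Since the sets
are closed, "supported in `S`" means vanishing almost everywhere outside `S`. -/

/-- The norm `‖𝓕⁻¹ g‖_{L¹_x L²_t}` of the inverse transform of an `L²` function `g` on the plane
(infinite if `g` is not in `L²`). -/
def invL1L2 (g : Plane → ℂ) : ℝ≥0∞ :=
  open Classical in
  if h : MemLp g 2 volume then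
    ∫⁻ x : ℝ, (∫⁻ t : ℝ, ‖(fourierInvL2 Plane (h.toLp g)) (pt x t)‖ₑ ^ 2) ^ (1 / 2 : ℝ)
  else ∞

/-- The norm of `B₀`. The infimum is over the decompositions `f = g + h` with `g = 𝓕 G`, `G ∈ L¹`.
The summation index `m ∈ ℕ` stands for `k' = 1 - m`. -/
def normB0 (η₀ : ℝ → ℝ) (f : ℝ → ℂ) : ℝ≥0∞ :=
  open Classical in
  if MemLp f 2 volume ∧ ∀ᵐ ξ : ℝ, ξ ∉ Itilde 0 → f ξ = 0 then
    ⨅ (G : ℝ → ℂ) (h : ℝ → ℂ) (_ : Integrable G) (_ : f =ᵐ[volume] fourierL1 G + h),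
      (eLpNorm G 1 volume + ∑' m : ℕ, (2 : ℝ≥0∞) ^ (-(1 - (m : ℝ)) / 2) *
        eLpNorm (fun ξ => (chi η₀ (1 - (m : ℤ)) ξ : ℂ) * h ξ) 2 volume)
  else ∞

/-- The norm of `X_k`. In `X₀` the index `m ∈ ℕ` stands for `k' = 1 - m`. -/
def normX (η₀ : ℝ → ℝ) (k : ℕ) (f : L2 Plane) : ℝ≥0∞ :=
  open Classical in
  if ∀ᵐ p : Plane, p.fst ∉ Itilde k → f p = 0 then
    if k = 0 then
      ∑' j : ℕ, ∑' m : ℕ, (2 : ℝ≥0∞) ^ ((j : ℝ) - (1 - (m : ℝ)) / 2) *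
        eLpNorm (fun p : Plane =>
          (eta η₀ j p.snd : ℂ) * (chi η₀ (1 - (m : ℤ)) p.fst : ℂ) * f p) 2 volume
    else
      ∑' j : ℕ, (2 : ℝ≥0∞) ^ ((j : ℝ) / 2) * beta k j *
        eLpNorm (fun p : Plane => (eta η₀ j (p.snd - omega p.fst) : ℂ) * f p) 2 volume
  else ∞

/-- The norm of `Y₀`. The index `m ∈ ℕ` stands for `j = m + 1 ≥ 1` in the first sum, and for
`j = -m ≤ 0` in the second one. -/
def normY0 (η₀ : ℝ → ℝ) (f : L2 Plane) : ℝ≥0∞ :=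
  open Classical in
  if ∀ᵐ p : Plane, p.fst ∉ Itilde 0 → f p = 0 then
    (∑' m : ℕ, (2 : ℝ≥0∞) ^ (m + 1) * invL1L2 (fun p => (eta η₀ (m + 1) p.snd : ℂ) * f p))
      + ∑' m : ℕ, invL1L2 (fun p => (chi η₀ (-(m : ℤ)) p.snd : ℂ) * f p)
  else ∞

/-- The norm of `Y_k`, used for `k ≥ 100`. -/
def normYHigh (k : ℕ) (f : L2 Plane) : ℝ≥0∞ :=
  open Classical in
  if ∀ᵐ p : Plane, p ∉ ⋃ j ∈ Finset.range k, D k j → f p = 0 then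
    (2 : ℝ≥0∞) ^ (-(k : ℝ) / 2) *
      invL1L2 (fun p => (((p.snd - omega p.fst : ℝ) : ℂ) + Complex.I) * f p)
  else ∞

/-- The norm of `Z_k`: `X_k` if `1 ≤ k ≤ 99`, and the sum space `X_k + Y_k` otherwise. -/
def normZ (η₀ : ℝ → ℝ) (k : ℕ) (f : L2 Plane) : ℝ≥0∞ :=
  if 1 ≤ k ∧ k ≤ 99 then normX η₀ k f
  else ⨅ (g : L2 Plane) (h : L2 Plane) (_ : f = g + h),
    (normX η₀ k g + if k = 0 then normY0 η₀ h else normYHigh k h)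

/-- The `Z_k` norm of a tempered distribution, infinite if it is not given by an `L²` function. -/
def normZDist (η₀ : ℝ → ℝ) (k : ℕ) (T : 𝓢'(Plane, ℂ)) : ℝ≥0∞ :=
  ⨅ (f : L2 Plane) (_ : Lp.toTemperedDistribution f = T), normZ η₀ k f

/-! ### The spaces `H̃^σ` and `F^σ` -/

/-- The norm of `H̃^σ`; the index `m ∈ ℕ` stands for `k = m + 1 ≥ 1`. -/
def normHtilde (η₀ : ℝ → ℝ) (σ : ℝ) (φ : L2 ℝ) : ℝ≥0∞ :=
  (normB0 η₀ (fun ξ => (eta η₀ 0 ξ : ℂ) * fourierL2 ℝ φ ξ) ^ 2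
    + ∑' m : ℕ, (2 : ℝ≥0∞) ^ (2 * σ * ((m : ℝ) + 1)) *
        eLpNorm (fun ξ => (eta η₀ (m + 1) ξ : ℂ) * fourierL2 ℝ φ ξ) 2 volume ^ 2) ^ (1 / 2 : ℝ)

/-- The operator `I - ∂_τ²` on tempered distributions in the variables `(ξ, τ)`. -/
def oneSubDtauSq (T : 𝓢'(Plane, ℂ)) : 𝓢'(Plane, ℂ) := T - ∂_{pt 0 1} (∂_{pt 0 1} T)

/-- The norm of `F^σ` on tempered distributions in the variables `(x, t)`. -/
def normF (η₀ : ℝ → ℝ) (σ : ℝ) (u : 𝓢'(Plane, ℂ)) : ℝ≥0∞ :=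
  (∑' k : ℕ, (2 : ℝ≥0∞) ^ (2 * σ * (k : ℝ)) *
    normZDist η₀ k (TemperedDistribution.smulLeftCLM ℂ (fun p : Plane => (eta η₀ k p.fst : ℂ))
      (oneSubDtauSq (fourierDist Plane u))) ^ 2) ^ (1 / 2 : ℝ)

/-! ### The free evolution -/

/-- The symbol `exp (i t ω(ξ) - |t| ε ξ²)`. -/
def symbol (ε t ξ : ℝ) : ℂ :=
  Complex.exp (Complex.I * ((t * omega ξ : ℝ) : ℂ) - ((|t| * ε * ξ ^ 2 : ℝ) : ℂ))

lemma norm_symbol_le {ε : ℝ} (hε : 0 ≤ ε) (t ξ : ℝ) : ‖symbol ε t ξ‖ ≤ 1 := by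
  rw [symbol, Complex.norm_exp, Real.exp_le_one_iff]
  have h : 0 ≤ |t| * ε * ξ ^ 2 := by positivity
  simp only [Complex.sub_re, Complex.mul_re, Complex.I_re, Complex.I_im, Complex.ofReal_re,
    Complex.ofReal_im]
  linarith

lemma continuous_symbol (ε : ℝ) : Continuous fun q : ℝ × ℝ => symbol ε q.1 q.2 := by
  unfold symbol omega
  fun_prop

lemma memLp_symbol_mul {ε : ℝ} (hε : 0 ≤ ε) (t : ℝ) (g : L2 ℝ) :
    MemLp (fun ξ => symbol ε t ξ * g ξ) 2 volume := by
  have hc : Continuous fun ξ => symbol ε t ξ :=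
    (continuous_symbol ε).comp (by fun_prop : Continuous fun ξ : ℝ => (t, ξ))
  refine (Lp.memLp g).of_le (hc.aestronglyMeasurable.mul (Lp.memLp g).1) ?_
  refine Eventually.of_forall fun ξ => ?_
  rw [norm_mul]
  exact mul_le_of_le_one_left (norm_nonneg _) (norm_symbol_le hε t ξ)

/-- The free evolution `W_ε(t)φ`, the Fourier multiplier with the above symbol. -/
def W (ε : ℝ) (hε : 0 ≤ ε) (t : ℝ) (φ : L2 ℝ) : L2 ℝ :=
  fourierInvL2 ℝ ((memLp_symbol_mul hε t (fourierL2 ℝ φ)).toLp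
    (fun ξ => symbol ε t ξ * fourierL2 ℝ φ ξ))

lemma continuous_toLp_of_dominated {f : ℝ → ℝ → ℂ} (hf : ∀ t, MemLp (f t) 2 volume) {g : ℝ → ℝ}
    (hg : MemLp g 2 volume) (hb : ∀ t x, ‖f t x‖ ≤ g x) (hc : ∀ x, Continuous fun t => f t x) :
    Continuous fun t => (hf t).toLp (f t) := by
  rw [continuous_iff_seqContinuous]
  intro s a hs
  have key : Tendsto (fun n => eLpNorm (f (s n) - f a) 2 volume) atTop (𝓝 0) := by
    have hI : Tendsto (fun n => ∫⁻ x, ‖(f (s n) - f a) x‖ₑ ^ (2 : ℝ)) atTop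
        (𝓝 (∫⁻ _ : ℝ, (0 : ℝ≥0∞))) := by
      refine tendsto_lintegral_of_dominated_convergence' (fun x => (2 * ‖g x‖ₑ) ^ (2 : ℝ)) ?_ ?_ ?_ ?_
      · intro n
        exact ((hf (s n)).1.sub (hf a).1).enorm.pow_const _
      · intro n
        refine Eventually.of_forall fun x => ?_
        refine ENNReal.rpow_le_rpow ?_ (by norm_num)
        have h1 : ∀ t, ‖f t x‖ₑ ≤ ‖g x‖ₑ := by
          intro t
          rw [enorm_le_iff_norm_le]
          exact (hb t x).trans (Real.le_norm_self _)
        calc ‖(f (s n) - f a) x‖ₑ ≤ ‖f (s n) x‖ₑ + ‖f a x‖ₑ := enorm_sub_le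
          _ ≤ ‖g x‖ₑ + ‖g x‖ₑ := add_le_add (h1 _) (h1 _)
          _ = 2 * ‖g x‖ₑ := (two_mul _).symm
      · have h2 : MemLp (fun x => (2 : ℝ) * g x) 2 volume := hg.const_mul 2
        have h3 := lintegral_rpow_enorm_lt_top_of_eLpNorm_lt_top (p := 2) (by norm_num) (by norm_num) h2.2
        have h4 : ‖(2 : ℝ)‖ₑ = 2 := by
          rw [Real.enorm_eq_ofReal (by norm_num)]; norm_num
        simpa [enorm_mul, h4] using h3.ne
      · refine Eventually.of_forall fun x => ?_
        have h1 : Tendsto (fun n => f (s n) x - f a x) atTop (𝓝 0) := by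
          have := ((hc x).tendsto a).comp hs
          simpa using this.sub_const (f a x)
        have h2 := (continuous_enorm.tendsto _).comp h1
        have h3 := ((ENNReal.continuous_rpow_const (y := (2 : ℝ))).tendsto _).comp h2
        simpa [Function.comp_def] using h3
    have h2 := ((ENNReal.continuous_rpow_const (y := (1 / 2 : ℝ))).tendsto _).comp hI
    simp only [lintegral_zero] at h2
    rw [ENNReal.zero_rpow_of_pos (by norm_num)] at h2
    refine h2.congr fun n => ?_
    rw [eLpNorm_eq_lintegral_rpow_enorm_toReal (by norm_num) (by norm_num)]
    simp
  exact (Lp.tendsto_Lp_iff_tendsto_eLpNorm'' (fun n => f (s n)) (fun n => hf (s n)) (f a)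
    (hf a)).2 key

lemma continuous_W (ε : ℝ) (hε : 0 ≤ ε) (φ : L2 ℝ) : Continuous fun t => W ε hε t φ := by
  refine (fourierInvL2 ℝ).continuous.comp ?_
  refine continuous_toLp_of_dominated (f := fun t ξ => symbol ε t ξ * fourierL2 ℝ φ ξ)
    (fun t => memLp_symbol_mul hε t _) (g := fun ξ => ‖fourierL2 ℝ φ ξ‖)
    (Lp.memLp (fourierL2 ℝ φ)).norm ?_ ?_
  · intro t ξ
    rw [norm_mul]
    exact mul_le_of_le_one_left (norm_nonneg _) (norm_symbol_le hε t ξ)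
  · intro ξ
    exact ((continuous_symbol ε).comp (by fun_prop : Continuous fun t : ℝ => (t, ξ))).mul
      continuous_const

/-! ### Curves in `L²` as tempered distributions -/

/-- A rapidly decaying majorant of the slices of a Schwartz function. -/
def sliceBound (x : ℝ) : ℝ := (1 + x ^ 2)⁻¹

lemma memLp_sliceBound : MemLp sliceBound 2 volume := by
  have hm : AEStronglyMeasurable sliceBound volume := by
    have : Continuous sliceBound := by
      unfold sliceBound
      exact Continuous.inv₀ (by fun_prop) (fun x => by positivity)
    exact this.aestronglyMeasurable
  rw [memLp_two_iff_integrable_sq hm]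
  refine Integrable.mono' integrable_inv_one_add_sq (hm.pow 2) ?_
  refine Eventually.of_forall fun x => ?_
  have h0 : 0 ≤ sliceBound x := by unfold sliceBound; positivity
  have h1 : sliceBound x ≤ 1 := by
    unfold sliceBound
    exact inv_le_one_of_one_le₀ (by nlinarith [sq_nonneg x])
  rw [Real.norm_of_nonneg (by positivity)]
  calc sliceBound x ^ 2 = sliceBound x * sliceBound x := by ring
    _ ≤ 1 * sliceBound x := by gcongr
    _ = (1 + x ^ 2)⁻¹ := one_mul _

lemma norm_slice_le (Φ : 𝓢(Plane, ℂ)) (x t : ℝ) :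
    ‖Φ (pt x t)‖ ≤ (4 * ((Finset.Iic ((2, 0) : ℕ × ℕ)).sup
      (schwartzSeminormFamily ℂ Plane ℂ)) Φ) * sliceBound x := by
  have h := SchwartzMap.one_add_le_sup_seminorm_apply (𝕜 := ℂ) (m := (2, 0)) (k := 2) (n := 0)
    le_rfl le_rfl Φ (pt x t)
  rw [norm_iteratedFDeriv_zero] at h
  have hx : |x| ≤ ‖pt x t‖ := by
    have := WithLp.prod_norm_sq_eq_of_L2 (pt x t)
    have h3 : ‖pt x t‖ ^ 2 = |x| ^ 2 + |t| ^ 2 := this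
    exact abs_le_of_sq_le_sq' (by nlinarith [sq_nonneg |t|]) (norm_nonneg _) |>.2
  have h2 : 1 + x ^ 2 ≤ (1 + ‖pt x t‖) ^ 2 := by
    have := abs_nonneg x
    nlinarith [sq_abs x]
  unfold sliceBound
  rw [← div_eq_mul_inv, le_div_iff₀ (by positivity), mul_comm]
  refine (mul_le_mul_of_nonneg_right h2 (norm_nonneg _)).trans (h.trans (le_of_eq ?_))
  norm_num
  rfl

lemma memLp_slice (Φ : 𝓢(Plane, ℂ)) (t : ℝ) : MemLp (fun x : ℝ => Φ (pt x t)) 2 volume := by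
  have hc : Continuous fun x : ℝ => Φ (pt x t) := by
    have : Continuous fun x : ℝ => pt x t := by unfold pt; fun_prop
    exact Φ.continuous.comp this
  refine (memLp_sliceBound.const_mul _).of_le hc.aestronglyMeasurable
    (Eventually.of_forall fun x => (norm_slice_le Φ x t).trans (Real.le_norm_self _))

lemma continuous_slice (Φ : 𝓢(Plane, ℂ)) :
    Continuous fun t => (memLp_slice Φ t).toLp (fun x : ℝ => Φ (pt x t)) := by
  refine continuous_toLp_of_dominated (f := fun t x => Φ (pt x t)) (memLp_slice Φ)
    (memLp_sliceBound.const_mul _) (fun t x => norm_slice_le Φ x t) ?_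
  intro x
  have : Continuous fun t : ℝ => pt x t := by unfold pt; fun_prop
  exact Φ.continuous.comp this

lemma norm_toLp_slice_le (Φ : 𝓢(Plane, ℂ)) (t : ℝ) :
    ‖(memLp_slice Φ t).toLp (fun x : ℝ => Φ (pt x t))‖ ≤
      (4 * ((Finset.Iic ((2, 0) : ℕ × ℕ)).sup (schwartzSeminormFamily ℂ Plane ℂ)) Φ) *
        ‖memLp_sliceBound.toLp sliceBound‖ := by
  refine Lp.norm_le_mul_norm_of_ae_le_mul ?_
  filter_upwards [MemLp.coeFn_toLp (memLp_slice Φ t), MemLp.coeFn_toLp memLp_sliceBound]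
    with x h1 h2
  rw [h1, h2]
  refine (norm_slice_le Φ x t).trans ?_
  have := apply_nonneg ((Finset.Iic ((2, 0) : ℕ × ℕ)).sup (schwartzSeminormFamily ℂ Plane ℂ)) Φ
  gcongr
  exact Real.le_norm_self _

/-- The bilinear pairing `(f, v) ↦ ∫ f v` on `L²`. -/
def pairing : L2 ℝ →L[ℂ] L2 ℝ →L[ℂ] ℂ := (ContinuousLinearMap.mul ℂ ℂ).lpPairing volume 2 2

lemma pairing_slice (Φ : 𝓢(Plane, ℂ)) (t : ℝ) (v : L2 ℝ) :
    pairing ((memLp_slice Φ t).toLp (fun x : ℝ => Φ (pt x t))) v = ∫ x : ℝ, Φ (pt x t) * v x := by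
  rw [pairing, ContinuousLinearMap.lpPairing_eq_integral]
  refine integral_congr_ae ?_
  filter_upwards [MemLp.coeFn_toLp (memLp_slice Φ t)] with x hx
  simp [hx]

lemma continuous_pairing_slice (Φ : 𝓢(Plane, ℂ)) {v : ℝ → L2 ℝ} (hv : Continuous v) :
    Continuous fun t => ∫ x : ℝ, Φ (pt x t) * v t x := by
  simp_rw [← pairing_slice]
  exact (pairing.continuous.comp (continuous_slice Φ)).clm_apply hv

lemma integrable_pairing_slice (Φ : 𝓢(Plane, ℂ)) {v : ℝ → L2 ℝ} (hv : Continuous v)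
    (hs : HasCompactSupport v) : Integrable fun t => ∫ x : ℝ, Φ (pt x t) * v t x := by
  refine (continuous_pairing_slice Φ hv).integrable_of_hasCompactSupport ?_
  refine hs.mono ?_
  intro t ht h0
  apply ht
  simp_rw [← pairing_slice]
  rw [h0, map_zero]

/-- A continuous compactly supported curve `t ↦ v(t)` in `L²(ℝ)`, seen as the tempered distribution
`Φ ↦ ∫ ∫ Φ(x,t) v(t)(x) dx dt` in the variables `(x, t)`. -/
def ofCurve (v : ℝ → L2 ℝ) (hv : Continuous v) (hs : HasCompactSupport v) : 𝓢'(Plane, ℂ) :=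
  ContinuousLinearMap.toPointwiseConvergenceCLM _ _ _ _
    (SchwartzMap.mkCLMtoNormedSpace (𝕜 := ℂ) (σ := RingHom.id ℂ)
      (fun Φ : 𝓢(Plane, ℂ) => ∫ t : ℝ, ∫ x : ℝ, Φ (pt x t) * v t x)
      (by
        intro f g
        rw [← integral_add (integrable_pairing_slice f hv hs) (integrable_pairing_slice g hv hs)]
        refine integral_congr_ae (Eventually.of_forall fun t => ?_)
        dsimp only
        simp_rw [← pairing_slice]
        rw [← add_apply, ← map_add]
        rfl)
      (by
        intro a f
        rw [RingHom.id_apply, ← integral_smul]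
        refine integral_congr_ae (Eventually.of_forall fun t => ?_)
        dsimp only
        rw [← integral_smul]
        refine integral_congr_ae (Eventually.of_forall fun x => ?_)
        simp [mul_assoc])
      (by
        have hvi : Integrable fun t => ‖v t‖ :=
          hv.norm.integrable_of_hasCompactSupport hs.norm
        refine ⟨Finset.Iic (2, 0), ‖pairing‖ * (4 * ‖memLp_sliceBound.toLp sliceBound‖) *
          ∫ t, ‖v t‖, by positivity, fun Φ => ?_⟩
        refine (norm_integral_le_integral_norm _).trans ?_
        rw [← integral_const_mul, ← integral_mul_const]
        refine integral_mono (integrable_pairing_slice Φ hv hs).norm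
          ((hvi.const_mul _).mul_const _) fun t => ?_
        dsimp only
        rw [← pairing_slice]
        refine (pairing.le_opNorm₂ _ _).trans ?_
        have h := norm_toLp_slice_le Φ t
        calc ‖pairing‖ * ‖(memLp_slice Φ t).toLp (fun x : ℝ => Φ (pt x t))‖ * ‖v t‖
            ≤ ‖pairing‖ * ((4 * ((Finset.Iic ((2, 0) : ℕ × ℕ)).sup
                (schwartzSeminormFamily ℂ Plane ℂ)) Φ) *
                  ‖memLp_sliceBound.toLp sliceBound‖) * ‖v t‖ := by gcongr
          _ = _ := by ring))

/-- The time-localized free evolution `ψ(t) W_ε(t)φ` as a tempered distribution. -/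
def localizedFlow (ψ : ℝ → ℝ) (hψ : IsCutoff ψ) (ε : ℝ) (hε : 0 ≤ ε) (φ : L2 ℝ) : 𝓢'(Plane, ℂ) :=
  ofCurve (fun t => (ψ t : ℂ) • W ε hε t φ)
    ((Complex.continuous_ofReal.comp hψ.smooth.continuous).smul (continuous_W ε hε φ))
    (hψ.hasCompactSupport.mono fun t ht h0 => ht (by simp [h0]))

end BOB

end

/-! After applying `(I - ∂_τ²) 𝓕`, the localized flow becomes the function `φ̂(ξ) m(ξ, τ)`. Here `m`
is the time transform of `(1 + t²) ψ(t) exp (i t ω(ξ) - |t| ε ξ²)` (`localizedFlow_fourierSchwartz`,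
`toTemperedDistribution_eq_localizedFlow`). The operator acts on each frequency `ξ` separately, so
the weights in `σ` play no role. It suffices to bound every `Z_k` norm by the matching term of the
`H̃^σ` norm, uniformly in `ε`.

The difficulty is the kink of `exp (-|t| ε ξ²)` at `t = 0`, which limits the decay of `m` in `τ`.
Put `a = ε ξ²` and `s = τ - ω(ξ)`. Splitting at `t = 0` writes `m` as a sum of Laplace transforms at
the conjugate points `a ± i s`. Two integrations by parts give leading terms `θ(0)/(a + i s)` and
`θ(0)/(a - i s)` with `θ = weight ψ`, and their sum is only `2 a θ(0)/(a² + s²)`. Hence `m` is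
dominated by a Poisson kernel of width `1 + a`, namely `(1 + a)/((1 + a)² + s²)`
(`exists_norm_twoSided_le`).

High frequencies, `k ≥ 1`: on the support of `η_k` the width is comparable to `B = 1 + ε 4^k`, which
is at most `2 · 4^k`. In the `X_k` norm the dyadic blocks in `s` then decay geometrically on both
sides of `2^j ~ B`, with a sum independent of `B` and `k` (`tsum_dyadic_le`, `normX_le_high`). The
space `Y_k` is not needed.

Low frequencies, `k = 0`: take a decomposition `𝓕G + h` from the definition of `B₀` and localize it
to `[-2, 2]` by a bump. The part from `h` goes into `X₀`, where `|m| ≤ C/(1 + τ²)` suffices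
(`normX_zero_le`). The part from `G` goes into `Y₀`: multiplication by `𝓕G` is convolution by `G` in
`x`, so Minkowski's inequality leaves the `L¹_x L²_t` norm of the inverse transform of the localized
multiplier. Cauchy–Schwarz with the weight `1 + x²` bounds that norm by `L²` norms of the multiplier
and of its `ξ`-derivative (`lintegral_kernel_le`, `normY0_le`). One derivative is available because
`ω` is of class `C¹`. -/

noncomputable section

namespace BOB

/-! ### The Fourier transform on `L¹ ∩ L²` -/

section FourierLOneLTwo

variable {E : Type} [NormedAddCommGroup E] [InnerProductSpace ℝ E] [FiniteDimensional ℝ E]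
  [MeasurableSpace E] [BorelSpace E]

lemma continuous_fourier_of_integrable {f : E → ℂ} (hf : Integrable f) : Continuous (𝓕 f) :=
  VectorFourier.fourierIntegral_continuous Real.continuous_fourierChar
    (by exact continuous_inner) hf

lemma continuous_fourierInv_of_integrable {f : E → ℂ} (hf : Integrable f) :
    Continuous (𝓕⁻ f) := by
  have h : 𝓕⁻ f = fun w => 𝓕 f (-w) := funext fun w => Real.fourierInv_eq_fourier_neg f w
  rw [h]
  exact (continuous_fourier_of_integrable hf).comp continuous_neg

lemma integral_fourier_mul_eq_of_integrable {f g : E → ℂ} (hf : Integrable f)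
    (hg : Integrable g) : ∫ x, 𝓕 f x * g x = ∫ x, f x * 𝓕 g x := by
  have h := VectorFourier.integral_fourierIntegral_smul_eq_flip (L := innerₗ E)
    (μ := (volume : Measure E)) (ν := (volume : Measure E))
    Real.continuous_fourierChar (by exact continuous_inner) hf hg
  simp only [smul_eq_mul] at h
  rw [flip_innerₗ] at h
  exact h

/-- The `L²` transform is an extension by density, so its agreement with the integral is checked
weakly: both sides are tested against smooth compactly supported functions, and the transform is
moved onto the test function. -/
lemma fourier_toLp_ae_eq {f : E → ℂ} (hf : Integrable f) (hf2 : MemLp f 2 volume) :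
    (𝓕 (hf2.toLp f) : L2 E) =ᵐ[volume] 𝓕 f := by
  refine ae_eq_of_integral_contDiff_smul_eq
    ((Lp.memLp (𝓕 (hf2.toLp f) : L2 E)).locallyIntegrable (by norm_num))
    (continuous_fourier_of_integrable hf).locallyIntegrable ?_
  intro g g_smooth g_cpt
  have hg₁ : HasCompactSupport (Complex.ofRealCLM ∘ g) := g_cpt.comp_left rfl
  have hg₂ : ContDiff ℝ ∞ (Complex.ofRealCLM ∘ g) := by fun_prop
  set S : 𝓢(E, ℂ) := hg₁.toSchwartzMap hg₂
  have hS : ∀ x, S x = (g x : ℂ) := fun x => rfl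
  have h1 : ∫ x, g x • (𝓕 (hf2.toLp f) : L2 E) x = ∫ x, (𝓕 S : 𝓢(E, ℂ)) x * f x := by
    calc ∫ x, g x • (𝓕 (hf2.toLp f) : L2 E) x
        = Lp.toTemperedDistribution (𝓕 (hf2.toLp f) : L2 E) S := by simp [hS]
      _ = Lp.toTemperedDistribution (hf2.toLp f) (𝓕 S) := by
          rw [← Lp.fourier_toTemperedDistribution_eq]; rfl
      _ = ∫ x, (𝓕 S : 𝓢(E, ℂ)) x * f x := by
          rw [Lp.toTemperedDistribution_apply]
          refine integral_congr_ae ?_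
          filter_upwards [hf2.coeFn_toLp] with x hx
          rw [hx, smul_eq_mul]
  rw [h1, SchwartzMap.fourier_coe, integral_fourier_mul_eq_of_integrable S.integrable hf]
  simp [hS]

lemma fourierInv_toLp_ae_eq {f : E → ℂ} (hf : Integrable f) (hf2 : MemLp f 2 volume) :
    (𝓕⁻ (hf2.toLp f) : L2 E) =ᵐ[volume] 𝓕⁻ f := by
  refine ae_eq_of_integral_contDiff_smul_eq
    ((Lp.memLp (𝓕⁻ (hf2.toLp f) : L2 E)).locallyIntegrable (by norm_num))
    (continuous_fourierInv_of_integrable hf).locallyIntegrable ?_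
  intro g g_smooth g_cpt
  have hg₁ : HasCompactSupport (Complex.ofRealCLM ∘ g) := g_cpt.comp_left rfl
  have hg₂ : ContDiff ℝ ∞ (Complex.ofRealCLM ∘ g) := by fun_prop
  set S : 𝓢(E, ℂ) := hg₁.toSchwartzMap hg₂
  have hS : ∀ x, S x = (g x : ℂ) := fun x => rfl
  have h1 : ∫ x, g x • (𝓕⁻ (hf2.toLp f) : L2 E) x = ∫ x, (𝓕⁻ S : 𝓢(E, ℂ)) x * f x := by
    calc ∫ x, g x • (𝓕⁻ (hf2.toLp f) : L2 E) x
        = Lp.toTemperedDistribution (𝓕⁻ (hf2.toLp f) : L2 E) S := by simp [hS]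
      _ = Lp.toTemperedDistribution (hf2.toLp f) (𝓕⁻ S) := by
          rw [← Lp.fourierInv_toTemperedDistribution_eq]; rfl
      _ = ∫ x, (𝓕⁻ S : 𝓢(E, ℂ)) x * f x := by
          rw [Lp.toTemperedDistribution_apply]
          refine integral_congr_ae ?_
          filter_upwards [hf2.coeFn_toLp] with x hx
          rw [hx, smul_eq_mul]
  -- A reflection turns the inverse transform into the forward one, for which the exchange formula
  -- is available.
  have h2 : ∫ x, (𝓕⁻ S : 𝓢(E, ℂ)) x * f x = ∫ x, (𝓕 S : 𝓢(E, ℂ)) x * f (-x) := by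
    rw [← integral_neg_eq_self (fun x => (𝓕 S : 𝓢(E, ℂ)) x * f (-x)) volume]
    simp [SchwartzMap.fourierInv_coe, SchwartzMap.fourier_coe, Real.fourierInv_eq_fourier_neg]
  rw [h1, h2, SchwartzMap.fourier_coe,
    integral_fourier_mul_eq_of_integrable S.integrable hf.comp_neg,
    ← Real.fourierInv_eq_fourier_comp_neg]
  simp [hS]

lemma coeFn_dilate {c : ℝ} (hc : c ≠ 0) (f : L2 E) :
    dilate E c hc f =ᵐ[volume] fun x => f (c • x) :=
  MemLp.coeFn_toLp (aux_memLp_dilate E (Lp.memLp f) hc)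

lemma fourierInvL2_ae_eq (f : L2 E) :
    fourierInvL2 E f =ᵐ[volume] fun x =>
      (((2 * Real.pi) ^ Module.finrank ℝ E)⁻¹ : ℂ) * (𝓕⁻ f : L2 E) ((2 * Real.pi)⁻¹ • x) := by
  have h1 := Lp.coeFn_smul (((2 * Real.pi) ^ Module.finrank ℝ E)⁻¹ : ℂ)
    (dilate E (2 * Real.pi)⁻¹ two_pi_inv_ne_zero (𝓕⁻ f : L2 E))
  filter_upwards [h1, coeFn_dilate two_pi_inv_ne_zero (𝓕⁻ f : L2 E)] with x h1 h2
  rw [← h2]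
  exact h1

lemma fourierInvL2_toLp_ae_eq {f : E → ℂ} (hf : Integrable f) (hf2 : MemLp f 2 volume) :
    fourierInvL2 E (hf2.toLp f) =ᵐ[volume] fun x =>
      (((2 * Real.pi) ^ Module.finrank ℝ E)⁻¹ : ℂ) * 𝓕⁻ f ((2 * Real.pi)⁻¹ • x) := by
  filter_upwards [fourierInvL2_ae_eq (hf2.toLp f),
    aux_ae_dilate E (fourierInv_toLp_ae_eq hf hf2) two_pi_inv_ne_zero] with x h1 h2
  rw [h1, h2]

end FourierLOneLTwo

/-- Parseval in bilinear form, without conjugation. Both sides are continuous in `g`, and for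
Schwartz `g` the identity is the definition of the inverse transform of a distribution. -/
lemma pairing_fourier_fourierInv (g w : L2 ℝ) : pairing (𝓕 g) (𝓕⁻ w) = pairing g w := by
  refine DenseRange.induction_on (p := fun g : L2 ℝ => pairing (𝓕 g) (𝓕⁻ w) = pairing g w)
    (SchwartzMap.denseRange_toLpCLM (E := ℝ) (F := ℂ) (μ := volume) (p := 2) ENNReal.ofNat_ne_top)
    g ?_ ?_
  · refine isClosed_eq ?_ ?_
    · exact (pairing.continuous.comp
        (FourierTransform.fourierCLM ℂ (L2 ℝ)).continuous).clm_apply continuous_const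
    · exact pairing.continuous.clm_apply continuous_const
  · intro S
    have key : ∀ (R : 𝓢(ℝ, ℂ)) (v : L2 ℝ),
        pairing (R.toLp 2) v = Lp.toTemperedDistribution v R := by
      intro R v
      rw [pairing, ContinuousLinearMap.lpPairing_eq_integral, Lp.toTemperedDistribution_apply]
      refine integral_congr_ae ?_
      filter_upwards [R.coeFn_toLp 2 volume] with x hx
      simp [hx]
    have e : SchwartzMap.toLpCLM ℝ (E := ℝ) ℂ 2 volume S = S.toLp 2 := rfl
    rw [e, SchwartzMap.toLp_fourier_eq, key, key, ← Lp.fourierInv_toTemperedDistribution_eq,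
      TemperedDistribution.fourierInv_apply, FourierTransform.fourierInv_fourier_eq]

/-- Duality between the transform of an integrable function and the inverse transform on `L²`. -/
lemma integral_fourier_mul_fourierInvL2 {g : ℝ → ℂ} (hg : Integrable g) (hg2 : MemLp g 2 volume)
    (w : L2 ℝ) :
    ∫ x, 𝓕 g ((2 * Real.pi)⁻¹ * x) * fourierInvL2 ℝ w x = ∫ ξ, g ξ * w ξ := by
  have h1 : ∫ x, 𝓕 g ((2 * Real.pi)⁻¹ * x) * fourierInvL2 ℝ w x
      = ((2 * Real.pi)⁻¹ : ℂ) * ∫ x, (fun y => 𝓕 g y * (𝓕⁻ w : L2 ℝ) y) ((2 * Real.pi)⁻¹ * x) := by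
    rw [← integral_const_mul]
    refine integral_congr_ae ?_
    filter_upwards [fourierInvL2_ae_eq w] with x hx
    rw [hx]
    simp only [Module.finrank_self, pow_one, smul_eq_mul]
    ring
  rw [h1, Measure.integral_comp_mul_left (fun y => 𝓕 g y * (𝓕⁻ w : L2 ℝ) y), inv_inv,
    abs_of_pos (by positivity),
    Complex.real_smul, ← mul_assoc]
  have hc : ((2 * Real.pi)⁻¹ : ℂ) * ((2 * Real.pi : ℝ) : ℂ) = 1 := by
    push_cast
    exact inv_mul_cancel₀ (by exact_mod_cast (by positivity : (2 * Real.pi : ℝ) ≠ 0))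
  rw [hc, one_mul]
  have h2 := pairing_fourier_fourierInv (hg2.toLp g) w
  rw [pairing, ContinuousLinearMap.lpPairing_eq_integral,
    ContinuousLinearMap.lpPairing_eq_integral] at h2
  calc ∫ y, 𝓕 g y * (𝓕⁻ w : L2 ℝ) y
      = ∫ y, (ContinuousLinearMap.mul ℂ ℂ) ((𝓕 (hg2.toLp g) : L2 ℝ) y) ((𝓕⁻ w : L2 ℝ) y) := by
        refine integral_congr_ae ?_
        filter_upwards [fourier_toLp_ae_eq hg hg2] with y hy
        rw [← hy]; rfl
    _ = ∫ y, (ContinuousLinearMap.mul ℂ ℂ) ((hg2.toLp g) y) (w y) := h2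
    _ = ∫ ξ, g ξ * w ξ := by
        refine integral_congr_ae ?_
        filter_upwards [hg2.coeFn_toLp] with y hy
        rw [hy]; rfl

/-! ### Laplace transforms of test functions -/

/-- The Laplace transform `z ↦ ∫_{t > 0} exp (-z t) θ(t) dt`. -/
def laplace (θ : ℝ → ℂ) (z : ℂ) : ℂ := ∫ t in Ioi (0 : ℝ), Complex.exp (-(z * t)) * θ t

section Laplace

variable {θ : ℝ → ℂ}

lemma integrable_exp_mul (hc : Continuous θ) (hs : HasCompactSupport θ) (z : ℂ) :
    Integrable fun t : ℝ => Complex.exp (-(z * t)) * θ t :=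
  Continuous.integrable_of_hasCompactSupport
    (by fun_prop : Continuous fun t : ℝ => Complex.exp (-(z * t)) * θ t) hs.mul_left

lemma norm_laplace_le (hc : Continuous θ) (hs : HasCompactSupport θ) {z : ℂ} (hz : 0 ≤ z.re) :
    ‖laplace θ z‖ ≤ ∫ t, ‖θ t‖ := by
  have hi : Integrable fun t => ‖θ t‖ := (hc.integrable_of_hasCompactSupport hs).norm
  refine (norm_integral_le_integral_norm _).trans ?_
  refine le_trans ?_ (setIntegral_le_integral (s := Ioi (0 : ℝ)) hi
    (Eventually.of_forall fun t => norm_nonneg _))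
  refine setIntegral_mono_on (integrable_exp_mul hc hs z).norm.integrableOn hi.integrableOn
    measurableSet_Ioi fun t ht => ?_
  rw [norm_mul, Complex.norm_exp]
  refine mul_le_of_le_one_left (norm_nonneg _) (Real.exp_le_one_iff.2 ?_)
  have : 0 ≤ z.re * t := mul_nonneg hz (le_of_lt ht)
  simpa using this

/-- Integration by parts on the half line; compact support removes the boundary term at infinity, so
no sign of `z.re` is needed. -/
lemma mul_laplace (hc : ContDiff ℝ 1 θ) (hs : HasCompactSupport θ) (z : ℂ) :
    z * laplace θ z = θ 0 + laplace (deriv θ) z := by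
  have hd : ∀ t : ℝ, HasDerivAt (fun t : ℝ => Complex.exp (-(z * t)) * θ t)
      (-z * (Complex.exp (-(z * t)) * θ t) + Complex.exp (-(z * t)) * deriv θ t) t := by
    intro t
    have h1 : HasDerivAt (fun t : ℝ => Complex.exp (-(z * t))) (Complex.exp (-(z * t)) * -z) t := by
      have h0 : HasDerivAt (fun t : ℝ => -(z * (t : ℂ))) (-(z * 1)) t :=
        ((Complex.ofRealCLM.hasDerivAt (x := t)).const_mul z).neg
      simpa using h0.cexp
    have h2 : HasDerivAt θ (deriv θ t) t := (hc.differentiable one_ne_zero t).hasDerivAt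
    exact (h1.mul h2).congr_deriv (by ring)
  have hc' : Continuous (deriv θ) := hc.continuous_deriv le_rfl
  have i1 := (integrable_exp_mul hc.continuous hs z).const_mul (-z)
  have i2 := integrable_exp_mul hc' hs.deriv z
  have hsupp : HasCompactSupport fun t : ℝ => Complex.exp (-(z * t)) * θ t := hs.mul_left
  have hlim : Tendsto (fun t : ℝ => Complex.exp (-(z * t)) * θ t) atTop (𝓝 0) := by
    have h := hasCompactSupport_iff_eventuallyEq.1 hsupp
    refine Tendsto.congr' (EventuallyEq.symm (h.filter_mono ?_)) tendsto_const_nhds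
    rw [coclosedCompact_eq_cocompact]
    exact atTop_le_cocompact
  have h := integral_Ioi_of_hasDerivAt_of_tendsto' (a := (0 : ℝ)) (fun t _ => hd t)
    (i1.add i2).integrableOn hlim
  rw [integral_add i1.integrableOn i2.integrableOn, integral_const_mul] at h
  simp only [Complex.ofReal_zero, mul_zero, neg_zero, Complex.exp_zero, one_mul, zero_sub] at h
  change -z * laplace θ z + laplace (deriv θ) z = -θ 0 at h
  linear_combination -h

lemma sq_mul_laplace (hc : ContDiff ℝ 2 θ) (hs : HasCompactSupport θ) (z : ℂ) :
    z ^ 2 * laplace θ z = z * θ 0 + deriv θ 0 + laplace (deriv (deriv θ)) z := by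
  have hd : ContDiff ℝ 1 (deriv θ) := ContDiff.deriv' (n := 1) (by rwa [one_add_one_eq_two])
  have h1 := mul_laplace (hc.of_le one_le_two) hs z
  have h2 := mul_laplace hd hs.deriv z
  linear_combination z * h1 + h2

/-- Differentiation under the integral sign. On the unit ball around `z` the exponential is at most
`exp ((‖z‖ + 1)|t|)`, which is harmless on the support of `θ`. -/
lemma hasDerivAt_laplace (hc : Continuous θ) (hs : HasCompactSupport θ) (z : ℂ) :
    HasDerivAt (laplace θ) (-laplace (fun t => t * θ t) z) z := by
  have hcont : ∀ w : ℂ, Continuous fun t : ℝ => Complex.exp (-(w * t)) * θ t := fun w => by fun_prop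
  have hb : Integrable (fun t : ℝ => Real.exp ((‖z‖ + 1) * |t|) * (|t| * ‖θ t‖))
      (volume.restrict (Ioi 0)) := by
    have : Continuous fun t : ℝ => Real.exp ((‖z‖ + 1) * |t|) * (|t| * ‖θ t‖) := by fun_prop
    exact (this.integrable_of_hasCompactSupport hs.norm.mul_left.mul_left).integrableOn
  have h := (hasDerivAt_integral_of_dominated_loc_of_deriv_le
    (μ := volume.restrict (Ioi (0 : ℝ))) (x₀ := z)
    (F := fun w (t : ℝ) => Complex.exp (-(w * t)) * θ t)
    (F' := fun w (t : ℝ) => Complex.exp (-(w * t)) * (-(t * θ t)))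
    (s := Metric.ball z 1) (Metric.ball_mem_nhds z one_pos)
    (Eventually.of_forall fun w => (hcont w).aestronglyMeasurable)
    (integrable_exp_mul hc hs z).integrableOn
    (by fun_prop : Continuous fun t : ℝ =>
      Complex.exp (-(z * t)) * (-(t * θ t))).aestronglyMeasurable
    (Eventually.of_forall fun t w hw => ?_) hb (Eventually.of_forall fun t w _ => ?_)).2
  · refine HasDerivAt.congr_deriv (f := laplace θ) h ?_
    rw [laplace, ← integral_neg]
    congr 1
    ext t
    ring
  · rw [norm_mul, norm_neg, norm_mul, Complex.norm_exp, Complex.norm_real, Real.norm_eq_abs]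
    gcongr
    have hw' : ‖w‖ ≤ ‖z‖ + 1 := by
      have h1 : ‖w - z‖ < 1 := by simpa [dist_eq_norm] using hw
      have h2 := norm_le_norm_add_norm_sub' w z
      linarith
    refine (Complex.re_le_norm _).trans ?_
    rw [norm_neg, norm_mul, Complex.norm_real, Real.norm_eq_abs]
    gcongr
  · have h0 : HasDerivAt (fun w : ℂ => -(w * (t : ℂ))) (-(1 * (t : ℂ))) w :=
      ((hasDerivAt_id w).mul_const (t : ℂ)).neg
    exact (h0.cexp.mul_const (θ t)).congr_deriv (by ring)

/-- Quadratic decay of the Laplace transform of a test function vanishing at the origin. -/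
lemma exists_norm_laplace_le (hc : ContDiff ℝ 2 θ) (hs : HasCompactSupport θ) (h0 : θ 0 = 0) :
    ∃ C : ℝ, 0 ≤ C ∧ ∀ z : ℂ, 0 ≤ z.re → ‖laplace θ z‖ ≤ C / (1 + ‖z‖ ^ 2) := by
  have hd : ContDiff ℝ 1 (deriv θ) := ContDiff.deriv' (n := 1) (by rwa [one_add_one_eq_two])
  set A := ∫ t, ‖θ t‖
  set B := ∫ t, ‖deriv (deriv θ) t‖
  have hA : 0 ≤ A := integral_nonneg fun t => norm_nonneg _
  have hB : 0 ≤ B := integral_nonneg fun t => norm_nonneg _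
  have hD := norm_nonneg (deriv θ 0)
  refine ⟨2 * A + 2 * (‖deriv θ 0‖ + B), by positivity, fun z hz => ?_⟩
  rw [le_div_iff₀ (by positivity)]
  have h1 : ‖laplace θ z‖ ≤ A := norm_laplace_le hc.continuous hs hz
  have h2 : ‖z‖ ^ 2 * ‖laplace θ z‖ ≤ ‖deriv θ 0‖ + B := by
    rw [← norm_pow, ← norm_mul, sq_mul_laplace hc hs z, h0, mul_zero, zero_add]
    exact (norm_add_le _ _).trans (by
      gcongr
      exact norm_laplace_le (hd.continuous_deriv le_rfl) hs.deriv.deriv hz)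
  nlinarith

end Laplace

/-- `∫ exp (-a|t| - i s t) θ(t) dt` for even `θ`, as a sum of two Laplace transforms. -/
def twoSided (θ : ℝ → ℂ) (a s : ℝ) : ℂ :=
  laplace θ (a + Complex.I * s) + laplace θ (a - Complex.I * s)

section TwoSided

variable {θ : ℝ → ℂ}

/-- The half line `t < 0` is folded onto `t > 0`; evenness of `θ` makes the same `θ` appear in both
halves. -/
lemma twoSided_eq_integral (hc : Continuous θ) (hs : HasCompactSupport θ)
    (he : ∀ t, θ (-t) = θ t) (a s : ℝ) :
    twoSided θ a s
      = ∫ t : ℝ, Complex.exp (-((a * |t| : ℝ) : ℂ) - Complex.I * s * t) * θ t := by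
  set F : ℝ → ℂ := fun t => Complex.exp (-((a * |t| : ℝ) : ℂ) - Complex.I * s * t) * θ t
  have hF : Integrable F :=
    (by fun_prop : Continuous F).integrable_of_hasCompactSupport hs.mul_left
  have h1 : ∫ t, F t = (∫ t in Iic 0, F t) + ∫ t in Ioi 0, F t := by
    rw [intervalIntegral.integral_Iic_add_Ioi hF.integrableOn hF.integrableOn]
  have h2 : ∫ t in Iic 0, F t = ∫ t in Ioi 0, F (-t) := by
    rw [integral_comp_neg_Ioi, neg_zero]
  rw [twoSided, h1, h2, add_comm]
  congr 1
  · refine setIntegral_congr_fun measurableSet_Ioi fun t ht => ?_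
    simp only [F, he, abs_neg, abs_of_pos (show (0 : ℝ) < t from ht)]
    congr 2
    push_cast
    ring
  · refine setIntegral_congr_fun measurableSet_Ioi fun t ht => ?_
    simp only [F, abs_of_pos (show (0 : ℝ) < t from ht)]
    congr 2
    push_cast
    ring

/-- The central estimate. Each Laplace transform alone decays only like `1/‖z‖`, but `1/z + 1/z' =
2a/(a² + s²)` for the conjugate points `z, z' = a ± i s`. The bound is thus a Poisson kernel of
width `1 + a`, with a constant independent of `a`. -/
lemma exists_norm_twoSided_le (hc : ContDiff ℝ 2 θ) (hs : HasCompactSupport θ)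
    (h0 : deriv θ 0 = 0) :
    ∃ C : ℝ, 0 ≤ C ∧ ∀ a s : ℝ, 0 ≤ a →
      ‖twoSided θ a s‖ ≤ C * ((1 + a) / ((1 + a) ^ 2 + s ^ 2)) := by
  have hd : ContDiff ℝ 1 (deriv θ) := ContDiff.deriv' (n := 1) (by rwa [one_add_one_eq_two])
  set A := ∫ t, ‖θ t‖
  set B := ∫ t, ‖deriv (deriv θ) t‖
  have hA : 0 ≤ A := integral_nonneg fun t => norm_nonneg _
  have hB : 0 ≤ B := integral_nonneg fun t => norm_nonneg _
  have hD := norm_nonneg (θ 0)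
  -- `10 A` serves `a² + s² ≤ 1`: the trivial bound `2A` and `(1 + a)² + s² ≤ 5(1 + a)`. The other
  -- term serves `a² + s² ≥ 1`, where `(1 + a)² + s² ≤ 4(a² + s²)`.
  refine ⟨10 * A + 8 * (‖θ 0‖ + B), by positivity, fun a s ha => ?_⟩
  set z : ℂ := a + Complex.I * s with hz
  set z' : ℂ := a - Complex.I * s with hz'
  have hre : 0 ≤ z.re := by simpa [hz] using ha
  have hre' : 0 ≤ z'.re := by simpa [hz'] using ha
  have hzz : z * z' = ((a ^ 2 + s ^ 2 : ℝ) : ℂ) := by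
    rw [hz, hz']; push_cast; linear_combination (-(s : ℂ) ^ 2) * Complex.I_sq
  have hn : ‖z‖ ^ 2 = a ^ 2 + s ^ 2 := by
    rw [Complex.sq_norm, Complex.normSq_apply]; simp [hz]; ring
  have hn' : ‖z'‖ ^ 2 = a ^ 2 + s ^ 2 := by
    rw [Complex.sq_norm, Complex.normSq_apply]; simp [hz']; ring
  have hsmall : ‖twoSided θ a s‖ ≤ 2 * A := by
    refine (norm_add_le _ _).trans ?_
    have h1 := norm_laplace_le hc.continuous hs hre
    have h2 := norm_laplace_le hc.continuous hs hre'
    linarith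
  have hlarge : (a ^ 2 + s ^ 2) * ‖twoSided θ a s‖ ≤ 2 * a * ‖θ 0‖ + 2 * B := by
    by_cases h : a ^ 2 + s ^ 2 = 0
    · rw [h, zero_mul]; positivity
    have hne : z ≠ 0 := fun hzero => h (by rw [← hn, hzero]; simp)
    have hne' : z' ≠ 0 := fun hzero => h (by rw [← hn', hzero]; simp)
    -- The boundary terms combine to `(z + z') θ(0)`, and the remainders carry the factors `z'/z`
    -- and `z/z'` of modulus one.
    have e : z * z' * twoSided θ a s = 2 * a * θ 0 + (z' / z) * laplace (deriv (deriv θ)) z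
        + (z / z') * laplace (deriv (deriv θ)) z' := by
      have e1 := sq_mul_laplace hc hs z
      have e2 := sq_mul_laplace hc hs z'
      have e3 : z + z' = 2 * a := by rw [hz, hz']; ring
      have e4 : z * z' * laplace θ z = (z' / z) * (z ^ 2 * laplace θ z) := by
        field_simp
      have e5 : z * z' * laplace θ z' = (z / z') * (z' ^ 2 * laplace θ z') := by
        field_simp
      rw [twoSided, mul_add, e4, e5, e1, e2, h0, ← e3]
      field_simp
      ring
    have hnn : ‖z‖ = ‖z'‖ := by
      rw [← abs_of_nonneg (norm_nonneg z), ← abs_of_nonneg (norm_nonneg z'),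
        ← sq_eq_sq_iff_abs_eq_abs, hn, hn']
    have hq : ‖z' / z‖ = 1 := by
      rw [norm_div, hnn, div_self (norm_ne_zero_iff.2 hne')]
    have hq' : ‖z / z'‖ = 1 := by
      rw [norm_div, hnn, div_self (norm_ne_zero_iff.2 hne')]
    have hcd := hd.continuous_deriv le_rfl
    have b1 := norm_laplace_le hcd hs.deriv.deriv hre
    have b2 := norm_laplace_le hcd hs.deriv.deriv hre'
    calc (a ^ 2 + s ^ 2) * ‖twoSided θ a s‖ = ‖z * z' * twoSided θ a s‖ := by
          rw [norm_mul, hzz, Complex.norm_real, Real.norm_of_nonneg (by positivity)]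
      _ ≤ ‖2 * (a : ℂ) * θ 0‖ + ‖(z' / z) * laplace (deriv (deriv θ)) z‖
        + ‖(z / z') * laplace (deriv (deriv θ)) z'‖ := by rw [e]; exact norm_add₃_le
      _ ≤ 2 * a * ‖θ 0‖ + 2 * B := by
          rw [norm_mul, norm_mul, norm_mul, norm_mul, hq, hq', Complex.norm_real,
            Real.norm_of_nonneg ha]
          simp only [Complex.norm_ofNat, one_mul]
          linarith
  rw [← mul_div_assoc, le_div_iff₀ (by positivity)]
  set T := ‖twoSided θ a s‖
  have hT : 0 ≤ T := norm_nonneg _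
  rcases le_total 1 (a ^ 2 + s ^ 2) with h | h
  · have h3 : (1 + a) ^ 2 + s ^ 2 ≤ 4 * (a ^ 2 + s ^ 2) := by nlinarith [sq_nonneg (a - 1)]
    have h4 : T * ((1 + a) ^ 2 + s ^ 2) ≤ 4 * (2 * a * ‖θ 0‖ + 2 * B) := by nlinarith
    nlinarith [mul_nonneg ha hA, mul_nonneg ha hB, mul_nonneg ha hD]
  · have ha1 : a ≤ 1 := by nlinarith [sq_nonneg s]
    have h3 : (1 + a) ^ 2 + s ^ 2 ≤ 5 * (1 + a) := by nlinarith [sq_nonneg s]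
    have h4 : T * ((1 + a) ^ 2 + s ^ 2) ≤ 2 * A * (5 * (1 + a)) := by
      gcongr
    nlinarith [mul_nonneg ha hA, mul_nonneg ha hB, mul_nonneg ha hD]

lemma continuous_laplace (hc : Continuous θ) (hs : HasCompactSupport θ) :
    Continuous (laplace θ) :=
  continuous_iff_continuousAt.2 fun z => (hasDerivAt_laplace hc hs z).continuousAt

lemma continuous_twoSided (hc : Continuous θ) (hs : HasCompactSupport θ) :
    Continuous fun q : ℝ × ℝ => twoSided θ q.1 q.2 := by
  have := continuous_laplace hc hs
  unfold twoSided
  fun_prop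

end TwoSided

/-! ### The time weight `(1 + t²) ψ(t)` -/

/-- The weight `(1 + t²) ψ(t)`. -/
def weight (ψ : ℝ → ℝ) (t : ℝ) : ℂ := (1 + (t : ℂ) ^ 2) * ψ t

section Weight

variable {ψ : ℝ → ℝ}

lemma contDiff_weight (hψ : IsCutoff ψ) : ContDiff ℝ 2 (weight ψ) := by
  have h1 : ContDiff ℝ 2 ψ := contDiff_infty.1 hψ.smooth 2
  have h2 : ContDiff ℝ 2 fun t : ℝ => (ψ t : ℂ) := Complex.ofRealCLM.contDiff.comp h1
  have h3 : ContDiff ℝ 2 fun t : ℝ => (t : ℂ) := Complex.ofRealCLM.contDiff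
  exact (contDiff_const.add (h3.pow 2)).mul h2

lemma hasCompactSupport_weight (hψ : IsCutoff ψ) : HasCompactSupport (weight ψ) := by
  have h : HasCompactSupport fun t : ℝ => (ψ t : ℂ) :=
    hψ.hasCompactSupport.comp_left (g := fun x : ℝ => (x : ℂ)) Complex.ofReal_zero
  exact h.mul_left

lemma weight_neg (hψ : IsCutoff ψ) (t : ℝ) : weight ψ (-t) = weight ψ t := by
  simp [weight, hψ.even]

lemma deriv_weight_zero (hψ : IsCutoff ψ) : deriv (weight ψ) 0 = 0 := by
  have h : deriv (fun t => weight ψ (-t)) 0 = -deriv (weight ψ) (-0) := deriv_comp_neg _ _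
  have e : (fun t => weight ψ (-t)) = weight ψ := funext (weight_neg hψ)
  rw [e, neg_zero] at h
  exact self_eq_neg.1 h

end Weight

/-! ### Lebesgue measure on the plane -/

lemma measurableEmbedding_toLp_plane :
    MeasurableEmbedding (WithLp.toLp 2 : ℝ × ℝ → Plane) :=
  (MeasurableEquiv.toLp 2 (ℝ × ℝ)).measurableEmbedding

lemma measurePreserving_toLp_plane :
    MeasurePreserving (WithLp.toLp 2 : ℝ × ℝ → Plane) volume volume :=
  WithLp.volume_preserving_toLp ℝ ℝ

lemma measurePreserving_ofLp_plane :
    MeasurePreserving (WithLp.ofLp : Plane → ℝ × ℝ) volume volume :=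
  WithLp.volume_preserving_ofLp ℝ ℝ

lemma integral_plane (f : Plane → ℂ) : ∫ p, f p = ∫ q : ℝ × ℝ, f (pt q.1 q.2) :=
  (measurePreserving_toLp_plane.integral_comp measurableEmbedding_toLp_plane f).symm

lemma lintegral_plane (f : Plane → ℝ≥0∞) : ∫⁻ p, f p = ∫⁻ q : ℝ × ℝ, f (pt q.1 q.2) :=
  (measurePreserving_toLp_plane.lintegral_comp_emb measurableEmbedding_toLp_plane f).symm

lemma ae_pt_of_ae {P : Plane → Prop} (h : ∀ᵐ p, P p) : ∀ᵐ q : ℝ × ℝ, P (pt q.1 q.2) :=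
  measurePreserving_toLp_plane.quasiMeasurePreserving.ae h

lemma continuous_pt : Continuous fun q : ℝ × ℝ => pt q.1 q.2 :=
  WithLp.prod_continuous_toLp 2 ℝ ℝ

lemma continuous_plane_fst : Continuous fun p : Plane => p.fst :=
  continuous_fst.comp (WithLp.prod_continuous_ofLp 2 ℝ ℝ)

lemma continuous_plane_snd : Continuous fun p : Plane => p.snd :=
  continuous_snd.comp (WithLp.prod_continuous_ofLp 2 ℝ ℝ)

lemma aestronglyMeasurable_comp_fst {g : ℝ → ℂ} (hg : AEStronglyMeasurable g volume) :
    AEStronglyMeasurable (fun p : Plane => g p.fst) volume := by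
  have h : AEStronglyMeasurable (fun q : ℝ × ℝ => g q.1) volume := hg.comp_fst
  exact h.comp_measurePreserving measurePreserving_ofLp_plane

lemma pt_fst (x t : ℝ) : (pt x t).fst = x := rfl

lemma pt_snd (x t : ℝ) : (pt x t).snd = t := rfl

lemma inner_pt (x t ξ τ : ℝ) : inner ℝ (pt ξ τ) (pt x t) = x * ξ + t * τ := by
  rw [WithLp.prod_inner_apply]
  simp

/-! ### The Fourier transform of the localized flow -/

/-- The space-time multiplier `(1 - ∂_τ²) 𝓕 (ψ(t) exp (i t ω(ξ) - |t| ε ξ²))`. -/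
def multiplier (ψ : ℝ → ℝ) (ε : ℝ) (ξ τ : ℝ) : ℂ :=
  twoSided (weight ψ) (ε * ξ ^ 2) (τ - omega ξ)

lemma continuous_omega : Continuous omega := by unfold omega; fun_prop

lemma continuous_multiplier {ψ : ℝ → ℝ} (hψ : IsCutoff ψ) (ε : ℝ) :
    Continuous fun q : ℝ × ℝ => multiplier ψ ε q.1 q.2 := by
  have h := continuous_twoSided (contDiff_weight hψ).continuous (hasCompactSupport_weight hψ)
  have ho := continuous_omega
  have hq : Continuous fun q : ℝ × ℝ => (ε * q.1 ^ 2, q.2 - omega q.1) := by fun_prop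
  unfold multiplier
  exact Continuous.comp (g := fun q : ℝ × ℝ => twoSided (weight ψ) q.1 q.2)
    (f := fun q : ℝ × ℝ => (ε * q.1 ^ 2, q.2 - omega q.1)) h hq

lemma multiplier_eq_integral {ψ : ℝ → ℝ} (hψ : IsCutoff ψ) (ε ξ τ : ℝ) :
    multiplier ψ ε ξ τ = ∫ t : ℝ, weight ψ t * (Complex.exp (-(Complex.I * t * τ)) *
      symbol ε t ξ) := by
  rw [multiplier, twoSided_eq_integral (contDiff_weight hψ).continuous
    (hasCompactSupport_weight hψ) (weight_neg hψ)]
  congr 1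
  ext t
  rw [mul_comm, symbol, ← Complex.exp_add]
  congr 2
  push_cast
  ring

/-! ### Pairing of the localized flow with transforms of Schwartz functions. -/

lemma fourierSchwartz_apply {E : Type} [NormedAddCommGroup E] [InnerProductSpace ℝ E]
    [FiniteDimensional ℝ E] [MeasurableSpace E] [BorelSpace E] (Θ : 𝓢(E, ℂ)) (w : E) :
    fourierSchwartz E Θ w = (𝓕 Θ : 𝓢(E, ℂ)) ((2 * Real.pi)⁻¹ • w) := rfl

lemma fourierSchwartz_lineDeriv (Θ : 𝓢(Plane, ℂ)) (x t : ℝ) :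
    fourierSchwartz Plane (∂_{pt 0 1} Θ) (pt x t)
      = Complex.I * t * fourierSchwartz Plane Θ (pt x t) := by
  have h : (fun y : Plane => inner ℝ y (pt 0 1)).HasTemperateGrowth :=
    ((innerSL ℝ).flip (pt 0 1)).hasTemperateGrowth
  have hi : inner ℝ ((2 * Real.pi)⁻¹ • pt x t) (pt 0 1) = (2 * Real.pi)⁻¹ * t := by
    rw [real_inner_smul_left, inner_pt]; ring
  rw [fourierSchwartz_apply, fourierSchwartz_apply, SchwartzMap.fourier_lineDerivOp_eq,
    _root_.smul_apply, SchwartzMap.smulLeftCLM_apply_apply h, hi, Complex.real_smul,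
    smul_eq_mul, ← mul_assoc]
  congr 1
  have : (Real.pi : ℂ) ≠ 0 := by exact_mod_cast Real.pi_ne_zero
  push_cast
  field_simp

/-- The partial Fourier transform in the second variable. -/
def partialFourier (Θ : 𝓢(Plane, ℂ)) (t ξ : ℝ) : ℂ :=
  ∫ τ : ℝ, Complex.exp (-(Complex.I * t * τ)) * Θ (pt ξ τ)

lemma norm_exp_neg_I_mul (x y : ℝ) : ‖Complex.exp (-(Complex.I * x * y))‖ = 1 := by
  rw [show -(Complex.I * (x : ℂ) * y) = ((-(x * y) : ℝ) : ℂ) * Complex.I by push_cast; ring]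
  exact Complex.norm_exp_ofReal_mul_I _

lemma exists_norm_schwartz_le (Θ : 𝓢(Plane, ℂ)) :
    ∃ C : ℝ, 0 ≤ C ∧ ∀ ξ τ, ‖Θ (pt ξ τ)‖ ≤ C * (sliceBound ξ * sliceBound τ) := by
  refine ⟨2 ^ 4 * (Finset.Iic (4, 0)).sup (fun m => SchwartzMap.seminorm ℂ m.1 m.2) Θ,
    mul_nonneg (by positivity) (apply_nonneg _ _), fun ξ τ => ?_⟩
  have h := SchwartzMap.one_add_le_sup_seminorm_apply (𝕜 := ℂ) (m := (4, 0)) (k := 4) (n := 0)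
    le_rfl le_rfl Θ (pt ξ τ)
  rw [norm_iteratedFDeriv_zero] at h
  have hn : ‖pt ξ τ‖ ^ 2 = ξ ^ 2 + τ ^ 2 := by
    have h3 : ‖pt ξ τ‖ ^ 2 = |ξ| ^ 2 + |τ| ^ 2 := WithLp.prod_norm_sq_eq_of_L2 (pt ξ τ)
    simpa using h3
  have h0 := norm_nonneg (pt ξ τ)
  have h2 : (1 + ξ ^ 2) * (1 + τ ^ 2) ≤ (1 + ‖pt ξ τ‖) ^ 4 := by
    have h4 : 1 + ξ ^ 2 ≤ (1 + ‖pt ξ τ‖) ^ 2 := by nlinarith [sq_nonneg τ]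
    have h5 : 1 + τ ^ 2 ≤ (1 + ‖pt ξ τ‖) ^ 2 := by nlinarith [sq_nonneg ξ]
    calc (1 + ξ ^ 2) * (1 + τ ^ 2) ≤ (1 + ‖pt ξ τ‖) ^ 2 * (1 + ‖pt ξ τ‖) ^ 2 := by gcongr
      _ = _ := by ring
  unfold sliceBound
  rw [← mul_inv, ← div_eq_mul_inv, le_div_iff₀ (by positivity), mul_comm]
  exact (mul_le_mul_of_nonneg_right h2 (norm_nonneg _)).trans h

lemma integrable_sliceBound : Integrable sliceBound := integrable_inv_one_add_sq

lemma continuous_schwartz_pt (Θ : 𝓢(Plane, ℂ)) : Continuous fun q : ℝ × ℝ => Θ (pt q.1 q.2) :=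
  Θ.continuous.comp continuous_pt

lemma aestronglyMeasurable_partialFourier (Θ : 𝓢(Plane, ℂ)) (t : ℝ) :
    AEStronglyMeasurable (partialFourier Θ t) volume := by
  have hc : Continuous fun q : ℝ × ℝ => Complex.exp (-(Complex.I * t * q.2)) * Θ (pt q.1 q.2) :=
    (by fun_prop : Continuous fun q : ℝ × ℝ => Complex.exp (-(Complex.I * t * q.2))).mul
      (continuous_schwartz_pt Θ)
  exact (hc.aestronglyMeasurable (μ := volume.prod volume)).integral_prod_right'

lemma exists_norm_partialFourier_le (Θ : 𝓢(Plane, ℂ)) (t : ℝ) :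
    ∃ C : ℝ, ∀ ξ, ‖partialFourier Θ t ξ‖ ≤ C * sliceBound ξ := by
  obtain ⟨C, hC, h⟩ := exists_norm_schwartz_le Θ
  refine ⟨C * ∫ τ, sliceBound τ, fun ξ => ?_⟩
  have : C * (∫ τ, sliceBound τ) * sliceBound ξ = ∫ τ, C * sliceBound ξ * sliceBound τ := by
    rw [integral_const_mul]; ring
  rw [this]
  refine norm_integral_le_of_norm_le (integrable_sliceBound.const_mul _)
    (Eventually.of_forall fun τ => ?_)
  rw [norm_mul, norm_exp_neg_I_mul, one_mul, mul_assoc]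
  exact h ξ τ

lemma integrable_partialFourier (Θ : 𝓢(Plane, ℂ)) (t : ℝ) : Integrable (partialFourier Θ t) := by
  obtain ⟨C, h⟩ := exists_norm_partialFourier_le Θ t
  exact (integrable_sliceBound.const_mul C).mono' (aestronglyMeasurable_partialFourier Θ t)
    (Eventually.of_forall h)

lemma memLp_partialFourier (Θ : 𝓢(Plane, ℂ)) (t : ℝ) : MemLp (partialFourier Θ t) 2 volume := by
  obtain ⟨C, h⟩ := exists_norm_partialFourier_le Θ t
  exact (memLp_sliceBound.const_mul C).of_le (aestronglyMeasurable_partialFourier Θ t)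
    (Eventually.of_forall fun ξ => (h ξ).trans (Real.le_norm_self _))

lemma integrable_schwartz_pt (Θ : 𝓢(Plane, ℂ)) :
    Integrable (fun q : ℝ × ℝ => Θ (pt q.1 q.2)) (volume.prod volume) :=
  (measurePreserving_toLp_plane.integrable_comp_emb measurableEmbedding_toLp_plane).2 Θ.integrable

/-- Fubini reduces each time slice to a one-dimensional transform in `x`, to which the duality with
`W ε hε t φ` applies. -/
lemma fourierSchwartz_pt (Θ : 𝓢(Plane, ℂ)) (x t : ℝ) :
    fourierSchwartz Plane Θ (pt x t) = 𝓕 (partialFourier Θ t) ((2 * Real.pi)⁻¹ * x) := by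
  rw [fourierSchwartz_apply, SchwartzMap.fourier_coe, Real.fourier_eq', Real.fourier_eq',
    integral_plane]
  have hpi : (Real.pi : ℂ) ≠ 0 := by exact_mod_cast Real.pi_ne_zero
  have e : ∀ q : ℝ × ℝ, Complex.exp (((-2 * Real.pi *
      inner ℝ (pt q.1 q.2) ((2 * Real.pi)⁻¹ • pt x t) : ℝ) : ℂ) * Complex.I) • Θ (pt q.1 q.2)
      = Complex.exp (-(Complex.I * x * q.1)) *
        (Complex.exp (-(Complex.I * t * q.2)) * Θ (pt q.1 q.2)) := by
    intro q
    rw [smul_eq_mul, ← mul_assoc, ← Complex.exp_add, real_inner_smul_right, inner_pt]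
    congr 2
    push_cast
    field_simp
    ring
  simp_rw [e]
  have hi : Integrable (fun q : ℝ × ℝ => Complex.exp (-(Complex.I * x * q.1)) *
        (Complex.exp (-(Complex.I * t * q.2)) * Θ (pt q.1 q.2))) (volume.prod volume) := by
    refine ((integrable_schwartz_pt Θ).bdd_mul (c := 1)
      (by fun_prop : Continuous fun q : ℝ × ℝ =>
        Complex.exp (-(Complex.I * t * q.2))).aestronglyMeasurable
      (Eventually.of_forall fun q => (norm_exp_neg_I_mul _ _).le)).bdd_mul (c := 1)
      (by fun_prop : Continuous fun q : ℝ × ℝ =>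
        Complex.exp (-(Complex.I * x * q.1))).aestronglyMeasurable
      (Eventually.of_forall fun q => (norm_exp_neg_I_mul _ _).le)
  rw [Measure.volume_eq_prod, integral_prod _ hi]
  congr 1
  ext ξ
  dsimp only
  rw [integral_const_mul, smul_eq_mul, partialFourier]
  congr 2
  simp
  field_simp

lemma integral_slice_localizedFlow {ψ : ℝ → ℝ} {ε : ℝ} (hε : 0 ≤ ε) (φ : L2 ℝ)
    (Θ : 𝓢(Plane, ℂ)) (t : ℝ) :
    ∫ x : ℝ, fourierSchwartz Plane (Θ - ∂_{pt 0 1} (∂_{pt 0 1} Θ)) (pt x t) *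
        ((ψ t : ℂ) • W ε hε t φ) x
      = weight ψ t * ∫ ξ : ℝ, partialFourier Θ t ξ * (symbol ε t ξ * fourierL2 ℝ φ ξ) := by
  have h1 : ∫ x : ℝ, fourierSchwartz Plane (Θ - ∂_{pt 0 1} (∂_{pt 0 1} Θ)) (pt x t) *
        ((ψ t : ℂ) • W ε hε t φ) x
      = weight ψ t * ∫ x : ℝ, 𝓕 (partialFourier Θ t) ((2 * Real.pi)⁻¹ * x) * W ε hε t φ x := by
    rw [← integral_const_mul]
    refine integral_congr_ae ?_
    filter_upwards [Lp.coeFn_smul (ψ t : ℂ) (W ε hε t φ)] with x hx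
    -- Two `τ`-derivatives produce `(i t)² = -t²`, so `1 - ∂_τ²` becomes the factor `1 + t²` of
    -- `weight ψ`.
    rw [hx, map_sub, _root_.sub_apply, fourierSchwartz_lineDeriv, fourierSchwartz_lineDeriv,
      fourierSchwartz_pt, weight, Pi.smul_apply, smul_eq_mul]
    linear_combination (-(t : ℂ) ^ 2 * 𝓕 (partialFourier Θ t) ((2 * Real.pi)⁻¹ * x) * ψ t *
      W ε hε t φ x) * Complex.I_sq
  rw [h1, W, integral_fourier_mul_fourierInvL2 (integrable_partialFourier Θ t)
    (memLp_partialFourier Θ t)]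
  congr 1
  refine integral_congr_ae ?_
  filter_upwards [MemLp.coeFn_toLp (memLp_symbol_mul hε t (fourierL2 ℝ φ))] with ξ hξ
  rw [hξ]

lemma integrable_schwartz_mul (Θ : 𝓢(Plane, ℂ)) (g : L2 ℝ) :
    Integrable (fun q : ℝ × ℝ => Θ (pt q.1 q.2) * g q.1) (volume.prod volume) := by
  obtain ⟨C, hC, h⟩ := exists_norm_schwartz_le Θ
  have h1 : Integrable fun ξ => sliceBound ξ * ‖g ξ‖ :=
    memLp_sliceBound.integrable_mul (Lp.memLp g).norm
  refine ((h1.mul_prod integrable_sliceBound).const_mul C).mono'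
    ((continuous_schwartz_pt Θ).aestronglyMeasurable.mul (Lp.memLp g).1.comp_fst)
    (Eventually.of_forall fun q => ?_)
  rw [norm_mul]
  calc ‖Θ (pt q.1 q.2)‖ * ‖g q.1‖ ≤ C * (sliceBound q.1 * sliceBound q.2) * ‖g q.1‖ := by
        gcongr; exact h _ _
    _ = _ := by ring

/-- Fubini in `(t, ξ, τ)`, justified by the compact support of the weight, the decay of `Θ` and
`‖symbol ε t ξ‖ ≤ 1`. Carrying out the time integral first produces the multiplier. -/
lemma localizedFlow_fourierSchwartz {ψ : ℝ → ℝ} (hψ : IsCutoff ψ) {ε : ℝ} (hε : 0 ≤ ε)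
    (φ : L2 ℝ) (Θ : 𝓢(Plane, ℂ)) :
    localizedFlow ψ hψ ε hε φ (fourierSchwartz Plane (Θ - ∂_{pt 0 1} (∂_{pt 0 1} Θ)))
      = ∫ p : Plane, Θ p * (fourierL2 ℝ φ p.fst * multiplier ψ ε p.fst p.snd) := by
  have h1 : localizedFlow ψ hψ ε hε φ (fourierSchwartz Plane (Θ - ∂_{pt 0 1} (∂_{pt 0 1} Θ)))
      = ∫ t : ℝ, weight ψ t *
        ∫ ξ : ℝ, partialFourier Θ t ξ * (symbol ε t ξ * fourierL2 ℝ φ ξ) := by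
    simp_rw [← integral_slice_localizedFlow hε φ Θ]
    rfl
  have hG := integrable_schwartz_mul Θ (fourierL2 ℝ φ)
  set G : ℝ × ℝ → ℂ := fun q => Θ (pt q.1 q.2) * fourierL2 ℝ φ q.1
  have hs := continuous_symbol ε
  have hu : ∀ t τ ξ : ℝ, ‖Complex.exp (-(Complex.I * t * τ)) * symbol ε t ξ‖ ≤ 1 := by
    intro t τ ξ
    rw [norm_mul, norm_exp_neg_I_mul, one_mul]
    exact norm_symbol_le hε t ξ
  have h2 : ∀ t : ℝ, weight ψ t *
      ∫ ξ : ℝ, partialFourier Θ t ξ * (symbol ε t ξ * fourierL2 ℝ φ ξ)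
      = ∫ q : ℝ × ℝ, (Complex.exp (-(Complex.I * t * q.2)) * symbol ε t q.1) *
          (weight ψ t * G q) := by
    intro t
    have hi : Integrable (fun q : ℝ × ℝ => (Complex.exp (-(Complex.I * t * q.2)) *
        symbol ε t q.1) * (weight ψ t * G q)) (volume.prod volume) := by
      refine (hG.const_mul (weight ψ t)).bdd_mul (c := 1) (Continuous.aestronglyMeasurable ?_)
        (Eventually.of_forall fun q => hu t q.2 q.1)
      exact (by fun_prop : Continuous fun q : ℝ × ℝ => Complex.exp (-(Complex.I * t * q.2))).mul
        (hs.comp (by fun_prop : Continuous fun q : ℝ × ℝ => (t, q.1)))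
    rw [Measure.volume_eq_prod, integral_prod _ hi, ← integral_const_mul]
    congr 1
    ext ξ
    rw [partialFourier, ← integral_mul_const, ← integral_const_mul]
    congr 1
    ext τ
    simp only [G]
    ring
  have hF : Integrable (fun z : ℝ × (ℝ × ℝ) => (Complex.exp (-(Complex.I * z.1 * z.2.2)) *
      symbol ε z.1 z.2.1) * (weight ψ z.1 * G z.2)) (volume.prod volume) := by
    have hw : Integrable (weight ψ) :=
      (contDiff_weight hψ).continuous.integrable_of_hasCompactSupport
      (hasCompactSupport_weight hψ)
    refine (hw.mul_prod hG).bdd_mul (c := 1) (Continuous.aestronglyMeasurable ?_)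
      (Eventually.of_forall fun z => hu z.1 z.2.2 z.2.1)
    exact (by fun_prop : Continuous fun z : ℝ × (ℝ × ℝ) =>
      Complex.exp (-(Complex.I * z.1 * z.2.2))).mul
      (hs.comp (by fun_prop : Continuous fun z : ℝ × (ℝ × ℝ) => (z.1, z.2.1)))
  rw [h1, integral_plane]
  simp_rw [h2]
  rw [integral_integral_swap hF]
  congr 1
  ext q
  simp only [G]
  rw [pt_fst, pt_snd, multiplier_eq_integral hψ, ← mul_assoc, ← integral_const_mul]
  congr 1
  ext t
  ring

/-- All operators are moved onto the test function by duality; the two signs from the line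
derivatives cancel. This exhibits the `L²` representative needed to bound `normZDist`. -/
lemma toTemperedDistribution_eq_localizedFlow {η₀ ψ : ℝ → ℝ} (hη₀ : IsCutoff η₀)
    (hψ : IsCutoff ψ) {ε : ℝ} (hε : 0 ≤ ε) (φ : L2 ℝ) (k : ℕ) {f : L2 Plane}
    (hf : f =ᵐ[volume] fun p : Plane =>
      ((eta η₀ k p.fst : ℂ) * fourierL2 ℝ φ p.fst) * multiplier ψ ε p.fst p.snd) :
    Lp.toTemperedDistribution f
      = TemperedDistribution.smulLeftCLM ℂ (fun p : Plane => (eta η₀ k p.fst : ℂ))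
        (oneSubDtauSq (fourierDist Plane (localizedFlow ψ hψ ε hε φ))) := by
  ext Φ
  set Θ : 𝓢(Plane, ℂ) := SchwartzMap.smulLeftCLM ℂ (fun p : Plane => (eta η₀ k p.fst : ℂ)) Φ
    with hΘ
  have hΘ' : ∀ p, Θ p = (eta η₀ k p.fst : ℂ) * Φ p := fun p => by
    rw [hΘ, SchwartzMap.smulLeftCLM_apply_apply (hasTemperateGrowth_eta hη₀ k), smul_eq_mul]
  have h1 : TemperedDistribution.smulLeftCLM ℂ (fun p : Plane => (eta η₀ k p.fst : ℂ))
        (oneSubDtauSq (fourierDist Plane (localizedFlow ψ hψ ε hε φ))) Φ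
      = localizedFlow ψ hψ ε hε φ (fourierSchwartz Plane (Θ - ∂_{pt 0 1} (∂_{pt 0 1} Θ))) := by
    have h2 : ∀ T : 𝓢'(Plane, ℂ), oneSubDtauSq T Θ = T (Θ - ∂_{pt 0 1} (∂_{pt 0 1} Θ)) := by
      intro T
      have h3 : (∂_{pt 0 1} (∂_{pt 0 1} T)) Θ = T (∂_{pt 0 1} (∂_{pt 0 1} Θ)) := by
        rw [TemperedDistribution.lineDerivOp_apply_apply,
          TemperedDistribution.lineDerivOp_apply_apply, LineDeriv.lineDerivOp_neg, neg_neg]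
      rw [map_sub, ← h3]
      rfl
    rw [TemperedDistribution.smulLeftCLM_apply_apply, h2]
    rfl
  rw [h1, localizedFlow_fourierSchwartz, Lp.toTemperedDistribution_apply]
  refine integral_congr_ae ?_
  filter_upwards [hf] with p hp
  rw [hp, hΘ', smul_eq_mul]
  ring

/-! ### Supports of the dyadic cutoffs -/

section Cutoffs

variable {η₀ : ℝ → ℝ}

lemma IsCutoff.eq_zero (h : IsCutoff η₀) {x : ℝ} (hx : 8 / 5 < |x|) : η₀ x = 0 := by
  by_contra hne
  have := h.supp (subset_tsupport _ hne)
  exact absurd (abs_le.2 ⟨by linarith [this.1], this.2⟩) (not_le.2 hx)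

lemma IsCutoff.eq_one_of_abs_le (h : IsCutoff η₀) {x : ℝ} (hx : |x| ≤ 5 / 4) : η₀ x = 1 :=
  h.eq_one x ⟨(abs_le.1 hx).1, (abs_le.1 hx).2⟩

lemma abs_chi_le_one (h : IsCutoff η₀) (l : ℤ) (x : ℝ) : |chi η₀ l x| ≤ 1 := by
  have h1 := h.mem_Icc (x / 2 ^ l)
  have h2 := h.mem_Icc (x / 2 ^ (l - 1))
  rw [chi, abs_le]
  constructor <;> linarith [h1.1, h1.2, h2.1, h2.2]

lemma abs_le_of_chi_ne_zero (h : IsCutoff η₀) {l : ℤ} {x : ℝ} (hx : chi η₀ l x ≠ 0) :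
    |x| ≤ 8 / 5 * 2 ^ l := by
  by_contra! hlt
  have hp : (0 : ℝ) < 2 ^ l := by positivity
  have h2 : (2 : ℝ) ^ (l - 1) = 2 ^ l / 2 := by rw [zpow_sub_one₀ two_ne_zero]; ring
  refine hx ?_
  rw [chi, h.eq_zero, h.eq_zero, sub_zero]
  · rw [abs_div, abs_of_pos (by positivity : (0 : ℝ) < 2 ^ (l - 1)),
      lt_div_iff₀ (by positivity), h2]
    linarith
  · rwa [abs_div, abs_of_pos hp, lt_div_iff₀ hp]

lemma lt_abs_of_chi_ne_zero (h : IsCutoff η₀) {l : ℤ} {x : ℝ} (hx : chi η₀ l x ≠ 0) :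
    5 / 8 * 2 ^ l < |x| := by
  by_contra! hle
  have hp : (0 : ℝ) < 2 ^ l := by positivity
  have h2 : (2 : ℝ) ^ (l - 1) = 2 ^ l / 2 := by rw [zpow_sub_one₀ two_ne_zero]; ring
  refine hx ?_
  rw [chi, h.eq_one_of_abs_le, h.eq_one_of_abs_le, sub_self]
  · rw [abs_div, abs_of_pos (by positivity : (0 : ℝ) < 2 ^ (l - 1)),
      div_le_iff₀ (by positivity), h2]
    linarith
  · rw [abs_div, abs_of_pos hp, div_le_iff₀ hp]
    linarith

lemma eta_succ (j : ℕ) : eta η₀ (j + 1) = chi η₀ ((j + 1 : ℕ) : ℤ) := by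
  ext x; simp [eta]

lemma abs_eta_le_one (h : IsCutoff η₀) (j : ℕ) (x : ℝ) : |eta η₀ j x| ≤ 1 := by
  cases j with
  | zero =>
    have := h.mem_Icc x
    simpa [eta, abs_of_nonneg this.1] using this.2
  | succ j => rw [eta_succ]; exact abs_chi_le_one h _ x

lemma abs_le_of_eta_ne_zero (h : IsCutoff η₀) {j : ℕ} {x : ℝ} (hx : eta η₀ j x ≠ 0) :
    |x| ≤ 8 / 5 * 2 ^ j := by
  cases j with
  | zero =>
    by_contra! hlt
    exact hx (by simpa [eta] using h.eq_zero (by simpa using hlt))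
  | succ j =>
    rw [eta_succ] at hx
    have := abs_le_of_chi_ne_zero h hx
    rwa [zpow_natCast] at this

lemma lt_abs_of_eta_succ_ne_zero (h : IsCutoff η₀) {j : ℕ} {x : ℝ} (hx : eta η₀ (j + 1) x ≠ 0) :
    5 / 8 * 2 ^ (j + 1) < |x| := by
  rw [eta_succ] at hx
  have := lt_abs_of_chi_ne_zero h hx
  rwa [zpow_natCast] at this

/-- The summand `1/4` covers `j = 0`, where the cutoff does not keep `x` away from the origin. -/
lemma le_sq_of_eta_ne_zero (h : IsCutoff η₀) {j : ℕ} {x : ℝ} (hx : eta η₀ j x ≠ 0) :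
    (4 : ℝ) ^ j ≤ 4 * (1 / 4 + x ^ 2) := by
  cases j with
  | zero => nlinarith [sq_nonneg x]
  | succ j =>
    have h1 := lt_abs_of_eta_succ_ne_zero h hx
    have h2 : (4 : ℝ) ^ (j + 1) = (2 ^ (j + 1)) ^ 2 := by
      rw [← pow_mul, mul_comm, pow_mul]; norm_num
    rw [h2, ← sq_abs x]
    have : (0 : ℝ) < 2 ^ (j + 1) := by positivity
    nlinarith

lemma continuous_eta (h : IsCutoff η₀) (j : ℕ) : Continuous (eta η₀ j) :=
  (contDiff_eta h j).continuous

lemma continuous_chi (h : IsCutoff η₀) (l : ℤ) : Continuous (chi η₀ l) := by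
  have := h.smooth.continuous
  unfold chi
  fun_prop

end Cutoffs

/-! ### `L²` norms on the plane -/

/-- For fixed `ξ` the shift by `c ξ` does not change the `L²_τ` norm of `Q`, so Tonelli separates
the variables. -/
lemma eLpNorm_plane_le {f : ℝ → ℂ} (hf : AEStronglyMeasurable f volume) {Q : ℝ → ℝ}
    (hQ : Measurable Q) {c : ℝ → ℝ} (hc : Measurable c) {F : Plane → ℂ}
    (h : ∀ᵐ p : Plane, ‖F p‖ ≤ ‖f p.fst‖ * ‖Q (p.snd - c p.fst)‖) :
    eLpNorm F 2 volume ≤ eLpNorm f 2 volume * eLpNorm Q 2 volume := by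
  have hm : AEMeasurable (fun q : ℝ × ℝ =>
      ‖f q.1‖ₑ ^ (2 : ℝ) * ‖Q (q.2 - c q.1)‖ₑ ^ (2 : ℝ)) (volume.prod volume) := by
    refine (hf.comp_fst.enorm.pow_const _).mul ?_
    exact (hQ.comp (measurable_snd.sub (hc.comp measurable_fst))).enorm.aemeasurable.pow_const _
  rw [eLpNorm_eq_lintegral_rpow_enorm_toReal (by norm_num) (by norm_num),
    eLpNorm_eq_lintegral_rpow_enorm_toReal (by norm_num) (by norm_num),
    eLpNorm_eq_lintegral_rpow_enorm_toReal (by norm_num) (by norm_num),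
    ← ENNReal.mul_rpow_of_nonneg _ _ (by norm_num)]
  refine ENNReal.rpow_le_rpow ?_ (by norm_num)
  simp only [ENNReal.toReal_ofNat]
  calc ∫⁻ p, ‖F p‖ₑ ^ (2 : ℝ)
      ≤ ∫⁻ p : Plane, ‖f p.fst‖ₑ ^ (2 : ℝ) * ‖Q (p.snd - c p.fst)‖ₑ ^ (2 : ℝ) := by
        refine lintegral_mono_ae ?_
        filter_upwards [h] with p hp
        rw [← ENNReal.mul_rpow_of_nonneg _ _ (by norm_num)]
        refine ENNReal.rpow_le_rpow ?_ (by norm_num)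
        rw [← ofReal_norm, ← ofReal_norm, ← ofReal_norm, ← ENNReal.ofReal_mul (norm_nonneg _)]
        exact ENNReal.ofReal_le_ofReal hp
    _ = ∫⁻ q : ℝ × ℝ, ‖f q.1‖ₑ ^ (2 : ℝ) * ‖Q (q.2 - c q.1)‖ₑ ^ (2 : ℝ) := lintegral_plane _
    _ = ∫⁻ ξ, ∫⁻ τ, ‖f ξ‖ₑ ^ (2 : ℝ) * ‖Q (τ - c ξ)‖ₑ ^ (2 : ℝ) := by
        rw [Measure.volume_eq_prod, lintegral_prod _ hm]
    _ = ∫⁻ ξ, ‖f ξ‖ₑ ^ (2 : ℝ) * ∫⁻ τ, ‖Q τ‖ₑ ^ (2 : ℝ) := by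
        congr 1
        ext ξ
        rw [lintegral_const_mul _ (by fun_prop),
          lintegral_sub_right_eq_self (fun τ => ‖Q τ‖ₑ ^ (2 : ℝ)) (c ξ)]
    _ = (∫⁻ ξ, ‖f ξ‖ₑ ^ (2 : ℝ)) * ∫⁻ τ, ‖Q τ‖ₑ ^ (2 : ℝ) :=
        lintegral_mul_const'' _ (hf.enorm.pow_const _)

/-- Height times the square root of the width of a strip around the curve `τ = c(ξ)`. It is used
with `c = ω` for `X_k`, `k ≥ 1`, and with `c = 0` at low frequencies. -/
lemma eLpNorm_plane_strip_le {f : ℝ → ℂ} (hf : AEStronglyMeasurable f volume) {q R : ℝ}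
    (hq : 0 ≤ q) (hR : 0 ≤ R) {c : ℝ → ℝ} (hc : Measurable c) {F : Plane → ℂ}
    (h : ∀ᵐ p : Plane, F p ≠ 0 → |p.snd - c p.fst| ≤ R ^ 2 ∧ ‖F p‖ ≤ q * ‖f p.fst‖) :
    eLpNorm F 2 volume ≤ ENNReal.ofReal (2 * q * R) * eLpNorm f 2 volume := by
  set Q : ℝ → ℝ := (Icc (-R ^ 2) (R ^ 2)).indicator fun _ => q with hQdef
  have hQ : Measurable Q := measurable_const.indicator measurableSet_Icc
  have h1 : eLpNorm F 2 volume ≤ eLpNorm f 2 volume * eLpNorm Q 2 volume := by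
    refine eLpNorm_plane_le hf hQ hc ?_
    filter_upwards [h] with p hp
    by_cases h0 : F p = 0
    · rw [h0, norm_zero]; positivity
    obtain ⟨h2, h3⟩ := hp h0
    have : Q (p.snd - c p.fst) = q :=
      indicator_of_mem (show _ ∈ Icc _ _ from ⟨by linarith [(abs_le.1 h2).1], (abs_le.1 h2).2⟩) _
    rw [this, Real.norm_of_nonneg hq, mul_comm]
    exact h3
  refine h1.trans ?_
  rw [mul_comm]
  gcongr
  rw [hQdef, eLpNorm_indicator_const measurableSet_Icc (by norm_num) (by norm_num), Real.volume_Icc,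
    Real.enorm_eq_ofReal hq, ENNReal.ofReal_rpow_of_nonneg (by nlinarith) (by norm_num),
    ← ENNReal.ofReal_mul hq]
  refine ENNReal.ofReal_le_ofReal ?_
  have e : R ^ 2 - -R ^ 2 = 2 * R ^ 2 := by ring
  have h2 : (R ^ 2 - -R ^ 2) ^ (1 / (2 : ℝ≥0∞).toReal) ≤ 2 * R := by
    rw [e, ENNReal.toReal_ofNat, ← Real.sqrt_eq_rpow, Real.sqrt_le_left (by positivity)]
    nlinarith
  nlinarith

/-! ### Bounds for the multiplier -/

section MultiplierBounds

variable {ψ : ℝ → ℝ}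

lemma exists_norm_multiplier_le (hψ : IsCutoff ψ) :
    ∃ C : ℝ, 0 ≤ C ∧ ∀ ε ξ τ : ℝ, 0 ≤ ε → ‖multiplier ψ ε ξ τ‖ ≤
      C * ((1 + ε * ξ ^ 2) / ((1 + ε * ξ ^ 2) ^ 2 + (τ - omega ξ) ^ 2)) := by
  obtain ⟨C, hC, h⟩ := exists_norm_twoSided_le (contDiff_weight hψ) (hasCompactSupport_weight hψ)
    (deriv_weight_zero hψ)
  exact ⟨C, hC, fun ε ξ τ hε => h _ _ (by positivity)⟩

lemma abs_omega_le {ξ : ℝ} (hξ : |ξ| ≤ 2) : |omega ξ| ≤ 4 := by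
  rw [omega, abs_mul, abs_neg, abs_abs]
  nlinarith [abs_nonneg ξ]

/-- At low frequencies the modulation `τ - ω(ξ)` and `τ` are interchangeable, since `τ² ≤ 2(τ - ω)²
+ 2ω²` and `ω² ≤ 16`. -/
lemma one_add_sq_le {ξ τ : ℝ} (hξ : |ξ| ≤ 2) : 1 + τ ^ 2 ≤ 33 * (1 + (τ - omega ξ) ^ 2) := by
  have h := abs_omega_le hξ
  have h2 : omega ξ ^ 2 ≤ 16 := by rw [← sq_abs]; nlinarith [abs_nonneg (omega ξ)]
  nlinarith [sq_nonneg (τ - 2 * omega ξ)]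

/-- Here `ε ξ² ≤ 4`, so the Poisson kernel has bounded width; `165 = 5 · 33`. -/
lemma exists_norm_multiplier_le_low (hψ : IsCutoff ψ) :
    ∃ C : ℝ, 0 ≤ C ∧ ∀ ε ξ τ : ℝ, 0 ≤ ε → ε ≤ 1 → |ξ| ≤ 2 →
      ‖multiplier ψ ε ξ τ‖ ≤ C / (1 + τ ^ 2) := by
  obtain ⟨C, hC, h⟩ := exists_norm_multiplier_le hψ
  refine ⟨165 * C, by positivity, fun ε ξ τ hε hε1 hξ => (h ε ξ τ hε).trans ?_⟩
  have h1 := one_add_sq_le (τ := τ) hξ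
  have h2 : ξ ^ 2 ≤ 4 := by rw [← sq_abs]; nlinarith [abs_nonneg ξ]
  have h3 : 0 ≤ ε * ξ ^ 2 := by positivity
  have h4 : ε * ξ ^ 2 ≤ 4 := by nlinarith [sq_nonneg ξ]
  rw [← mul_div_assoc, div_le_div_iff₀ (by positivity) (by positivity)]
  set s := τ - omega ξ
  set a := ε * ξ ^ 2
  have h5 : (1 + a) * (1 + τ ^ 2) ≤ 165 * ((1 + a) ^ 2 + s ^ 2) := by
    calc (1 + a) * (1 + τ ^ 2) ≤ 5 * (33 * (1 + s ^ 2)) := by gcongr; linarith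
      _ ≤ _ := by nlinarith
  calc C * (1 + a) * (1 + τ ^ 2) = C * ((1 + a) * (1 + τ ^ 2)) := by ring
    _ ≤ C * (165 * ((1 + a) ^ 2 + s ^ 2)) := by gcongr
    _ = _ := by ring

/-- The Poisson kernel of width at least one is bounded by `(1 + s²)^(-1/2)`, which is square
integrable in `s`. -/
lemma memLp_mul_multiplier (hψ : IsCutoff ψ) {ε : ℝ} (hε : 0 ≤ ε) {g : ℝ → ℂ}
    (hg : MemLp g 2 volume) :
    MemLp (fun p : Plane => g p.fst * multiplier ψ ε p.fst p.snd) 2 volume := by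
  obtain ⟨C, hC, h⟩ := exists_norm_multiplier_le hψ
  have hcont : Continuous fun s : ℝ => C * √(sliceBound s) := by
    have : Continuous sliceBound := by
      unfold sliceBound
      exact Continuous.inv₀ (by fun_prop) (fun x => by positivity)
    fun_prop
  have hQ : MemLp (fun s : ℝ => C * √(sliceBound s)) 2 volume := by
    rw [memLp_two_iff_integrable_sq hcont.aestronglyMeasurable]
    refine (integrable_sliceBound.const_mul (C ^ 2)).congr (Eventually.of_forall fun s => ?_)
    dsimp only
    rw [mul_pow, Real.sq_sqrt (by unfold sliceBound; positivity)]
  refine ⟨(aestronglyMeasurable_comp_fst hg.1).mul (((continuous_multiplier hψ ε).comp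
    (continuous_plane_fst.prodMk continuous_plane_snd)).aestronglyMeasurable), ?_⟩
  refine (eLpNorm_plane_le hg.1 hcont.measurable continuous_omega.measurable
    (Eventually.of_forall fun p => ?_)).trans_lt (ENNReal.mul_lt_top hg.2 hQ.2)
  rw [norm_mul]
  gcongr
  refine (h ε p.fst p.snd hε).trans ?_
  rw [Real.norm_of_nonneg (by positivity)]
  gcongr
  set a := ε * p.fst ^ 2
  have ha : 0 ≤ a := by positivity
  refine Real.le_sqrt_of_sq_le ?_
  unfold sliceBound
  rw [div_pow, ← one_div, div_le_div_iff₀ (by positivity) (by positivity), one_mul,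
    sq ((1 + a) ^ 2 + _)]
  gcongr
  · nlinarith [sq_nonneg (p.snd - omega p.fst)]
  · nlinarith

end MultiplierBounds

/-! ### Dyadic sums -/

lemma two_rpow_half (j : ℕ) : (2 : ℝ≥0∞) ^ ((j : ℝ) / 2) = ENNReal.ofReal (√2 ^ j) := by
  rw [show (2 : ℝ≥0∞) = ENNReal.ofReal 2 by simp, ENNReal.ofReal_rpow_of_pos two_pos,
    Real.sqrt_eq_rpow, ← Real.rpow_natCast, ← Real.rpow_mul zero_le_two]
  congr 2
  ring

lemma beta_eq (k j : ℕ) : beta k j = ENNReal.ofReal (1 + √2 ^ j / (√2 ^ k) ^ 2) := by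
  rw [beta, ENNReal.ofReal_add zero_le_one (by positivity), ENNReal.ofReal_one,
    show (2 : ℝ≥0∞) = ENNReal.ofReal 2 by simp, ENNReal.ofReal_rpow_of_pos two_pos]
  congr 2
  rw [← pow_mul, ← Real.rpow_natCast, ← Real.rpow_natCast, Real.sqrt_eq_rpow,
    ← Real.rpow_mul zero_le_two, ← Real.rpow_mul zero_le_two, ← Real.rpow_sub two_pos]
  congr 1
  push_cast
  ring

/-- The sum `∑_{i ∈ ℤ} 2^(-|i|/2)`. -/
def dyadicSum : ℝ≥0∞ := ∑' i : ℤ, ENNReal.ofReal ((√2)⁻¹ ^ i.natAbs)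

lemma inv_sqrt_two_lt_one : (√2)⁻¹ < 1 :=
  inv_lt_one_of_one_lt₀ (by rw [Real.lt_sqrt zero_le_one]; norm_num)

lemma dyadicSum_ne_top : dyadicSum ≠ ⊤ := by
  have hs : Summable fun n : ℕ => (√2)⁻¹ ^ n :=
    summable_geometric_of_lt_one (by positivity) inv_sqrt_two_lt_one
  have h : Summable fun i : ℤ => (√2)⁻¹ ^ i.natAbs := by
    refine Summable.of_nat_of_neg ?_ ?_ <;> simpa using hs
  rw [dyadicSum, ← ENNReal.ofReal_tsum_of_nonneg (fun i => by positivity) h]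
  exact ENNReal.ofReal_ne_top

lemma tsum_ofReal_natAbs_sub_le (n : ℕ) :
    ∑' j : ℕ, ENNReal.ofReal ((√2)⁻¹ ^ ((j : ℤ) - n).natAbs) ≤ dyadicSum :=
  ENNReal.tsum_comp_le_tsum_of_injective (f := fun j : ℕ => (j : ℤ) - n)
    (fun a b h => by simpa using h) fun i : ℤ => ENNReal.ofReal ((√2)⁻¹ ^ i.natAbs)

lemma tsum_ofReal_pow_le : ∑' j : ℕ, ENNReal.ofReal ((√2)⁻¹ ^ j) ≤ dyadicSum := by
  simpa using tsum_ofReal_natAbs_sub_le 0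

/-! ### Geometric decay of a single dyadic term. -/

lemma inv_pow_natAbs_sub {ρ : ℝ} (hρ : 0 < ρ) (j n : ℕ) :
    (j ≤ n ∧ ρ⁻¹ ^ ((j : ℤ) - n).natAbs = ρ ^ j / ρ ^ n) ∨
    (n ≤ j ∧ ρ⁻¹ ^ ((j : ℤ) - n).natAbs = ρ ^ n / ρ ^ j) := by
  rcases le_total j n with h | h
  · refine Or.inl ⟨h, ?_⟩
    obtain ⟨d, rfl⟩ := Nat.exists_eq_add_of_le h
    have : ((j : ℤ) - (j + d : ℕ)).natAbs = d := by omega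
    rw [this, pow_add, inv_pow]
    field_simp
  · refine Or.inr ⟨h, ?_⟩
    obtain ⟨d, rfl⟩ := Nat.exists_eq_add_of_le h
    have : (((n + d : ℕ) : ℤ) - n).natAbs = d := by omega
    rw [this, pow_add, inv_pow]
    field_simp

/-- Meant for `u = √2^j`, `w = √2^k` and `v² = 2^n`, the power of two just below `B`. The hypothesis
`B ≤ 2 w⁴` lets `v` replace `w²` in the factor `β_{k,j}`, which removes the dependence on `k`. -/
lemma dyadic_term_le {u v w B : ℝ} (hu : 0 < u) (hv : 1 ≤ v) (hw : 0 < w) (hB : v ^ 2 ≤ B)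
    (hB' : B ≤ 2 * v ^ 2) (hBw : B ≤ 2 * w ^ 4) :
    u * (1 + u / w ^ 2) * (u * (B / (B ^ 2 + u ^ 4)))
      ≤ 2 * v ^ 2 * (u ^ 2 + 2 * u ^ 3 / v) / (v ^ 4 + u ^ 4) := by
  have hv0 : 0 < v := by linarith
  have hB0 : 0 < B := by nlinarith
  have h1 : v ≤ 2 * w ^ 2 := by nlinarith [sq_nonneg (v - 2 * w ^ 2), pow_pos hw 2]
  have h2 : u / w ^ 2 ≤ 2 * u / v := by
    rw [div_le_div_iff₀ (by positivity) hv0]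
    nlinarith
  have h3 : B / (B ^ 2 + u ^ 4) ≤ 2 * v ^ 2 / (v ^ 4 + u ^ 4) := by
    have : v ^ 4 ≤ B ^ 2 := by nlinarith [sq_nonneg v]
    gcongr
  calc u * (1 + u / w ^ 2) * (u * (B / (B ^ 2 + u ^ 4)))
      ≤ u * (1 + 2 * u / v) * (u * (2 * v ^ 2 / (v ^ 4 + u ^ 4))) := by gcongr
    _ = _ := by field_simp

lemma dyadic_term_le_of_le {u v : ℝ} (hu : 0 < u) (hv : 0 < v) (h : u ≤ v) :
    2 * v ^ 2 * (u ^ 2 + 2 * u ^ 3 / v) / (v ^ 4 + u ^ 4) ≤ 6 * (u / v) := by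
  have e : 2 * v ^ 2 * (u ^ 2 + 2 * u ^ 3 / v) = 2 * v * u ^ 2 * (v + 2 * u) := by field_simp
  rw [e, ← mul_div_assoc, div_le_div_iff₀ (by positivity) hv]
  calc 2 * v * u ^ 2 * (v + 2 * u) * v ≤ 2 * v * (u * v) * (v + 2 * v) * v := by
        gcongr; nlinarith
    _ = 6 * u * v ^ 4 := by ring
    _ ≤ 6 * u * (v ^ 4 + u ^ 4) := by gcongr; linarith [pow_pos hu 4]

lemma dyadic_term_le_of_ge {u v : ℝ} (hu : 0 < u) (hv : 0 < v) (h : v ≤ u) :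
    2 * v ^ 2 * (u ^ 2 + 2 * u ^ 3 / v) / (v ^ 4 + u ^ 4) ≤ 6 * (v / u) := by
  have e : 2 * v ^ 2 * (u ^ 2 + 2 * u ^ 3 / v) = 2 * v * u ^ 2 * (v + 2 * u) := by field_simp
  rw [e, ← mul_div_assoc, div_le_div_iff₀ (by positivity) hu]
  calc 2 * v * u ^ 2 * (v + 2 * u) * u ≤ 2 * v * u ^ 2 * (u + 2 * u) * u := by gcongr
    _ = 6 * v * u ^ 4 := by ring
    _ ≤ 6 * v * (v ^ 4 + u ^ 4) := by gcongr; linarith [pow_pos hv 4]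

/-- The terms peak at `2^j ~ B`. Below the peak they lose at least a factor `√2` per step from the
growth of `2^j/B`. Above it the ratio `B/2^j` wins against `β_{k,j}`, still leaving `(B/2^j)^(1/2)`
because `B ≲ 4^k`. -/
lemma tsum_dyadic_le {B : ℝ} (hB : 1 ≤ B) (k : ℕ) (hBk : B ≤ 2 * 4 ^ k) :
    ∑' j : ℕ, ENNReal.ofReal
      (√2 ^ j * (1 + √2 ^ j / (√2 ^ k) ^ 2) * (√2 ^ j * (B / (B ^ 2 + 4 ^ j))))
      ≤ 6 * dyadicSum := by
  obtain ⟨n, hn, hn'⟩ := exists_nat_pow_near hB one_lt_two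
  have hs : √2 ^ 2 = (2 : ℝ) := Real.sq_sqrt zero_le_two
  have hs4 : ∀ m : ℕ, (√2 ^ m) ^ 4 = (4 : ℝ) ^ m := fun m => by
    rw [← pow_mul, mul_comm, pow_mul, show √2 ^ 4 = (√2 ^ 2) ^ 2 by ring, hs]; norm_num
  have hs2 : (√2 ^ n) ^ 2 = (2 : ℝ) ^ n := by rw [← pow_mul, mul_comm, pow_mul, hs]
  have h1 : (1 : ℝ) ≤ √2 := Real.one_le_sqrt.2 one_le_two
  calc _ ≤ ∑' j : ℕ, 6 * ENNReal.ofReal ((√2)⁻¹ ^ ((j : ℤ) - n).natAbs) := by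
        refine ENNReal.tsum_le_tsum fun j => ?_
        rw [show (6 : ℝ≥0∞) = ENNReal.ofReal 6 by simp, ← ENNReal.ofReal_mul (by norm_num)]
        refine ENNReal.ofReal_le_ofReal ?_
        rw [← hs4 j]
        refine (dyadic_term_le (v := √2 ^ n) (by positivity) (one_le_pow₀ h1) (by positivity)
          (by rwa [hs2]) (by rw [hs2, mul_comm, ← pow_succ]; exact hn'.le) (by rwa [hs4])).trans ?_
        rcases inv_pow_natAbs_sub (ρ := √2) (by positivity) j n with ⟨hjn, e⟩ | ⟨hjn, e⟩
        · rw [e]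
          exact dyadic_term_le_of_le (by positivity) (by positivity) (pow_le_pow_right₀ h1 hjn)
        · rw [e]
          exact dyadic_term_le_of_ge (by positivity) (by positivity) (pow_le_pow_right₀ h1 hjn)
    _ ≤ 6 * dyadicSum := by
        rw [ENNReal.tsum_mul_left]
        gcongr
        exact tsum_ofReal_natAbs_sub_le n

/-! ### The high frequencies -/

section HighFrequency

variable {η₀ ψ : ℝ → ℝ}

lemma mem_Itilde_of_eta_ne_zero (h : IsCutoff η₀) {k : ℕ} {x : ℝ} (hx : eta η₀ k x ≠ 0) :
    x ∈ Itilde k := by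
  have h1 := abs_le_of_eta_ne_zero h hx
  cases k with
  | zero =>
    have h2 : |x| ≤ 2 := by norm_num at h1; linarith
    simpa [Itilde] using abs_le.1 h2
  | succ k =>
    have h2 := lt_abs_of_eta_succ_ne_zero h hx
    have hp : (0 : ℝ) < 2 ^ (k + 1) := by positivity
    have e1 : (2 : ℝ) ^ (((k + 1 : ℕ) : ℤ) - 1) = 2 ^ (k + 1) / 2 := by
      rw [zpow_sub_one₀ two_ne_zero, zpow_natCast]; ring
    have e2 : (2 : ℝ) ^ (((k + 1 : ℕ) : ℤ) + 1) = 2 ^ (k + 1) * 2 := by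
      rw [zpow_add_one₀ two_ne_zero, zpow_natCast]
    rw [Itilde, if_neg (Nat.succ_ne_zero k), mem_ofPred_eq, e1, e2]
    constructor <;> linarith

/-- Replaces the true width `b = 1 + ε ξ²` by the dyadic `B`, and `s²` by `y = 4^j`. The factors
`25/64` and `64/25` are the squares of the endpoints of the support of `η_k`. -/
lemma multiplier_ratio_le {B b s y : ℝ} (hB : 1 ≤ B) (hb : 25 / 64 * B ≤ b) (hb' : b ≤ 64 / 25 * B)
    (hy : 0 ≤ y) (hs : y ≤ 4 * (1 / 4 + s ^ 2)) :
    b / (b ^ 2 + s ^ 2) ≤ 40 * (B / (B ^ 2 + y)) := by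
  have hb0 : 0 < b := by linarith
  rw [← mul_div_assoc, div_le_div_iff₀ (by positivity) (by positivity)]
  have h1 : 625 / 4096 * B ^ 2 ≤ b ^ 2 := by nlinarith
  have h2 : B ^ 2 + y ≤ 14 * (b ^ 2 + s ^ 2) := by nlinarith [sq_nonneg s]
  calc b * (B ^ 2 + y) ≤ 64 / 25 * B * (14 * (b ^ 2 + s ^ 2)) := by gcongr
    _ ≤ _ := by
      nlinarith [mul_nonneg (by linarith : (0 : ℝ) ≤ B) (add_nonneg (sq_nonneg b) (sq_nonneg s))]

/-- On each block in `j` the multiplier is at most its Poisson height and the strip has width of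
order `2^j`; the resulting series is the one in `tsum_dyadic_le`. -/
lemma normX_le_high (hη₀ : IsCutoff η₀) (hψ : IsCutoff ψ) :
    ∃ C : ℝ≥0, ∀ ε : ℝ, 0 ≤ ε → ε ≤ 1 → ∀ (k : ℕ) (v : ℝ → ℂ) (f : L2 Plane), k ≠ 0 →
      AEStronglyMeasurable v volume →
      f =ᵐ[volume] (fun p : Plane =>
        ((eta η₀ k p.fst : ℂ) * v p.fst) * multiplier ψ ε p.fst p.snd) →
      normX η₀ k f ≤ C * eLpNorm (fun ξ => (eta η₀ k ξ : ℂ) * v ξ) 2 volume := by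
  obtain ⟨C, hC, h⟩ := exists_norm_multiplier_le hψ
  refine ⟨(ENNReal.ofReal (160 * C) * (6 * dyadicSum)).toNNReal, ?_⟩
  intro ε hε hε1 k v f hk hv hf
  rw [ENNReal.coe_toNNReal (by
    exact ENNReal.mul_ne_top ENNReal.ofReal_ne_top
      (ENNReal.mul_ne_top (by norm_num) dyadicSum_ne_top))]
  set g : ℝ → ℂ := fun ξ => (eta η₀ k ξ : ℂ) * v ξ with hg
  have hgm : AEStronglyMeasurable g volume :=
    (Complex.continuous_ofReal.comp (continuous_eta hη₀ k)).aestronglyMeasurable.mul hv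
  have hsupp : ∀ᵐ p : Plane, p.fst ∉ Itilde k → f p = 0 := by
    filter_upwards [hf] with p hp hnot
    have : eta η₀ k p.fst = 0 := by
      by_contra hne
      exact hnot (mem_Itilde_of_eta_ne_zero hη₀ hne)
    rw [hp, this]
    simp
  rw [normX, if_pos hsupp, if_neg hk]
  set B : ℝ := 1 + ε * 4 ^ k with hBdef
  have hB : 1 ≤ B := by rw [hBdef]; linarith [show 0 ≤ ε * (4 : ℝ) ^ k by positivity]
  have h4k : (1 : ℝ) ≤ 4 ^ k := one_le_pow₀ (by norm_num)
  have hBk : B ≤ 2 * 4 ^ k := by rw [hBdef]; nlinarith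
  have hterm : ∀ j : ℕ, (2 : ℝ≥0∞) ^ ((j : ℝ) / 2) * beta k j *
      eLpNorm (fun p : Plane => (eta η₀ j (p.snd - omega p.fst) : ℂ) * f p) 2 volume
      ≤ ENNReal.ofReal (160 * C) * ENNReal.ofReal
        (√2 ^ j * (1 + √2 ^ j / (√2 ^ k) ^ 2) * (√2 ^ j * (B / (B ^ 2 + 4 ^ j)))) *
        eLpNorm g 2 volume := by
    intro j
    have hn : eLpNorm (fun p : Plane => (eta η₀ j (p.snd - omega p.fst) : ℂ) * f p) 2 volume
        ≤ ENNReal.ofReal (2 * (C * (40 * (B / (B ^ 2 + 4 ^ j)))) * (2 * √2 ^ j)) *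
          eLpNorm g 2 volume := by
      -- Half-width `R² = 4 · 2^j`, which contains the support bound `8/5 · 2^j`; the factors `2 ·
      -- 40 · 2` give the constant `160`.
      refine eLpNorm_plane_strip_le hgm (by positivity) (by positivity)
        continuous_omega.measurable ?_
      filter_upwards [hf] with p hp hne
      have hηj : eta η₀ j (p.snd - omega p.fst) ≠ 0 := by
        intro h0; exact hne (by simp [h0])
      have hηk : eta η₀ k p.fst ≠ 0 := by
        intro h0; exact hne (by simp [hp, h0])
      constructor
      · refine (abs_le_of_eta_ne_zero hη₀ hηj).trans ?_
        rw [mul_pow, ← pow_mul, mul_comm j, pow_mul, Real.sq_sqrt zero_le_two]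
        linarith [show (0 : ℝ) < 2 ^ j by positivity]
      · rw [hp, norm_mul, norm_mul, Complex.norm_real]
        have h1 : ‖eta η₀ j (p.snd - omega p.fst)‖ ≤ 1 := abs_eta_le_one hη₀ j _
        have h2 : ‖multiplier ψ ε p.fst p.snd‖ ≤ C * (40 * (B / (B ^ 2 + 4 ^ j))) := by
          refine (h ε p.fst p.snd hε).trans ?_
          gcongr
          have hup := abs_le_of_eta_ne_zero hη₀ hηk
          have hlow : 5 / 8 * 2 ^ k < |p.fst| := by
            obtain ⟨m, rfl⟩ := Nat.exists_eq_succ_of_ne_zero hk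
            exact lt_abs_of_eta_succ_ne_zero hη₀ hηk
          have e4 : (4 : ℝ) ^ k = (2 ^ k) ^ 2 := by
            rw [← pow_mul, mul_comm, pow_mul]; norm_num
          have hp2 : (0 : ℝ) < 2 ^ k := by positivity
          have hx1 : 25 / 64 * (4 : ℝ) ^ k ≤ p.fst ^ 2 := by
            rw [e4, ← sq_abs p.fst]; nlinarith
          have hx2 : p.fst ^ 2 ≤ 64 / 25 * (4 : ℝ) ^ k := by
            rw [e4, ← sq_abs p.fst]; nlinarith [abs_nonneg p.fst]
          have hy1 := mul_le_mul_of_nonneg_left hx1 hε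
          have hy2 := mul_le_mul_of_nonneg_left hx2 hε
          exact multiplier_ratio_le hB (by rw [hBdef]; linarith) (by rw [hBdef]; linarith)
            (by positivity) (le_sq_of_eta_ne_zero hη₀ hηj)
        calc _ ≤ 1 * (‖g p.fst‖ * (C * (40 * (B / (B ^ 2 + 4 ^ j))))) := by
              gcongr
          _ = _ := by ring
    refine (mul_le_mul_right hn _).trans ?_
    rw [two_rpow_half, beta_eq, ← ENNReal.ofReal_mul (by positivity), ← mul_assoc,
      ← ENNReal.ofReal_mul (by positivity), ← ENNReal.ofReal_mul (by positivity)]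
    refine le_of_eq ?_
    congr 2
    ring
  calc _ ≤ ∑' j : ℕ, ENNReal.ofReal (160 * C) * ENNReal.ofReal
        (√2 ^ j * (1 + √2 ^ j / (√2 ^ k) ^ 2) * (√2 ^ j * (B / (B ^ 2 + 4 ^ j)))) *
        eLpNorm g 2 volume := ENNReal.tsum_le_tsum hterm
    _ ≤ _ := by
      rw [ENNReal.tsum_mul_right, ENNReal.tsum_mul_left]
      gcongr
      exact tsum_dyadic_le hB k hBk

/-! ### The low frequencies in `X₀` -/

/-- The decay `1/(1 + τ²)` gives `2^j · 2^(j/2) · 4^(-j) = 2^(-j/2)`, summable in `j`, while the sum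
over the frequency blocks is carried along unchanged. -/
lemma normX_zero_le (hη₀ : IsCutoff η₀) (hψ : IsCutoff ψ) :
    ∃ C : ℝ≥0, ∀ ε : ℝ, 0 ≤ ε → ε ≤ 1 → ∀ (g : ℝ → ℂ) (f : L2 Plane),
      AEStronglyMeasurable g volume → (∀ ξ, 2 < |ξ| → g ξ = 0) →
      f =ᵐ[volume] (fun p : Plane => g p.fst * multiplier ψ ε p.fst p.snd) →
      normX η₀ 0 f ≤ C * ∑' m : ℕ, (2 : ℝ≥0∞) ^ (-(1 - (m : ℝ)) / 2) *
        eLpNorm (fun ξ => (chi η₀ (1 - (m : ℤ)) ξ : ℂ) * g ξ) 2 volume := by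
  obtain ⟨C, hC, h⟩ := exists_norm_multiplier_le_low hψ
  refine ⟨(ENNReal.ofReal (16 * C) * dyadicSum).toNNReal, ?_⟩
  intro ε hε hε1 g f hgm hg hf
  rw [ENNReal.coe_toNNReal (ENNReal.mul_ne_top ENNReal.ofReal_ne_top dyadicSum_ne_top)]
  have hsupp : ∀ᵐ p : Plane, p.fst ∉ Itilde 0 → f p = 0 := by
    filter_upwards [hf] with p hp hnot
    have : 2 < |p.fst| := by
      by_contra! hle
      exact hnot (by simpa [Itilde] using abs_le.1 hle)
    rw [hp, hg _ this, zero_mul]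
  rw [normX, if_pos hsupp, if_pos rfl]
  have hterm : ∀ j m : ℕ, (2 : ℝ≥0∞) ^ ((j : ℝ) - (1 - (m : ℝ)) / 2) *
        eLpNorm (fun p : Plane =>
          (eta η₀ j p.snd : ℂ) * (chi η₀ (1 - (m : ℤ)) p.fst : ℂ) * f p) 2 volume
      ≤ ENNReal.ofReal (16 * C) * ENNReal.ofReal ((√2)⁻¹ ^ j) *
        ((2 : ℝ≥0∞) ^ (-(1 - (m : ℝ)) / 2) *
        eLpNorm (fun ξ => (chi η₀ (1 - (m : ℤ)) ξ : ℂ) * g ξ) 2 volume) := by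
    intro j m
    have hcm : AEStronglyMeasurable (fun ξ => (chi η₀ (1 - (m : ℤ)) ξ : ℂ) * g ξ) volume :=
      (Complex.continuous_ofReal.comp (continuous_chi hη₀ _)).aestronglyMeasurable.mul hgm
    have hn : eLpNorm (fun p : Plane =>
          (eta η₀ j p.snd : ℂ) * (chi η₀ (1 - (m : ℤ)) p.fst : ℂ) * f p) 2 volume
        ≤ ENNReal.ofReal (2 * (4 * C / 4 ^ j) * (2 * √2 ^ j)) *
          eLpNorm (fun ξ => (chi η₀ (1 - (m : ℤ)) ξ : ℂ) * g ξ) 2 volume := by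
      refine eLpNorm_plane_strip_le hcm (by positivity) (by positivity)
        (c := fun _ => 0) measurable_const ?_
      filter_upwards [hf] with p hp hne
      have hηj : eta η₀ j p.snd ≠ 0 := by
        intro h0; exact hne (by simp [h0])
      have hgp : g p.fst ≠ 0 := by
        intro h0; exact hne (by simp [hp, h0])
      have hξ : |p.fst| ≤ 2 := by
        by_contra! hlt; exact hgp (hg _ hlt)
      constructor
      · rw [sub_zero]
        refine (abs_le_of_eta_ne_zero hη₀ hηj).trans ?_
        rw [mul_pow, ← pow_mul, mul_comm j, pow_mul, Real.sq_sqrt zero_le_two]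
        linarith [show (0 : ℝ) < 2 ^ j by positivity]
      · rw [hp, norm_mul, norm_mul, norm_mul, norm_mul, Complex.norm_real]
        have h1 : ‖eta η₀ j p.snd‖ ≤ 1 := abs_eta_le_one hη₀ j _
        have h2 : ‖multiplier ψ ε p.fst p.snd‖ ≤ 4 * C / 4 ^ j := by
          refine (h ε p.fst p.snd hε hε1 hξ).trans ?_
          rw [div_le_div_iff₀ (by positivity) (by positivity)]
          have := le_sq_of_eta_ne_zero hη₀ hηj
          nlinarith
        calc _ ≤ 1 * ‖(chi η₀ (1 - (m : ℤ)) p.fst : ℂ)‖ * (‖g p.fst‖ * (4 * C / 4 ^ j)) := by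
              gcongr
          _ = _ := by ring
    refine (mul_le_mul_right hn _).trans (le_of_eq ?_)
    have e1 : (2 : ℝ≥0∞) ^ ((j : ℝ) - (1 - (m : ℝ)) / 2)
        = ENNReal.ofReal (2 ^ j) * (2 : ℝ≥0∞) ^ (-(1 - (m : ℝ)) / 2) := by
      rw [show ((j : ℝ) - (1 - (m : ℝ)) / 2) = (j : ℝ) + -(1 - (m : ℝ)) / 2 by ring,
        ENNReal.rpow_add _ _ (by norm_num) (by norm_num), ENNReal.rpow_natCast]
      congr 1
      rw [ENNReal.ofReal_pow zero_le_two]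
      simp
    have e2 : ENNReal.ofReal (2 ^ j) * ENNReal.ofReal (2 * (4 * C / 4 ^ j) * (2 * √2 ^ j))
        = ENNReal.ofReal (16 * C) * ENNReal.ofReal ((√2)⁻¹ ^ j) := by
      rw [← ENNReal.ofReal_mul (by positivity), ← ENNReal.ofReal_mul (by positivity)]
      congr 1
      have h4 : (4 : ℝ) ^ j = 2 ^ j * 2 ^ j := by rw [← mul_pow]; norm_num
      have h2 : (2 : ℝ) ^ j = √2 ^ j * √2 ^ j := by
        rw [← mul_pow, Real.mul_self_sqrt zero_le_two]
      rw [h4, inv_pow]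
      field_simp
      rw [h2]
      ring
    rw [e1, ← e2]
    ring
  calc _ ≤ ∑' j : ℕ, ∑' m : ℕ, ENNReal.ofReal (16 * C) * ENNReal.ofReal ((√2)⁻¹ ^ j) *
        ((2 : ℝ≥0∞) ^ (-(1 - (m : ℝ)) / 2) *
        eLpNorm (fun ξ => (chi η₀ (1 - (m : ℤ)) ξ : ℂ) * g ξ) 2 volume) :=
        ENNReal.tsum_le_tsum fun j => ENNReal.tsum_le_tsum fun m => hterm j m
    _ ≤ _ := by
      simp_rw [ENNReal.tsum_mul_left]
      rw [ENNReal.tsum_mul_right, ENNReal.tsum_mul_left]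
      gcongr
      exact tsum_ofReal_pow_le

end HighFrequency

/-! ### Integral inequalities -/

/-- The `L²` norm in the second variable is subadditive under integration in the first one. -/
lemma lintegral_sq_lintegral_le {A : ℝ → ℝ → ℝ≥0∞} (hA : Measurable (Function.uncurry A)) :
    (∫⁻ t, (∫⁻ y, A y t) ^ 2) ^ (1 / 2 : ℝ) ≤ ∫⁻ y, (∫⁻ t, A y t ^ 2) ^ (1 / 2 : ℝ) := by
  have hy : ∀ t, Measurable fun y => A y t := fun t => hA.of_uncurry_right
  have ht : ∀ y, Measurable (A y) := fun y => hA.of_uncurry_left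
  have hn : Measurable fun y => (∫⁻ t, A y t ^ 2) ^ (1 / 2 : ℝ) :=
    (Measurable.lintegral_prod_right' (f := fun q : ℝ × ℝ => A q.1 q.2 ^ 2)
      (hA.pow_const 2)).pow_const _
  have hcs : ∀ y y', ∫⁻ t, A y t * A y' t
      ≤ (∫⁻ t, A y t ^ 2) ^ (1 / 2 : ℝ) * (∫⁻ t, A y' t ^ 2) ^ (1 / 2 : ℝ) := by
    intro y y'
    have := ENNReal.lintegral_mul_le_Lp_mul_Lq volume Real.HolderConjugate.two_two
      (ht y).aemeasurable (ht y').aemeasurable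
    simpa using this
  -- The square is expanded as a double integral over `(y, y')`, the `t`-integral is moved inside,
  -- and Cauchy–Schwarz in `t` makes the result a product.
  have key : ∫⁻ t, (∫⁻ y, A y t) ^ 2 ≤ (∫⁻ y, (∫⁻ t, A y t ^ 2) ^ (1 / 2 : ℝ)) ^ 2 := by
    calc ∫⁻ t, (∫⁻ y, A y t) ^ 2 = ∫⁻ t, ∫⁻ y, ∫⁻ y', A y t * A y' t := by
          congr 1
          ext t
          simp_rw [lintegral_const_mul _ (hy t)]
          rw [lintegral_mul_const _ (hy t), sq]
      _ = ∫⁻ y, ∫⁻ t, ∫⁻ y', A y t * A y' t := by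
          refine lintegral_lintegral_swap (Measurable.aemeasurable ?_)
          refine Measurable.lintegral_prod_right'
            (f := fun q : (ℝ × ℝ) × ℝ => A q.1.2 q.1.1 * A q.2 q.1.1) ?_
          exact (hA.comp (by fun_prop : Measurable fun q : (ℝ × ℝ) × ℝ => (q.1.2, q.1.1))).mul
            (hA.comp (by fun_prop : Measurable fun q : (ℝ × ℝ) × ℝ => (q.2, q.1.1)))
      _ = ∫⁻ y, ∫⁻ y', ∫⁻ t, A y t * A y' t := by
          congr 1
          ext y
          refine lintegral_lintegral_swap (Measurable.aemeasurable ?_)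
          exact ((ht y).comp measurable_fst).mul
            (hA.comp (by fun_prop : Measurable fun q : ℝ × ℝ => (q.2, q.1)))
      _ ≤ ∫⁻ y, ∫⁻ y', (∫⁻ t, A y t ^ 2) ^ (1 / 2 : ℝ) * (∫⁻ t, A y' t ^ 2) ^ (1 / 2 : ℝ) :=
          lintegral_mono fun y => lintegral_mono fun y' => hcs y y'
      _ = _ := by
          simp_rw [lintegral_const_mul _ hn]
          rw [lintegral_mul_const _ hn, sq]
  calc _ ≤ ((∫⁻ y, (∫⁻ t, A y t ^ 2) ^ (1 / 2 : ℝ)) ^ 2) ^ (1 / 2 : ℝ) :=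
        ENNReal.rpow_le_rpow key (by norm_num)
    _ = _ := by
        rw [← ENNReal.rpow_natCast, ← ENNReal.rpow_mul]
        norm_num

/-- The integral of `(1 + x²)⁻¹`, to the power `1/2`. -/
def weightConst : ℝ≥0∞ := (∫⁻ x : ℝ, ENNReal.ofReal (sliceBound x)) ^ (1 / 2 : ℝ)

lemma weightConst_ne_top : weightConst ≠ ⊤ := by
  refine ENNReal.rpow_ne_top_of_nonneg (by norm_num) ?_
  rw [← ofReal_integral_eq_lintegral_ofReal integrable_sliceBound
    (Eventually.of_forall fun x => by simp only [Pi.zero_apply, sliceBound]; positivity)]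
  exact ENNReal.ofReal_ne_top

/-- Cauchy–Schwarz against the integrable weight `(1 + x²)⁻¹`. It will be applied with `n x` the
squared `L²_t` norm of a kernel, turning `L¹_x` into weighted `L²_x`. -/
lemma lintegral_rpow_half_le {n : ℝ → ℝ≥0∞} (hn : Measurable n) :
    ∫⁻ x, n x ^ (1 / 2 : ℝ)
      ≤ weightConst * (∫⁻ x, ENNReal.ofReal (1 + x ^ 2) * n x) ^ (1 / 2 : ℝ) := by
  have hs : Measurable sliceBound := by
    unfold sliceBound
    fun_prop
  have hs' : Measurable fun x => ENNReal.ofReal (sliceBound x) ^ (1 / 2 : ℝ) :=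
    hs.ennreal_ofReal.pow_const _
  have hw : Measurable fun x : ℝ => (ENNReal.ofReal (1 + x ^ 2) * n x) ^ (1 / 2 : ℝ) :=
    ((by fun_prop : Measurable fun x : ℝ => ENNReal.ofReal (1 + x ^ 2)).mul hn).pow_const _
  have h := ENNReal.lintegral_mul_le_Lp_mul_Lq volume Real.HolderConjugate.two_two
    hs'.aemeasurable hw.aemeasurable
  have e : ∀ a : ℝ≥0∞, (a ^ (1 / 2 : ℝ)) ^ (2 : ℝ) = a := fun a => by
    rw [← ENNReal.rpow_mul]; norm_num
  simp only [Pi.mul_apply, e] at h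
  refine le_trans (le_of_eq ?_) h
  congr 1
  ext x
  rw [← ENNReal.mul_rpow_of_nonneg _ _ (by norm_num), ← mul_assoc,
    ← ENNReal.ofReal_mul (by unfold sliceBound; positivity)]
  congr 1
  have : sliceBound x * (1 + x ^ 2) = 1 := by
    unfold sliceBound
    exact inv_mul_cancel₀ (by positivity)
  rw [this, ENNReal.ofReal_one, one_mul]

/-! ### Inverse Fourier transforms of integrable functions on the plane -/

/-- The inverse Fourier transform of an integrable function on the plane. -/
def kernel (P : Plane → ℂ) (x t : ℝ) : ℂ :=
  (((2 * Real.pi) ^ 2)⁻¹ : ℂ) *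
    ∫ p : Plane, Complex.exp (Complex.I * (x * p.fst + t * p.snd)) * P p

lemma norm_exp_I_mul (x t ξ τ : ℝ) :
    ‖Complex.exp (Complex.I * (x * ξ + t * τ))‖ = 1 := by
  rw [show Complex.I * ((x : ℂ) * ξ + t * τ) = ((x * ξ + t * τ : ℝ) : ℂ) * Complex.I by
    push_cast; ring]
  exact Complex.norm_exp_ofReal_mul_I _

lemma kernel_eq_fourierInv (P : Plane → ℂ) (x t : ℝ) :
    kernel P x t = (((2 * Real.pi) ^ 2)⁻¹ : ℂ) * 𝓕⁻ P ((2 * Real.pi)⁻¹ • pt x t) := by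
  rw [kernel, Real.fourierInv_eq']
  congr 2
  ext p
  have hpi : (Real.pi : ℂ) ≠ 0 := by exact_mod_cast Real.pi_ne_zero
  have hi : inner ℝ p (pt x t) = x * p.fst + t * p.snd := inner_pt x t p.fst p.snd
  rw [real_inner_smul_right, hi, smul_eq_mul]
  congr 2
  push_cast
  field_simp

lemma continuous_kernel {P : Plane → ℂ} (hP : Integrable P) :
    Continuous fun q : ℝ × ℝ => kernel P q.1 q.2 := by
  simp_rw [kernel_eq_fourierInv]
  exact continuous_const.mul ((continuous_fourierInv_of_integrable hP).comp
    ((continuous_const_smul (2 * Real.pi)⁻¹).comp continuous_pt))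

lemma fourierInvL2_plane_ae_eq {P : Plane → ℂ} (hP : Integrable P) (hP2 : MemLp P 2 volume) :
    fourierInvL2 Plane (hP2.toLp P) =ᵐ[volume] fun p => kernel P p.fst p.snd := by
  have hd : Module.finrank ℝ Plane = 2 := by
    rw [(WithLp.linearEquiv 2 ℝ (ℝ × ℝ)).finrank_eq]
    simp
  filter_upwards [fourierInvL2_toLp_ae_eq hP hP2] with p hp
  rw [hp, kernel_eq_fourierInv, hd]
  rfl

/-- The `L²` class has the continuous representative `kernel P`, so pointwise identities and slices
become usable. -/
lemma invL1L2_eq {P : Plane → ℂ} (hP : Integrable P) (hP2 : MemLp P 2 volume) :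
    invL1L2 P = ∫⁻ x : ℝ, (∫⁻ t : ℝ, ‖kernel P x t‖ₑ ^ 2) ^ (1 / 2 : ℝ) := by
  rw [invL1L2, dif_pos hP2]
  have h := ae_pt_of_ae (fourierInvL2_plane_ae_eq hP hP2)
  rw [Measure.volume_eq_prod] at h
  refine lintegral_congr_ae ?_
  filter_upwards [Measure.ae_ae_of_ae_prod h] with x hx
  congr 1
  refine lintegral_congr_ae ?_
  filter_upwards [hx] with t ht
  rw [ht, pt_fst, pt_snd]

lemma invL1L2_congr {f g : Plane → ℂ} (h : f =ᵐ[volume] g) : invL1L2 f = invL1L2 g := by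
  by_cases hf : MemLp f 2 volume
  · have hg : MemLp g 2 volume := hf.ae_eq h
    have e : hf.toLp f = hg.toLp g := (MemLp.toLp_eq_toLp_iff hf hg).2 h
    rw [invL1L2, invL1L2, dif_pos hf, dif_pos hg, e]
  · have hg : ¬MemLp g 2 volume := fun hg => hf (hg.ae_eq h.symm)
    rw [invL1L2, invL1L2, dif_neg hf, dif_neg hg]

lemma invL1L2_zero : invL1L2 0 = 0 := by
  rw [invL1L2_eq (integrable_zero _ _ _) MemLp.zero]
  simp [kernel]

lemma lintegral_kernel_sq_eq {P : Plane → ℂ} (hP : Integrable P) (hP2 : MemLp P 2 volume) :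
    ∫⁻ x : ℝ, ∫⁻ t : ℝ, ‖kernel P x t‖ₑ ^ 2
      = ‖fourierInvL2 Plane (hP2.toLp P)‖ₑ ^ 2 := by
  have hm : Measurable fun q : ℝ × ℝ => ‖kernel P q.1 q.2‖ₑ ^ 2 :=
    (continuous_kernel hP).measurable.enorm.pow_const 2
  have h1 : ∫⁻ p : Plane, ‖fourierInvL2 Plane (hP2.toLp P) p‖ₑ ^ 2
      = ∫⁻ p : Plane, ‖kernel P p.fst p.snd‖ₑ ^ 2 := by
    refine lintegral_congr_ae ?_
    filter_upwards [fourierInvL2_plane_ae_eq hP hP2] with p hp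
    rw [hp]
  rw [← lintegral_prod _ hm.aemeasurable, ← Measure.volume_eq_prod]
  rw [lintegral_plane (fun p : Plane => ‖kernel P p.fst p.snd‖ₑ ^ 2)] at h1
  refine h1.symm.trans ?_
  rw [Lp.enorm_def, eLpNorm_eq_lintegral_rpow_enorm_toReal (by norm_num) (by norm_num),
    ← ENNReal.rpow_natCast, ← ENNReal.rpow_mul]
  simp

/-- Only boundedness on `L²` is required, so the operator norm replaces the Plancherel constant. -/
lemma lintegral_kernel_sq_le {P : Plane → ℂ} (hP : Integrable P) (hP2 : MemLp P 2 volume) :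
    ∫⁻ x : ℝ, ∫⁻ t : ℝ, ‖kernel P x t‖ₑ ^ 2
      ≤ (‖fourierInvL2 Plane‖ₑ * eLpNorm P 2 volume) ^ 2 := by
  rw [lintegral_kernel_sq_eq hP hP2]
  gcongr
  refine ((fourierInvL2 Plane).le_opENorm _).trans ?_
  rw [Lp.enorm_toLp]

/-- Integration by parts in the first variable. -/
lemma mul_kernel {P P' : Plane → ℂ} (hP : Integrable P) (hP' : Integrable P')
    (hd : ∀ ξ τ, HasDerivAt (fun ξ => P (pt ξ τ)) (P' (pt ξ τ)) ξ) (x t : ℝ) :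
    x * kernel P x t = Complex.I * kernel P' x t := by
  have hc : Continuous fun p : Plane => Complex.exp (Complex.I * (x * p.fst + t * p.snd)) := by
    have := continuous_plane_fst
    have := continuous_plane_snd
    fun_prop
  have key : ∀ R : Plane → ℂ, Integrable R →
      Integrable (fun q : ℝ × ℝ => Complex.exp (Complex.I * (x * q.1 + t * q.2)) * R (pt q.1 q.2))
        (volume.prod volume) := by
    intro R hR
    have h1 : Integrable fun p : Plane =>
        Complex.exp (Complex.I * (x * p.fst + t * p.snd)) * R p :=
      hR.bdd_mul (c := 1) hc.aestronglyMeasurable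
        (Eventually.of_forall fun p => (norm_exp_I_mul _ _ _ _).le)
    exact (measurePreserving_toLp_plane.integrable_comp_emb measurableEmbedding_toLp_plane).2 h1
  have hq := key P hP
  have hq' := key P' hP'
  have h2 : ∫ p : Plane, Complex.exp (Complex.I * (x * p.fst + t * p.snd)) * P' p
      = -(Complex.I * x *
        ∫ p : Plane, Complex.exp (Complex.I * (x * p.fst + t * p.snd)) * P p) := by
    rw [integral_plane, integral_plane, Measure.volume_eq_prod]
    simp only [pt_fst, pt_snd]
    rw [integral_prod_symm _ hq', integral_prod_symm _ hq, ← integral_const_mul, ← integral_neg]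
    refine integral_congr_ae ?_
    filter_upwards [hq.prod_left_ae, hq'.prod_left_ae] with τ h3 h4
    have hu : ∀ ξ : ℝ, HasDerivAt (fun ξ : ℝ => Complex.exp (Complex.I * (x * ξ + t * τ)))
        (Complex.I * x * Complex.exp (Complex.I * (x * ξ + t * τ))) ξ := by
      intro ξ
      have h0 : HasDerivAt (fun ξ : ℝ => Complex.I * ((x : ℂ) * ξ + t * τ))
          (Complex.I * (x * 1)) ξ :=
        (((Complex.ofRealCLM.hasDerivAt (x := ξ)).const_mul (x : ℂ)).add_const _).const_mul _
      exact h0.cexp.congr_deriv (by ring)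
    have h5 := integral_mul_deriv_eq_deriv_mul_of_integrable
      (u := fun ξ : ℝ => Complex.exp (Complex.I * (x * ξ + t * τ)))
      (v := fun ξ => P (pt ξ τ)) (fun ξ _ => hu ξ) (fun ξ _ => hd ξ τ) h4
      (by simpa [Pi.mul_def, mul_assoc] using h3.const_mul (Complex.I * x)) h3
    refine h5.trans ?_
    rw [← integral_const_mul]
    simp only [mul_assoc]
  rw [kernel, kernel, h2]
  linear_combination ((x : ℂ) * (((2 * Real.pi) ^ 2)⁻¹ : ℂ) *
    ∫ p : Plane, Complex.exp (Complex.I * (x * p.fst + t * p.snd)) * P p) * Complex.I_sq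

/-- Since multiplication by `x` corresponds to the `ξ`-derivative, the integral of `(1 + x²)|K|²` is
the sum of the squared `L²` norms of the kernels of `P` and `P'`. -/
lemma lintegral_kernel_le {P P' : Plane → ℂ} (hP : Integrable P) (hP' : Integrable P')
    (hP2 : MemLp P 2 volume) (hP2' : MemLp P' 2 volume)
    (hd : ∀ ξ τ, HasDerivAt (fun ξ => P (pt ξ τ)) (P' (pt ξ τ)) ξ) :
    ∫⁻ x : ℝ, (∫⁻ t : ℝ, ‖kernel P x t‖ₑ ^ 2) ^ (1 / 2 : ℝ)
      ≤ weightConst * (‖fourierInvL2 Plane‖ₑ * (eLpNorm P 2 volume + eLpNorm P' 2 volume)) := by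
  have hm : ∀ R : Plane → ℂ, Integrable R → Measurable fun x => ∫⁻ t : ℝ, ‖kernel R x t‖ₑ ^ 2 :=
    fun R hR => Measurable.lintegral_prod_right' (f := fun q : ℝ × ℝ => ‖kernel R q.1 q.2‖ₑ ^ 2)
      ((continuous_kernel hR).measurable.enorm.pow_const 2)
  refine (lintegral_rpow_half_le (hm P hP)).trans ?_
  gcongr
  set M := ‖fourierInvL2 Plane‖ₑ
  have h1 : ∫⁻ x : ℝ, ENNReal.ofReal (1 + x ^ 2) * ∫⁻ t : ℝ, ‖kernel P x t‖ₑ ^ 2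
      ≤ (M * (eLpNorm P 2 volume + eLpNorm P' 2 volume)) ^ 2 := by
    calc _ = ∫⁻ x : ℝ, ((∫⁻ t : ℝ, ‖kernel P x t‖ₑ ^ 2) + ∫⁻ t : ℝ, ‖kernel P' x t‖ₑ ^ 2) := by
          congr 1
          ext x
          rw [ENNReal.ofReal_add zero_le_one (sq_nonneg x), ENNReal.ofReal_one, add_mul, one_mul,
            ← lintegral_const_mul' _ _ ENNReal.ofReal_ne_top]
          congr 2
          ext t
          have h2 : ‖(x : ℂ) * kernel P x t‖ₑ = ‖kernel P' x t‖ₑ := by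
            rw [mul_kernel hP hP' hd x t, enorm_mul]
            simp [enorm_eq_nnnorm]
          rw [← h2, enorm_mul, mul_pow, ← sq_abs, ENNReal.ofReal_pow (abs_nonneg x)]
          congr 2
          rw [← ofReal_norm, Complex.norm_real, Real.norm_eq_abs]
      _ = (∫⁻ x : ℝ, ∫⁻ t : ℝ, ‖kernel P x t‖ₑ ^ 2) + ∫⁻ x : ℝ, ∫⁻ t : ℝ, ‖kernel P' x t‖ₑ ^ 2 :=
          lintegral_add_left (hm P hP) _
      _ ≤ (M * eLpNorm P 2 volume) ^ 2 + (M * eLpNorm P' 2 volume) ^ 2 :=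
          add_le_add (lintegral_kernel_sq_le hP hP2) (lintegral_kernel_sq_le hP' hP2')
      _ ≤ _ := by
          rw [mul_add, add_sq]
          gcongr
          exact le_self_add
  calc _ ≤ ((M * (eLpNorm P 2 volume + eLpNorm P' 2 volume)) ^ 2) ^ (1 / 2 : ℝ) :=
        ENNReal.rpow_le_rpow h1 (by norm_num)
    _ = _ := by
        rw [← ENNReal.rpow_natCast, ← ENNReal.rpow_mul]
        norm_num

/-! ### Products with the Fourier transform of an integrable function -/

lemma fourierL1_eq (G : ℝ → ℂ) (ξ : ℝ) : fourierL1 G ξ = 𝓕 G ((2 * Real.pi)⁻¹ * ξ) := by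
  rw [fourierL1, Real.fourier_eq']
  congr 1
  ext x
  have hpi : (Real.pi : ℂ) ≠ 0 := by exact_mod_cast Real.pi_ne_zero
  rw [smul_eq_mul]
  congr 2
  simp
  field_simp

lemma continuous_fourierL1 {G : ℝ → ℂ} (hG : Integrable G) : Continuous (fourierL1 G) := by
  have : fourierL1 G = fun ξ => 𝓕 G ((2 * Real.pi)⁻¹ * ξ) := funext (fourierL1_eq G)
  rw [this]
  exact (continuous_fourier_of_integrable hG).comp (by fun_prop)

/-- A factor depending on `ξ` alone acts as a convolution in `x` alone. -/
lemma kernel_fourierL1_mul {G : ℝ → ℂ} (hG : Integrable G) {P : Plane → ℂ} (hP : Integrable P)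
    (x t : ℝ) :
    kernel (fun p => fourierL1 G p.fst * P p) x t = ∫ y, G y * kernel P (x - y) t := by
  have hc : Continuous fun z : Plane × ℝ =>
      Complex.exp (Complex.I * (((x - z.2 : ℝ) : ℂ) * z.1.fst + t * z.1.snd)) := by
    have := continuous_plane_fst
    have := continuous_plane_snd
    fun_prop
  have hi : Integrable (fun z : Plane × ℝ =>
      Complex.exp (Complex.I * (((x - z.2 : ℝ) : ℂ) * z.1.fst + t * z.1.snd)) * (P z.1 * G z.2))
      (volume.prod volume) :=
    (hP.mul_prod hG).bdd_mul (c := 1) hc.aestronglyMeasurable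
      (Eventually.of_forall fun z => (norm_exp_I_mul _ _ _ _).le)
  have h1 : ∫ p : Plane, Complex.exp (Complex.I * (x * p.fst + t * p.snd)) *
        (fourierL1 G p.fst * P p)
      = ∫ p : Plane, ∫ y, Complex.exp (Complex.I * (((x - y : ℝ) : ℂ) * p.fst + t * p.snd)) *
        (P p * G y) := by
    congr 1
    ext p
    rw [fourierL1, mul_comm _ (P p), ← mul_assoc, ← integral_const_mul]
    congr 1
    ext y
    have : Complex.exp (Complex.I * (((x - y : ℝ) : ℂ) * p.fst + t * p.snd))
        = Complex.exp (Complex.I * (x * p.fst + t * p.snd)) *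
          Complex.exp (-(Complex.I * y * p.fst)) := by
      rw [← Complex.exp_add]
      congr 1
      push_cast
      ring
    rw [this]
    ring
  rw [kernel, h1, integral_integral_swap hi, ← integral_const_mul]
  congr 1
  ext y
  rw [kernel]
  simp_rw [← mul_assoc]
  rw [integral_mul_const]
  ring

/-- Young's inequality for `L¹` against `L¹_x L²_t`: Minkowski in `t`, then translation invariance
in `x`. -/
lemma lintegral_kernel_fourierL1_mul_le {G : ℝ → ℂ} (hGm : Measurable G) (hG : Integrable G)
    {P : Plane → ℂ} (hP : Integrable P) :
    ∫⁻ x : ℝ, (∫⁻ t : ℝ, ‖kernel (fun p => fourierL1 G p.fst * P p) x t‖ₑ ^ 2) ^ (1 / 2 : ℝ)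
      ≤ eLpNorm G 1 volume *
        ∫⁻ x : ℝ, (∫⁻ t : ℝ, ‖kernel P x t‖ₑ ^ 2) ^ (1 / 2 : ℝ) := by
  have hK := (continuous_kernel hP).measurable
  set n : ℝ → ℝ≥0∞ := fun x => (∫⁻ t : ℝ, ‖kernel P x t‖ₑ ^ 2) ^ (1 / 2 : ℝ) with hn
  have hnm : Measurable n :=
    (Measurable.lintegral_prod_right' (f := fun q : ℝ × ℝ => ‖kernel P q.1 q.2‖ₑ ^ 2)
      (hK.enorm.pow_const 2)).pow_const _
  calc _ ≤ ∫⁻ x : ℝ, ∫⁻ y : ℝ, ‖G y‖ₑ * n (x - y) := by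
        refine lintegral_mono fun x => ?_
        have hA : Measurable (Function.uncurry fun y t => ‖G y‖ₑ * ‖kernel P (x - y) t‖ₑ) :=
          (hGm.enorm.comp measurable_fst).mul
            (hK.comp (by fun_prop : Measurable fun q : ℝ × ℝ => (x - q.1, q.2))).enorm
        refine le_trans ?_ ((lintegral_sq_lintegral_le hA).trans (le_of_eq ?_))
        · refine ENNReal.rpow_le_rpow (lintegral_mono fun t => ?_) (by norm_num)
          gcongr
          rw [kernel_fourierL1_mul hG hP]
          refine (enorm_integral_le_lintegral_enorm _).trans (le_of_eq ?_)
          simp_rw [enorm_mul]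
        · congr 1
          ext y
          simp_rw [mul_pow]
          rw [lintegral_const_mul' _ _ (by simp), ENNReal.mul_rpow_of_nonneg _ _ (by norm_num),
            ← ENNReal.rpow_natCast, ← ENNReal.rpow_mul]
          norm_num [hn]
    _ = ∫⁻ y : ℝ, ∫⁻ x : ℝ, ‖G y‖ₑ * n (x - y) := by
        refine lintegral_lintegral_swap (Measurable.aemeasurable ?_)
        exact (hGm.enorm.comp measurable_snd).mul (hnm.comp (measurable_fst.sub measurable_snd))
    _ = ∫⁻ y : ℝ, ‖G y‖ₑ * ∫⁻ x, n x := by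
        congr 1
        ext y
        rw [lintegral_const_mul' _ _ (by simp), lintegral_sub_right_eq_self n y]
    _ = _ := by
        rw [lintegral_mul_const _ hGm.enorm, eLpNorm_one_eq_lintegral_enorm]

/-! ### The frequency derivative of the multiplier -/

/-- At the origin `ω(ξ) = o(ξ)`. The second derivative jumps there, but one derivative is all that
the weight `1 + x²` costs. -/
lemma hasDerivAt_omega (ξ : ℝ) : HasDerivAt omega (-2 * |ξ|) ξ := by
  rcases lt_trichotomy ξ 0 with h | h | h
  · have h1 : HasDerivAt (fun x : ℝ => x ^ 2) (2 * ξ) ξ := by simpa using hasDerivAt_pow 2 ξ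
    rw [abs_of_neg h]
    refine (h1.congr_deriv (by ring)).congr_of_eventuallyEq ?_
    filter_upwards [gt_mem_nhds h] with x hx
    rw [omega, abs_of_neg hx]
    ring
  · subst h
    rw [abs_zero, mul_zero, hasDerivAt_iff_isLittleO]
    simp only [omega, sub_zero, neg_zero, abs_zero, mul_zero, smul_zero]
    have h1 : (fun x : ℝ => -x * |x|) =o[𝓝 0] fun x : ℝ => x * 1 := by
      refine Asymptotics.IsBigO.mul_isLittleO (Asymptotics.isBigO_refl _ _).neg_left ?_
      rw [Asymptotics.isLittleO_one_iff]
      simpa using (continuous_abs.tendsto (0 : ℝ))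
    simpa using h1
  · have h1 : HasDerivAt (fun x : ℝ => -x ^ 2) (-(2 * ξ)) ξ := by
      simpa using (hasDerivAt_pow 2 ξ).fun_neg
    rw [abs_of_pos h]
    refine (h1.congr_deriv (by ring)).congr_of_eventuallyEq ?_
    filter_upwards [lt_mem_nhds h] with x hx
    rw [omega, abs_of_pos hx]
    ring

/-- The derivative of the multiplier in the first variable. -/
def multiplierDeriv (ψ : ℝ → ℝ) (ε ξ τ : ℝ) : ℂ :=
  -laplace (fun t => t * weight ψ t) ((ε * ξ ^ 2 : ℝ) + Complex.I * (τ - omega ξ : ℝ)) *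
      ((2 * ε * ξ : ℝ) + Complex.I * (2 * |ξ| : ℝ)) +
    -laplace (fun t => t * weight ψ t) ((ε * ξ ^ 2 : ℝ) - Complex.I * (τ - omega ξ : ℝ)) *
      ((2 * ε * ξ : ℝ) - Complex.I * (2 * |ξ| : ℝ))

section MultiplierDeriv

variable {ψ : ℝ → ℝ}

lemma contDiff_mul_weight (hψ : IsCutoff ψ) : ContDiff ℝ 2 fun t : ℝ => (t : ℂ) * weight ψ t :=
  ContDiff.mul Complex.ofRealCLM.contDiff (contDiff_weight hψ)

lemma hasCompactSupport_mul_weight (hψ : IsCutoff ψ) :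
    HasCompactSupport fun t : ℝ => (t : ℂ) * weight ψ t :=
  (hasCompactSupport_weight hψ).mul_left

lemma hasDerivAt_multiplier (hψ : IsCutoff ψ) (ε ξ τ : ℝ) :
    HasDerivAt (fun ξ => multiplier ψ ε ξ τ) (multiplierDeriv ψ ε ξ τ) ξ := by
  have ha : HasDerivAt (fun ξ : ℝ => ε * ξ ^ 2) (2 * ε * ξ) ξ :=
    ((hasDerivAt_pow 2 ξ).const_mul ε).congr_deriv (by norm_num; ring)
  have hs : HasDerivAt (fun ξ : ℝ => τ - omega ξ) (2 * |ξ|) ξ :=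
    ((hasDerivAt_omega ξ).const_sub τ).congr_deriv (by ring)
  have h1 := ha.ofReal_comp.add (hs.ofReal_comp.const_mul Complex.I)
  have h2 := ha.ofReal_comp.sub (hs.ofReal_comp.const_mul Complex.I)
  have hl := hasDerivAt_laplace (contDiff_weight hψ).continuous (hasCompactSupport_weight hψ)
  exact ((hl _).comp ξ h1).add ((hl _).comp ξ h2)

lemma continuous_multiplierDeriv (hψ : IsCutoff ψ) (ε : ℝ) :
    Continuous fun q : ℝ × ℝ => multiplierDeriv ψ ε q.1 q.2 := by
  have hl := continuous_laplace (contDiff_mul_weight hψ).continuous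
    (hasCompactSupport_mul_weight hψ)
  have ho := continuous_omega
  unfold multiplierDeriv
  fun_prop

/-- Differentiating a Laplace transform inserts a factor `t`, so the new test function vanishes at
`0`. Each half then decays quadratically by itself and no cancellation is needed. -/
lemma exists_norm_multiplierDeriv_le (hψ : IsCutoff ψ) :
    ∃ C : ℝ, 0 ≤ C ∧ ∀ ε ξ τ : ℝ, 0 ≤ ε → ε ≤ 1 → |ξ| ≤ 2 →
      ‖multiplierDeriv ψ ε ξ τ‖ ≤ C / (1 + τ ^ 2) := by
  obtain ⟨C, hC, h⟩ := exists_norm_laplace_le (contDiff_mul_weight hψ)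
    (hasCompactSupport_mul_weight hψ) (by simp)
  -- Two halves, each with chain-rule factor at most `8`; `33` comes from exchanging `τ - ω(ξ)` for
  -- `τ`.
  refine ⟨16 * (33 * C), by positivity, fun ε ξ τ hε hε1 hξ => ?_⟩
  have key : ∀ z : ℂ, 0 ≤ z.re → z.im ^ 2 = (τ - omega ξ) ^ 2 →
      ‖laplace (fun t => t * weight ψ t) z‖ ≤ 33 * C / (1 + τ ^ 2) := by
    intro z hz hzi
    refine (h z hz).trans ?_
    rw [div_le_div_iff₀ (by positivity) (by positivity)]
    have h1 := one_add_sq_le (τ := τ) hξ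
    have h2 : (τ - omega ξ) ^ 2 ≤ ‖z‖ ^ 2 := by
      rw [Complex.sq_norm, Complex.normSq_apply, ← hzi]
      nlinarith [mul_self_nonneg z.re]
    calc C * (1 + τ ^ 2) ≤ C * (33 * (1 + ‖z‖ ^ 2)) := by gcongr; linarith
      _ = _ := by ring
  have ha : 0 ≤ ε * ξ ^ 2 := by positivity
  have hc : ∀ w : ℂ, ‖w‖ = 1 → ‖((2 * ε * ξ : ℝ) : ℂ) + w * (2 * |ξ| : ℝ)‖ ≤ 8 := by
    intro w hw
    refine (norm_add_le _ _).trans ?_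
    rw [norm_mul, hw, Complex.norm_real, Complex.norm_real, Real.norm_eq_abs, Real.norm_eq_abs,
      abs_mul, abs_mul, abs_mul, abs_abs, abs_of_nonneg hε]
    norm_num
    nlinarith [abs_nonneg ξ]
  have hc1 := hc Complex.I (by simp)
  have hc2 := hc (-Complex.I) (by simp)
  rw [neg_mul, ← sub_eq_add_neg] at hc2
  have k1 := key ((ε * ξ ^ 2 : ℝ) + Complex.I * (τ - omega ξ : ℝ))
    (by simpa [← Complex.ofReal_pow] using ha) (by simp [-Complex.ofReal_pow, -Complex.ofReal_mul])
  have k2 := key ((ε * ξ ^ 2 : ℝ) - Complex.I * (τ - omega ξ : ℝ))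
    (by simpa [← Complex.ofReal_pow] using ha)
    (by simp [-Complex.ofReal_pow, -Complex.ofReal_mul]; ring)
  rw [multiplierDeriv]
  refine (norm_add_le _ _).trans ?_
  rw [norm_mul, norm_mul, norm_neg, norm_neg]
  calc _ ≤ 33 * C / (1 + τ ^ 2) * 8 + 33 * C / (1 + τ ^ 2) * 8 := by gcongr
    _ = _ := by ring

end MultiplierDeriv

/-! ### A smooth cutoff to low frequencies -/

/-- A bump function equal to `1` on `[-8/5, 8/5]` and supported in `[-2, 2]`. -/
def lowBump : ContDiffBump (0 : ℝ) := ⟨8 / 5, 2, by norm_num, by norm_num⟩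

lemma lowBump_eq_one {ξ : ℝ} (h : |ξ| ≤ 8 / 5) : lowBump ξ = 1 :=
  lowBump.one_of_mem_closedBall (by simpa [lowBump] using h)

lemma lowBump_eq_zero {ξ : ℝ} (h : 2 < |ξ|) : lowBump ξ = 0 :=
  lowBump.zero_of_le_dist (by simpa [lowBump] using h.le)

lemma deriv_lowBump_eq_zero {ξ : ℝ} (h : 2 < |ξ|) : deriv lowBump ξ = 0 := by
  by_contra hne
  have h1 := support_deriv_subset (f := (lowBump : ℝ → ℝ)) hne
  rw [lowBump.tsupport_eq] at h1
  have h2 : |ξ| ≤ 2 := by simpa [lowBump] using h1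
  linarith

lemma abs_lowBump_le_one (ξ : ℝ) : |lowBump ξ| ≤ 1 := by
  rw [abs_of_nonneg lowBump.nonneg]
  exact lowBump.le_one

lemma continuous_deriv_lowBump : Continuous (deriv lowBump) :=
  (lowBump.contDiff (n := 1)).continuous_deriv le_rfl

lemma exists_abs_deriv_lowBump_le : ∃ C : ℝ, 0 ≤ C ∧ ∀ ξ, |deriv lowBump ξ| ≤ C := by
  obtain ⟨C, hC⟩ := continuous_deriv_lowBump.bounded_above_of_compact_support
    lowBump.hasCompactSupport.deriv
  exact ⟨C, (norm_nonneg _).trans (hC 0), hC⟩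

lemma hasCompactSupport_plane {F : Plane → ℂ} {a b : ℝ}
    (h : ∀ p, F p ≠ 0 → |p.fst| ≤ a ∧ |p.snd| ≤ b) : HasCompactSupport F := by
  have hK : IsCompact ((fun q : ℝ × ℝ => pt q.1 q.2) '' (Icc (-a) a ×ˢ Icc (-b) b)) :=
    (isCompact_Icc.prod isCompact_Icc).image continuous_pt
  refine HasCompactSupport.intro hK fun p hp => ?_
  by_contra hne
  obtain ⟨h1, h2⟩ := h p hne
  exact hp ⟨(p.fst, p.snd), ⟨abs_le.1 h1, abs_le.1 h2⟩, rfl⟩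

/-! ### The low frequencies in `Y₀` -/

section LowFrequency

variable {η₀ ψ : ℝ → ℝ}

/-- The localized multiplier `χ_l(τ) m(ξ, τ)` at low frequencies `ξ`. -/
def lowPiece (η₀ ψ : ℝ → ℝ) (ε : ℝ) (l : ℤ) (p : Plane) : ℂ :=
  (chi η₀ l p.snd : ℂ) * ((lowBump p.fst : ℂ) * multiplier ψ ε p.fst p.snd)

/-- The derivative of `lowPiece` in the first variable. -/
def lowPieceDeriv (η₀ ψ : ℝ → ℝ) (ε : ℝ) (l : ℤ) (p : Plane) : ℂ :=
  (chi η₀ l p.snd : ℂ) * (((deriv lowBump p.fst : ℝ) : ℂ) * multiplier ψ ε p.fst p.snd +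
    (lowBump p.fst : ℂ) * multiplierDeriv ψ ε p.fst p.snd)

lemma hasDerivAt_lowPiece (hψ : IsCutoff ψ) (ε : ℝ) (l : ℤ) (ξ τ : ℝ) :
    HasDerivAt (fun ξ => lowPiece η₀ ψ ε l (pt ξ τ)) (lowPieceDeriv η₀ ψ ε l (pt ξ τ)) ξ := by
  have h1 : HasDerivAt (fun ξ : ℝ => (lowBump ξ : ℂ)) ((deriv lowBump ξ : ℝ) : ℂ) ξ :=
    (((lowBump.contDiff (n := 1)).differentiable one_ne_zero) ξ).hasDerivAt.ofReal_comp
  exact (h1.fun_mul (hasDerivAt_multiplier hψ ε ξ τ)).const_mul (chi η₀ l τ : ℂ)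

lemma continuous_lowPiece (hη₀ : IsCutoff η₀) (hψ : IsCutoff ψ) (ε : ℝ) (l : ℤ) :
    Continuous (lowPiece η₀ ψ ε l) := by
  have hp := continuous_plane_fst.prodMk continuous_plane_snd
  have h1 := (continuous_multiplier hψ ε).comp hp
  have h2 := (continuous_chi hη₀ l).comp continuous_plane_snd
  have h3 := lowBump.continuous.comp continuous_plane_fst
  exact (Complex.continuous_ofReal.comp h2).mul ((Complex.continuous_ofReal.comp h3).mul h1)

lemma continuous_lowPieceDeriv (hη₀ : IsCutoff η₀) (hψ : IsCutoff ψ) (ε : ℝ) (l : ℤ) :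
    Continuous (lowPieceDeriv η₀ ψ ε l) := by
  have hp := continuous_plane_fst.prodMk continuous_plane_snd
  have h1 := (continuous_multiplier hψ ε).comp hp
  have h1' := (continuous_multiplierDeriv hψ ε).comp hp
  have h2 := (continuous_chi hη₀ l).comp continuous_plane_snd
  have h3 := lowBump.continuous.comp continuous_plane_fst
  have h3' := continuous_deriv_lowBump.comp continuous_plane_fst
  exact (Complex.continuous_ofReal.comp h2).mul
    (((Complex.continuous_ofReal.comp h3').mul h1).add
      ((Complex.continuous_ofReal.comp h3).mul h1'))

lemma abs_fst_le_of_lowPiece_ne_zero {ε : ℝ} {l : ℤ} {p : Plane}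
    (hp : lowPiece η₀ ψ ε l p ≠ 0) : |p.fst| ≤ 2 ∧ chi η₀ l p.snd ≠ 0 := by
  refine ⟨?_, fun h0 => hp (by simp [lowPiece, h0])⟩
  by_contra! hlt
  exact hp (by simp [lowPiece, lowBump_eq_zero hlt])

lemma abs_fst_le_of_lowPieceDeriv_ne_zero {ε : ℝ} {l : ℤ} {p : Plane}
    (hp : lowPieceDeriv η₀ ψ ε l p ≠ 0) : |p.fst| ≤ 2 ∧ chi η₀ l p.snd ≠ 0 := by
  refine ⟨?_, fun h0 => hp (by simp [lowPieceDeriv, h0])⟩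
  by_contra! hlt
  exact hp (by simp [lowPieceDeriv, lowBump_eq_zero hlt, deriv_lowBump_eq_zero hlt])

lemma exists_norm_lowPiece_le (hη₀ : IsCutoff η₀) (hψ : IsCutoff ψ) :
    ∃ C : ℝ, 0 ≤ C ∧ ∀ ε : ℝ, 0 ≤ ε → ε ≤ 1 → ∀ (l : ℤ) (p : Plane), |p.fst| ≤ 2 →
      ‖lowPiece η₀ ψ ε l p‖ ≤ C / (1 + p.snd ^ 2) ∧
      ‖lowPieceDeriv η₀ ψ ε l p‖ ≤ C / (1 + p.snd ^ 2) := by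
  obtain ⟨C₁, hC₁, h₁⟩ := exists_norm_multiplier_le_low hψ
  obtain ⟨C₂, hC₂, h₂⟩ := exists_norm_multiplierDeriv_le hψ
  obtain ⟨C₃, hC₃, h₃⟩ := exists_abs_deriv_lowBump_le
  refine ⟨C₁ + C₃ * C₁ + C₂, by positivity, fun ε hε hε1 l p hp => ?_⟩
  have hm := h₁ ε p.fst p.snd hε hε1 hp
  have hm' := h₂ ε p.fst p.snd hε hε1 hp
  have hb : ‖(lowBump p.fst : ℂ)‖ ≤ 1 := by
    rw [Complex.norm_real]; exact abs_lowBump_le_one _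
  have hb' : ‖((deriv lowBump p.fst : ℝ) : ℂ)‖ ≤ C₃ := by
    rw [Complex.norm_real]; exact h₃ _
  have hc : ‖(chi η₀ l p.snd : ℂ)‖ ≤ 1 := by
    rw [Complex.norm_real]; exact abs_chi_le_one hη₀ l _
  have hd : (0 : ℝ) ≤ 1 + p.snd ^ 2 := by positivity
  constructor
  · rw [lowPiece, norm_mul, norm_mul]
    calc _ ≤ 1 * (1 * (C₁ / (1 + p.snd ^ 2))) := by gcongr
      _ = C₁ / (1 + p.snd ^ 2) := by ring
      _ ≤ _ := by
        gcongr
        linarith [mul_nonneg hC₃ hC₁]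
  · rw [lowPieceDeriv, norm_mul]
    calc _ ≤ 1 * (C₃ * (C₁ / (1 + p.snd ^ 2)) + 1 * (C₂ / (1 + p.snd ^ 2))) := by
          refine mul_le_mul hc ((norm_add_le _ _).trans ?_) (norm_nonneg _) zero_le_one
          rw [norm_mul, norm_mul]
          gcongr
      _ = (C₃ * C₁ + C₂) / (1 + p.snd ^ 2) := by ring
      _ ≤ _ := by
        gcongr
        linarith

/-- Stated for any `l : ℤ`, with `q` the height and `R²` the half-width of the block, so that it
serves both sums in the `Y₀` norm. Convolution extracts `‖G‖₁`, and `lintegral_kernel_le` bounds the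
remaining kernel. -/
lemma invL1L2_low_le (hη₀ : IsCutoff η₀) (hψ : IsCutoff ψ) :
    ∃ K : ℝ≥0∞, K ≠ ⊤ ∧ ∀ ε : ℝ, 0 ≤ ε → ε ≤ 1 → ∀ (l : ℤ) (q R : ℝ), 0 ≤ q → 0 ≤ R →
      (∀ τ, chi η₀ l τ ≠ 0 → |τ| ≤ R ^ 2 ∧ 1 / (1 + τ ^ 2) ≤ q) →
      ∀ G : ℝ → ℂ, Measurable G → Integrable G →
      invL1L2 (fun p => (chi η₀ l p.snd : ℂ) *
          (((lowBump p.fst : ℂ) * fourierL1 G p.fst) * multiplier ψ ε p.fst p.snd))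
        ≤ K * ENNReal.ofReal (q * R) * eLpNorm G 1 volume := by
  obtain ⟨C, hC, h⟩ := exists_norm_lowPiece_le hη₀ hψ
  set S : ℝ → ℂ := (Icc (-2 : ℝ) 2).indicator fun _ => 1 with hS
  have hSm : MemLp S 2 volume :=
    memLp_indicator_const 2 measurableSet_Icc _ (Or.inr (by simp))
  refine ⟨weightConst * (‖fourierInvL2 Plane‖ₑ * (ENNReal.ofReal (4 * C) * eLpNorm S 2 volume)),
    ?_, ?_⟩
  · exact ENNReal.mul_ne_top weightConst_ne_top (ENNReal.mul_ne_top (by simp)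
      (ENNReal.mul_ne_top ENNReal.ofReal_ne_top hSm.2.ne))
  intro ε hε hε1 l q R hq hR hl G hGm hG
  set P := lowPiece η₀ ψ ε l
  set P' := lowPieceDeriv η₀ ψ ε l
  have hPs : HasCompactSupport P := hasCompactSupport_plane fun p hp =>
    ⟨(abs_fst_le_of_lowPiece_ne_zero hp).1, (hl _ (abs_fst_le_of_lowPiece_ne_zero hp).2).1⟩
  have hPs' : HasCompactSupport P' := hasCompactSupport_plane fun p hp =>
    ⟨(abs_fst_le_of_lowPieceDeriv_ne_zero hp).1,
      (hl _ (abs_fst_le_of_lowPieceDeriv_ne_zero hp).2).1⟩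
  have hPc : Continuous P := continuous_lowPiece hη₀ hψ ε l
  have hPc' : Continuous P' := continuous_lowPieceDeriv hη₀ hψ ε l
  have hPi := hPc.integrable_of_hasCompactSupport hPs (μ := volume)
  have hPi' := hPc'.integrable_of_hasCompactSupport hPs' (μ := volume)
  have hP2 : MemLp P 2 volume := hPc.memLp_of_hasCompactSupport hPs
  have hP2' : MemLp P' 2 volume := hPc'.memLp_of_hasCompactSupport hPs'
  have hSone : ∀ ξ : ℝ, |ξ| ≤ 2 → ‖S ξ‖ = 1 := fun ξ hξ => by
    rw [hS, indicator_of_mem (show ξ ∈ Icc (-2 : ℝ) 2 from abs_le.1 hξ), norm_one]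
  have hstrip : ∀ F : Plane → ℂ, (∀ p, F p ≠ 0 → |p.fst| ≤ 2 ∧ chi η₀ l p.snd ≠ 0) →
      (∀ p : Plane, |p.fst| ≤ 2 → ‖F p‖ ≤ C / (1 + p.snd ^ 2)) →
      eLpNorm F 2 volume ≤ ENNReal.ofReal (2 * (C * q) * R) * eLpNorm S 2 volume := by
    intro F hF hF'
    refine eLpNorm_plane_strip_le hSm.1 (by positivity) hR (c := fun _ => 0) measurable_const
      (Eventually.of_forall fun p hp => ?_)
    obtain ⟨h1, h2⟩ := hF p hp
    obtain ⟨h3, h4⟩ := hl _ h2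
    refine ⟨by rwa [sub_zero], ?_⟩
    rw [hSone _ h1, mul_one]
    refine (hF' p h1).trans ?_
    rw [div_eq_mul_one_div]
    gcongr
  have e1 := hstrip P (fun p hp => abs_fst_le_of_lowPiece_ne_zero hp)
    fun p hp => (h ε hε hε1 l p hp).1
  have e2 := hstrip P' (fun p hp => abs_fst_le_of_lowPieceDeriv_ne_zero hp)
    fun p hp => (h ε hε hε1 l p hp).2
  have hH : (fun p : Plane => (chi η₀ l p.snd : ℂ) *
      (((lowBump p.fst : ℂ) * fourierL1 G p.fst) * multiplier ψ ε p.fst p.snd))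
      = fun p => fourierL1 G p.fst * P p := by
    ext p
    simp only [P, lowPiece]
    ring
  have hGc : Continuous fun p : Plane => fourierL1 G p.fst :=
    (continuous_fourierL1 hG).comp continuous_plane_fst
  have hHc : Continuous fun p : Plane => fourierL1 G p.fst * P p := hGc.mul hPc
  have hHs : HasCompactSupport fun p : Plane => fourierL1 G p.fst * P p := hPs.mul_left
  rw [hH, invL1L2_eq (hHc.integrable_of_hasCompactSupport hHs)
    (hHc.memLp_of_hasCompactSupport hHs)]
  calc _ ≤ eLpNorm G 1 volume *
        ∫⁻ x : ℝ, (∫⁻ t : ℝ, ‖kernel P x t‖ₑ ^ 2) ^ (1 / 2 : ℝ) :=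
        lintegral_kernel_fourierL1_mul_le hGm hG hPi
    _ ≤ eLpNorm G 1 volume * (weightConst * (‖fourierInvL2 Plane‖ₑ *
        (ENNReal.ofReal (2 * (C * q) * R) * eLpNorm S 2 volume +
          ENNReal.ofReal (2 * (C * q) * R) * eLpNorm S 2 volume))) := by
        gcongr
        refine (lintegral_kernel_le hPi hPi' hP2 hP2' (hasDerivAt_lowPiece hψ ε l)).trans ?_
        gcongr
    _ = _ := by
        have : ENNReal.ofReal (4 * C) * ENNReal.ofReal (q * R)
            = 2 * ENNReal.ofReal (2 * (C * q) * R) := by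
          rw [show (2 : ℝ≥0∞) = ENNReal.ofReal 2 by simp, ← ENNReal.ofReal_mul (by positivity),
            ← ENNReal.ofReal_mul (by positivity)]
          congr 1
          ring
        calc _ = eLpNorm G 1 volume * weightConst * ‖fourierInvL2 Plane‖ₑ * eLpNorm S 2 volume *
              (2 * ENNReal.ofReal (2 * (C * q) * R)) := by ring
          _ = _ := by rw [← this]; ring

lemma normY0_le (hη₀ : IsCutoff η₀) (hψ : IsCutoff ψ) :
    ∃ C : ℝ≥0, ∀ ε : ℝ, 0 ≤ ε → ε ≤ 1 → ∀ (G : ℝ → ℂ) (f : L2 Plane), Integrable G →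
      f =ᵐ[volume] (fun p : Plane =>
        ((lowBump p.fst : ℂ) * fourierL1 G p.fst) * multiplier ψ ε p.fst p.snd) →
      normY0 η₀ f ≤ C * eLpNorm G 1 volume := by
  obtain ⟨K, hK, h⟩ := invL1L2_low_le hη₀ hψ
  -- For `j ≥ 1`, `q = 4/4^j` and `R = 2 · 2^(j/2)` give `2^j q R = 8 · 2^(-j/2)`. For `j = -m ≤ 0`,
  -- `q = 1` and the shrinking width `R = 2 · 2^(-m/2)` alone yields convergence.
  refine ⟨(K * 8 * dyadicSum + K * 2 * dyadicSum).toNNReal, ?_⟩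
  intro ε hε hε1 G f hG hf
  rw [ENNReal.coe_toNNReal (ENNReal.add_ne_top.2
    ⟨ENNReal.mul_ne_top (ENNReal.mul_ne_top hK (by norm_num)) dyadicSum_ne_top,
     ENNReal.mul_ne_top (ENNReal.mul_ne_top hK (by norm_num)) dyadicSum_ne_top⟩)]
  obtain ⟨G', hG'm, hGG'⟩ := hG.1.aemeasurable
  have hG' : Integrable G' := hG.congr hGG'
  have hF : fourierL1 G = fourierL1 G' := by
    ext ξ
    refine integral_congr_ae ?_
    filter_upwards [hGG'] with y hy
    rw [hy]
  rw [hF] at hf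
  rw [eLpNorm_congr_ae hGG']
  have hsupp : ∀ᵐ p : Plane, p.fst ∉ Itilde 0 → f p = 0 := by
    filter_upwards [hf] with p hp hnot
    have : 2 < |p.fst| := by
      by_contra! hle
      exact hnot (by simpa [Itilde] using abs_le.1 hle)
    rw [hp, lowBump_eq_zero this]
    simp
  rw [normY0, if_pos hsupp]
  have hcongr : ∀ l : ℤ, invL1L2 (fun p => (chi η₀ l p.snd : ℂ) * f p)
      = invL1L2 (fun p => (chi η₀ l p.snd : ℂ) *
          (((lowBump p.fst : ℂ) * fourierL1 G' p.fst) * multiplier ψ ε p.fst p.snd)) := by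
    intro l
    refine invL1L2_congr ?_
    filter_upwards [hf] with p hp
    rw [hp]
  have hsq : ∀ m : ℕ, (√2 ^ m) ^ 2 = (2 : ℝ) ^ m := fun m => by
    rw [← pow_mul, mul_comm, pow_mul, Real.sq_sqrt zero_le_two]
  rw [add_mul]
  refine add_le_add ?_ ?_
  · calc _ ≤ ∑' m : ℕ, K * 8 * ENNReal.ofReal ((√2)⁻¹ ^ (m + 1)) * eLpNorm G' 1 volume := by
          refine ENNReal.tsum_le_tsum fun m => ?_
          rw [eta_succ, hcongr]
          refine (mul_le_mul_right (h ε hε hε1 ((m + 1 : ℕ) : ℤ) (4 / 4 ^ (m + 1))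
            (2 * √2 ^ (m + 1)) (by positivity) (by positivity) ?_ G' hG'm hG') _).trans
            (le_of_eq ?_)
          · intro τ hτ
            rw [← eta_succ] at hτ
            constructor
            · refine (abs_le_of_eta_ne_zero hη₀ hτ).trans ?_
              rw [mul_pow, hsq]
              linarith [show (0 : ℝ) < 2 ^ (m + 1) by positivity]
            · rw [div_le_div_iff₀ (by positivity) (by positivity)]
              linarith [le_sq_of_eta_ne_zero hη₀ hτ]
          · have e : (2 : ℝ≥0∞) ^ (m + 1) * ENNReal.ofReal (4 / 4 ^ (m + 1) * (2 * √2 ^ (m + 1)))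
                = 8 * ENNReal.ofReal ((√2)⁻¹ ^ (m + 1)) := by
              rw [show (2 : ℝ≥0∞) ^ (m + 1) = ENNReal.ofReal (2 ^ (m + 1)) by
                  rw [ENNReal.ofReal_pow zero_le_two]; simp,
                show (8 : ℝ≥0∞) = ENNReal.ofReal 8 by simp, ← ENNReal.ofReal_mul (by positivity),
                ← ENNReal.ofReal_mul (by positivity)]
              congr 1
              have h4 : (4 : ℝ) ^ (m + 1) = 2 ^ (m + 1) * (√2 ^ (m + 1)) ^ 2 := by
                rw [hsq, ← mul_pow]; norm_num
              rw [h4, inv_pow]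
              field_simp
              norm_num
            calc _ = K * ((2 : ℝ≥0∞) ^ (m + 1) *
                  ENNReal.ofReal (4 / 4 ^ (m + 1) * (2 * √2 ^ (m + 1)))) * eLpNorm G' 1 volume := by
                  ring
              _ = _ := by rw [e]; ring
      _ ≤ _ := by
          rw [ENNReal.tsum_mul_right, ENNReal.tsum_mul_left]
          gcongr
          refine le_trans ?_ tsum_ofReal_pow_le
          exact ENNReal.tsum_comp_le_tsum_of_injective (f := fun m : ℕ => m + 1)
            (add_left_injective 1) fun m : ℕ => ENNReal.ofReal ((√2)⁻¹ ^ m)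
  · calc _ ≤ ∑' m : ℕ, K * 2 * ENNReal.ofReal ((√2)⁻¹ ^ m) * eLpNorm G' 1 volume := by
          refine ENNReal.tsum_le_tsum fun m => ?_
          rw [hcongr]
          refine (h ε hε hε1 (-(m : ℤ)) 1 (2 * (√2)⁻¹ ^ m) zero_le_one (by positivity) ?_
            G' hG'm hG').trans (le_of_eq ?_)
          · intro τ hτ
            constructor
            · refine (abs_le_of_chi_ne_zero hη₀ hτ).trans ?_
              rw [mul_pow, inv_pow, inv_pow, hsq, zpow_neg, zpow_natCast]
              have : (0 : ℝ) < (2 ^ m)⁻¹ := by positivity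
              linarith
            · rw [div_le_one (by positivity)]
              nlinarith [sq_nonneg τ]
          · rw [one_mul, ENNReal.ofReal_mul zero_le_two]
            simp only [ENNReal.ofReal_ofNat]
            ring
      _ ≤ _ := by
          rw [ENNReal.tsum_mul_right, ENNReal.tsum_mul_left]
          gcongr
          exact tsum_ofReal_pow_le

end LowFrequency

/-! ### Assembly -/

section Assembly

variable {η₀ ψ : ℝ → ℝ}

lemma memLp_eta_mul (hη₀ : IsCutoff η₀) (k : ℕ) (v : L2 ℝ) :
    MemLp (fun ξ => (eta η₀ k ξ : ℂ) * v ξ) 2 volume := by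
  refine (Lp.memLp v).of_le ((Complex.continuous_ofReal.comp
    (continuous_eta hη₀ k)).aestronglyMeasurable.mul (Lp.memLp v).1)
    (Eventually.of_forall fun ξ => ?_)
  rw [norm_mul, Complex.norm_real]
  exact mul_le_of_le_one_left (norm_nonneg _) (abs_eta_le_one hη₀ k ξ)

lemma normYHigh_zero (k : ℕ) : normYHigh k 0 = 0 := by
  have h0 := Lp.coeFn_zero ℂ 2 (volume : Measure Plane)
  have hsupp : ∀ᵐ p : Plane, p ∉ ⋃ j ∈ Finset.range k, D k j → (0 : L2 Plane) p = 0 := by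
    filter_upwards [h0] with p hp _
    rw [hp, Pi.zero_apply]
  have h1 : (fun p : Plane => (((p.snd - omega p.fst : ℝ) : ℂ) + Complex.I) * (0 : L2 Plane) p)
      =ᵐ[volume] 0 := by
    filter_upwards [h0] with p hp
    rw [hp, Pi.zero_apply, mul_zero]
  rw [normYHigh, if_pos hsupp, invL1L2_congr h1, invL1L2_zero, mul_zero]

/-- In the sum space the component in `Y_k` is chosen to be zero. -/
lemma normZ_le_normX {k : ℕ} (hk : k ≠ 0) (f : L2 Plane) : normZ η₀ k f ≤ normX η₀ k f := by
  rw [normZ]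
  split_ifs
  · exact le_rfl
  · refine (iInf_le _ f).trans ((iInf_le _ 0).trans ((iInf_le _ (add_zero f).symm).trans ?_))
    rw [normYHigh_zero, add_zero]

lemma normZDist_high_le (hη₀ : IsCutoff η₀) (hψ : IsCutoff ψ) :
    ∃ C : ℝ≥0, ∀ (ε : ℝ) (hε : 0 ≤ ε), ε ≤ 1 → ∀ (φ : L2 ℝ) (k : ℕ), k ≠ 0 →
      normZDist η₀ k (TemperedDistribution.smulLeftCLM ℂ (fun p : Plane => (eta η₀ k p.fst : ℂ))
        (oneSubDtauSq (fourierDist Plane (localizedFlow ψ hψ ε hε φ))))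
      ≤ C * eLpNorm (fun ξ => (eta η₀ k ξ : ℂ) * fourierL2 ℝ φ ξ) 2 volume := by
  obtain ⟨C, h⟩ := normX_le_high hη₀ hψ
  refine ⟨C, fun ε hε hε1 φ k hk => ?_⟩
  have hF := memLp_mul_multiplier hψ hε (memLp_eta_mul hη₀ k (fourierL2 ℝ φ))
  refine (iInf₂_le (hF.toLp _) (toTemperedDistribution_eq_localizedFlow hη₀ hψ hε φ k
    hF.coeFn_toLp)).trans ((normZ_le_normX hk _).trans ?_)
  exact h ε hε hε1 k _ _ hk (Lp.memLp (fourierL2 ℝ φ)).1 hF.coeFn_toLp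

/-- Every decomposition admissible for `B₀` yields one admissible for `Z₀`: the transform of `G`
feeds `Y₀` and the remainder feeds `X₀`. -/
lemma normZDist_low_le (hη₀ : IsCutoff η₀) (hψ : IsCutoff ψ) :
    ∃ C : ℝ≥0, ∀ (ε : ℝ) (hε : 0 ≤ ε), ε ≤ 1 → ∀ φ : L2 ℝ,
      normZDist η₀ 0 (TemperedDistribution.smulLeftCLM ℂ (fun p : Plane => (eta η₀ 0 p.fst : ℂ))
        (oneSubDtauSq (fourierDist Plane (localizedFlow ψ hψ ε hε φ))))
      ≤ C * normB0 η₀ (fun ξ => (eta η₀ 0 ξ : ℂ) * fourierL2 ℝ φ ξ) := by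
  obtain ⟨C₁, h₁⟩ := normX_zero_le hη₀ hψ
  obtain ⟨C₂, h₂⟩ := normY0_le hη₀ hψ
  -- The summand `1` makes the constant nonzero, so it can be divided out before passing to the
  -- infimum.
  refine ⟨C₁ + C₂ + 1, fun ε hε hε1 φ => ?_⟩
  set f : ℝ → ℂ := fun ξ => (eta η₀ 0 ξ : ℂ) * fourierL2 ℝ φ ξ with hfdef
  have hf : MemLp f 2 volume := memLp_eta_mul hη₀ 0 (fourierL2 ℝ φ)
  have hbump : ∀ ξ, (lowBump ξ : ℂ) * f ξ = f ξ := by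
    intro ξ
    by_cases h0 : eta η₀ 0 ξ = 0
    · simp [hfdef, h0]
    · have : |ξ| ≤ 8 / 5 := by simpa using abs_le_of_eta_ne_zero hη₀ h0
      rw [lowBump_eq_one this, Complex.ofReal_one, one_mul]
  rw [mul_comm, ← ENNReal.div_le_iff (by simp) ENNReal.coe_ne_top, normB0]
  split_ifs with hcond
  swap
  · exact le_top
  refine le_iInf fun G => le_iInf fun h => le_iInf fun hG => le_iInf fun hfGh => ?_
  rw [ENNReal.div_le_iff (by simp) ENNReal.coe_ne_top, mul_comm]
  set g₁ : ℝ → ℂ := fun ξ => (lowBump ξ : ℂ) * fourierL1 G ξ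
  -- `𝓕G` and `h` need not be supported in `[-2, 2]`, so both are cut off by the bump, which leaves
  -- `f` unchanged. Defining `g₂` as a difference makes it vanish outside `[-2, 2]` everywhere,
  -- although it equals the bump times `h` only almost everywhere.
  set g₂ : ℝ → ℂ := fun ξ => f ξ - g₁ ξ with hg₂def
  have hg₁ : MemLp g₁ 2 volume := by
    have hc : Continuous g₁ :=
      (Complex.continuous_ofReal.comp lowBump.continuous).mul (continuous_fourierL1 hG)
    have hs : HasCompactSupport fun ξ => (lowBump ξ : ℂ) :=
      lowBump.hasCompactSupport.comp_left (g := fun x : ℝ => (x : ℂ)) Complex.ofReal_zero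
    exact hc.memLp_of_hasCompactSupport hs.mul_right
  have hg₂ : MemLp g₂ 2 volume := hf.sub hg₁
  have hF₁ := memLp_mul_multiplier hψ hε hg₁
  have hF₂ := memLp_mul_multiplier hψ hε hg₂
  have hF : ((hF₂.toLp _ + hF₁.toLp _ : L2 Plane) : Plane → ℂ) =ᵐ[volume] fun p : Plane =>
      ((eta η₀ 0 p.fst : ℂ) * fourierL2 ℝ φ p.fst) * multiplier ψ ε p.fst p.snd := by
    filter_upwards [Lp.coeFn_add (hF₂.toLp _) (hF₁.toLp _), hF₁.coeFn_toLp, hF₂.coeFn_toLp]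
      with p e1 e2 e3
    rw [e1, Pi.add_apply, e2, e3]
    simp only [g₂, hfdef]
    ring
  refine (iInf₂_le (hF₂.toLp _ + hF₁.toLp _)
    (toTemperedDistribution_eq_localizedFlow hη₀ hψ hε φ 0 hF)).trans ?_
  rw [normZ, if_neg (by norm_num)]
  refine (iInf_le _ (hF₂.toLp _)).trans ((iInf_le _ (hF₁.toLp _)).trans
    ((iInf_le _ rfl).trans ?_))
  rw [if_pos rfl]
  have hsupp : ∀ ξ, 2 < |ξ| → g₂ ξ = 0 := by
    intro ξ hξ
    rw [hg₂def]
    dsimp only [g₁]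
    rw [← hbump ξ, lowBump_eq_zero hξ]
    simp
  have b1 := h₁ ε hε hε1 g₂ _ hg₂.1 hsupp hF₂.coeFn_toLp
  have b2 := h₂ ε hε hε1 G _ hG hF₁.coeFn_toLp
  have b3 : ∑' m : ℕ, (2 : ℝ≥0∞) ^ (-(1 - (m : ℝ)) / 2) *
        eLpNorm (fun ξ => (chi η₀ (1 - (m : ℤ)) ξ : ℂ) * g₂ ξ) 2 volume
      ≤ ∑' m : ℕ, (2 : ℝ≥0∞) ^ (-(1 - (m : ℝ)) / 2) *
        eLpNorm (fun ξ => (chi η₀ (1 - (m : ℤ)) ξ : ℂ) * h ξ) 2 volume := by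
    refine ENNReal.tsum_le_tsum fun m => ?_
    gcongr
    refine eLpNorm_mono_ae ?_
    filter_upwards [hfGh] with ξ hξ
    have e : g₂ ξ = (lowBump ξ : ℂ) * h ξ := by
      rw [hg₂def]
      dsimp only [g₁]
      rw [← hbump ξ, hξ, Pi.add_apply]
      ring
    rw [e, norm_mul, norm_mul, norm_mul, Complex.norm_real (lowBump ξ)]
    gcongr
    exact mul_le_of_le_one_left (norm_nonneg _) (abs_lowBump_le_one ξ)
  set S := ∑' m : ℕ, (2 : ℝ≥0∞) ^ (-(1 - (m : ℝ)) / 2) *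
        eLpNorm (fun ξ => (chi η₀ (1 - (m : ℤ)) ξ : ℂ) * h ξ) 2 volume
  calc _ ≤ C₁ * S + C₂ * eLpNorm G 1 volume :=
        add_le_add (b1.trans (mul_le_mul_right b3 _)) b2
    _ ≤ ((C₁ + C₂ + 1 : ℝ≥0) : ℝ≥0∞) * S + ((C₁ + C₂ + 1 : ℝ≥0) : ℝ≥0∞) * eLpNorm G 1 volume := by
        gcongr
        · exact le_add_right le_self_add
        · exact le_add_right le_add_self
    _ = _ := by rw [← mul_add, add_comm S]

end Assembly

end BOB

end

theorem lemma3p1 (η₀ ψ : ℝ → ℝ) (hη₀ : BOB.IsCutoff η₀) (hψ : BOB.IsCutoff ψ) :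
    ∃ C : ℝ≥0, ∀ σ : ℝ, 0 ≤ σ → ∀ (ε : ℝ) (hε : 0 ≤ ε), ε ≤ 1 →
      ∀ φ : BOB.L2 ℝ, BOB.normHtilde η₀ σ φ < ⊤ →
        BOB.normF η₀ σ (BOB.localizedFlow ψ hψ ε hε φ) ≤ C * BOB.normHtilde η₀ σ φ := by
  obtain ⟨C₁, h₁⟩ := BOB.normZDist_low_le hη₀ hψ
  obtain ⟨C₂, h₂⟩ := BOB.normZDist_high_le hη₀ hψ
  refine ⟨C₁ + C₂, fun σ _ ε hε hε1 φ _ => ?_⟩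
  set C : ℝ≥0∞ := ((C₁ + C₂ : ℝ≥0) : ℝ≥0∞) with hC
  have hC₁ : (C₁ : ℝ≥0∞) ≤ C := by rw [hC, ENNReal.coe_add]; exact le_self_add
  have hC₂ : (C₂ : ℝ≥0∞) ≤ C := by rw [hC, ENNReal.coe_add]; exact le_add_self
  have e : C = (C ^ 2) ^ (1 / 2 : ℝ) := by
    rw [← ENNReal.rpow_natCast, ← ENNReal.rpow_mul]; norm_num
  rw [BOB.normF, BOB.normHtilde, e, ← ENNReal.mul_rpow_of_nonneg _ _ (by norm_num)]
  refine ENNReal.rpow_le_rpow ?_ (by norm_num)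
  -- The term `k = 0` is matched with the `B₀` part, and `k = m + 1` with the `m`-th term of the
  -- `H̃^σ` sum, which carries the same weight.
  rw [tsum_eq_zero_add' ENNReal.summable, mul_add, ← ENNReal.tsum_mul_left]
  refine add_le_add ?_ (ENNReal.tsum_le_tsum fun m => ?_)
  · rw [Nat.cast_zero, mul_zero, ENNReal.rpow_zero, one_mul, ← mul_pow]
    gcongr
    exact (h₁ ε hε hε1 φ).trans (mul_le_mul_left hC₁ _)
  · rw [Nat.cast_add, Nat.cast_one, mul_left_comm, ← mul_pow]
    gcongr
    exact (h₂ ε hε hε1 φ (m + 1) (Nat.succ_ne_zero m)).trans (mul_le_mul_left hC₂ _)
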